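/- **Model.** Algorithms are deterministic programs for the word RAM with unit-cost operations. Words have $O(\log n)$ bits on inputs of size $n$; for a dynamic problem on an $N$-vertex graph with $m$ operations they have $O(\log(N+m))$ bits. **APSP conjecture.** For every $\varepsilon>0$ there is a $c$ such that no algorithm solves the all pairs shortest paths problem on $n$-vertex directed graphs without negative cycles, with integer edge weights in $[-n^c,n^c]$, in time $O(n^{3-\varepsilon})$. **Dynamic APSP in planar graphs.** An undirected planar graph on $N$ vertices with integer edge weights in $\{0,\dots,N^c\}$ is given for preprocessing. Afterwards an online sequence of updates and queries has to be processed. A query asks for the distance between two given vertices in the current graph (or reports that they are not connected). There are two variants: (a) an update inserts an edge, with a given weight, or removes an edge, the graph remaining planar; (b) an update changes the weight of an existing edge. All weights stay in $\{0,\dots,N^c\}$. The problem is solved with preprocessing time $O(N^p)$ and amortized time $O(N^a)$ for both updates and queries if, for every $m$ and every sequence of $m$ operations, the preprocessing and the $m$ operations together take time $O(N^p+m\,N^a)$. **Theorem.** Assume the APSP conjecture, and let $\varepsilon>0$. Then for neither of the two variants is there an exponent $p$ such that, for every $c$, some algorithm solves the dynamic APSP problem in planar graphs on $N$ vertices with weights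 at most $N^c$ with preprocessing time $O(N^p)$ and amortized time $O(N^{1/2-\varepsilon})$ for both updates and queries. In particular, the lower bound holds even if only weight updates are allowed. -/

import Mathlib

/-! ## The machine model: a word RAM

A program works on finitely many integer registers and finitely many (unbounded, zero-initialised)
arrays. Every instruction and every elementary operation takes unit time, and every value that is
read, computed, stored or used as an address must be smaller in absolute value than the word
bound `W`; otherwise the computation is stuck. Taking `W` polynomial in the input size gives the
usual word RAM with words of `O(log n)` bits. -/

namespace WordRAM

/-- The contents of the registers and of the arrays. -/
structure State where
  reg : ℕ → ℤ
  arr : ℕ → ℤ → ℤ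

/-- The state with all registers and arrays equal to zero. -/
def State.zero : State := ⟨fun _ => 0, fun _ _ => 0⟩

def State.setReg (σ : State) (x : ℕ) (v : ℤ) : State :=
  { σ with reg := Function.update σ.reg x v }

def State.setArr (σ : State) (a : ℕ) (i v : ℤ) : State :=
  { σ with arr := Function.update σ.arr a (Function.update (σ.arr a) i v) }

/-- Put the given values in the registers `0, 1, 2, …`, leaving everything else unchanged. -/
def State.loadRegs (σ : State) (l : List ℤ) : State :=
  { σ with reg := fun x => if x < l.length then l.getD x 0 else σ.reg x }

/-- Put the given values in the cells `0, 1, 2, …` of the array `a`, and `0` in its other cells. -/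
def State.loadArr (σ : State) (a : ℕ) (l : List ℤ) : State :=
  { σ with arr := Function.update σ.arr a (fun i => if 0 ≤ i then l.getD i.toNat 0 else 0) }

/-- The elementary operations. Comparisons return `1` or `0`. -/
inductive BinOp
  | add | sub | mul | div | mod
  | lt | le | eq
  | band | bor | bxor | shl | shr

def BinOp.eval : BinOp → ℤ → ℤ → ℤ
  | .add, a, b => a + b
  | .sub, a, b => a - b
  | .mul, a, b => a * b
  | .div, a, b => a / b
  | .mod, a, b => a % b
  | .lt, a, b => if a < b then 1 else 0
  | .le, a, b => if a ≤ b then 1 else 0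
  | .eq, a, b => if a = b then 1 else 0
  | .band, a, b => Int.land a b
  | .bor, a, b => Int.lor a b
  | .bxor, a, b => Int.xor a b
  | .shl, a, b => a * 2 ^ b.toNat
  | .shr, a, b => a / 2 ^ b.toNat

/-- Integer expressions: constants, registers, array cells, elementary operations. -/
inductive RExpr
  | const (k : ℤ)
  | reg (x : ℕ)
  | get (a : ℕ) (i : RExpr)
  | bin (o : BinOp) (e f : RExpr)

/-- The value of an expression in a state. -/
def RExpr.eval (σ : State) : RExpr → ℤ
  | .const k => k
  | .reg x => σ.reg x
  | .get a i => σ.arr a (i.eval σ)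
  | .bin o e f => o.eval (e.eval σ) (f.eval σ)

/-- The number of elementary steps needed to evaluate an expression. -/
def RExpr.cost : RExpr → ℕ
  | .const _ => 1
  | .reg _ => 1
  | .get _ i => i.cost + 1
  | .bin _ e f => e.cost + f.cost + 1

/-- Every value arising in the evaluation of the expression fits in a word. -/
def RExpr.Fits (W : ℕ) (σ : State) : RExpr → Prop
  | .const k => |k| < (W : ℤ)
  | .reg x => |σ.reg x| < (W : ℤ)
  | .get a i => i.Fits W σ ∧ |σ.arr a (i.eval σ)| < (W : ℤ)
  | .bin o e f => e.Fits W σ ∧ f.Fits W σ ∧ |o.eval (e.eval σ) (f.eval σ)| < (W : ℤ)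

/-- Programs. -/
inductive Prog
  | skip
  | assign (x : ℕ) (e : RExpr)
  | put (a : ℕ) (i e : RExpr)
  | seq (p q : Prog)
  | cond (e : RExpr) (p q : Prog)
  | loop (e : RExpr) (p : Prog)

/-- `Exec W p σ t σ'`: with word bound `W`, the program `p` started in the state `σ` halts in the
state `σ'` after `t` steps, and all values occurring on the way fit in a word. `cond` branches on
whether its expression is nonzero, and `loop` repeats its body while its expression is nonzero. -/
inductive Exec (W : ℕ) : Prog → State → ℕ → State → Prop
  | skip (σ : State) : Exec W .skip σ 1 σ
  | assign (σ : State) (x : ℕ) (e : RExpr) (he : e.Fits W σ) :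
      Exec W (.assign x e) σ (e.cost + 1) (σ.setReg x (e.eval σ))
  | put (σ : State) (a : ℕ) (i e : RExpr) (hi : i.Fits W σ) (he : e.Fits W σ) :
      Exec W (.put a i e) σ (i.cost + e.cost + 1) (σ.setArr a (i.eval σ) (e.eval σ))
  | seq {p q : Prog} {σ₁ σ₂ σ₃ : State} {s t : ℕ} (hp : Exec W p σ₁ s σ₂)
      (hq : Exec W q σ₂ t σ₃) : Exec W (.seq p q) σ₁ (s + t) σ₃
  | condTrue {e : RExpr} {p q : Prog} {σ σ' : State} {t : ℕ} (hf : e.Fits W σ)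
      (he : e.eval σ ≠ 0) (hp : Exec W p σ t σ') : Exec W (.cond e p q) σ (e.cost + 1 + t) σ'
  | condFalse {e : RExpr} {p q : Prog} {σ σ' : State} {t : ℕ} (hf : e.Fits W σ)
      (he : e.eval σ = 0) (hq : Exec W q σ t σ') : Exec W (.cond e p q) σ (e.cost + 1 + t) σ'
  | loopStop {e : RExpr} {p : Prog} {σ : State} (hf : e.Fits W σ) (he : e.eval σ = 0) :
      Exec W (.loop e p) σ (e.cost + 1) σ
  | loopStep {e : RExpr} {p : Prog} {σ₁ σ₂ σ₃ : State} {s t : ℕ} (hf : e.Fits W σ₁)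
      (he : e.eval σ₁ ≠ 0) (hp : Exec W p σ₁ s σ₂) (hl : Exec W (.loop e p) σ₂ t σ₃) :
      Exec W (.loop e p) σ₁ (e.cost + 1 + s + t) σ₃

end WordRAM

/-! ## The static all pairs shortest paths problem and the APSP conjecture -/

namespace APSP

open WordRAM

/-- A weighted directed graph on `n` vertices: `w i j` is the weight of the arc from `i` to `j`,
and `none` if there is no such arc. -/
abbrev WDigraph (n : ℕ) := Fin n → Fin n → Option ℤ

/-- `w.IsWalk i j ℓ`: there is a directed walk from `i` to `j` of total weight `ℓ`. -/
inductive IsWalk {n : ℕ} (w : WDigraph n) : Fin n → Fin n → ℤ → Prop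
  | nil (i : Fin n) : IsWalk w i i 0
  | cons {i j k : Fin n} {x ℓ : ℤ} (h : w i j = some x) (p : IsWalk w j k ℓ) :
      IsWalk w i k (x + ℓ)

def NoNegativeCycle {n : ℕ} (w : WDigraph n) : Prop :=
  ∀ i ℓ, IsWalk w i i ℓ → 0 ≤ ℓ

/-- The input: `n` in register `0`; the adjacency matrix, row by row, in array `0`; the matrix of
weights (`0` for a missing arc), row by row, in array `1`. -/
def inputState {n : ℕ} (w : WDigraph n) : State :=
  ((State.zero.loadRegs [(n : ℤ)]).loadArr 0
    (List.ofFn fun k : Fin (n * n) => if (w k.divNat k.modNat).isSome then 1 else 0)).loadArr 1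
    (List.ofFn fun k : Fin (n * n) => (w k.divNat k.modNat).getD 0)

/-- The output: array `2` tells, row by row, whether `j` is reachable from `i` (`1`) or
not (`0`), and array `3` contains the distances between the pairs for which it is. -/
def IsOutput {n : ℕ} (w : WDigraph n) (σ : State) : Prop :=
  ∀ i j : Fin n,
    (σ.arr 2 (i * n + j) = 1 ∧ IsLeast {ℓ | IsWalk w i j ℓ} (σ.arr 3 (i * n + j))) ∨
    (σ.arr 2 (i * n + j) = 0 ∧ ¬ ∃ ℓ, IsWalk w i j ℓ)

/-- All pairs shortest paths in `n`-vertex directed graphs without negative cycles, with integer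
weights of absolute value at most `n ^ c`, can be solved in time `O(n ^ a)` on a word RAM with
words of `O(log n)` bits. -/
def SolvableInTime (c : ℕ) (a : ℝ) : Prop :=
  ∃ (P : Prog) (K : ℝ) (k : ℕ), ∀ (n : ℕ) (w : WDigraph n), 1 ≤ n → NoNegativeCycle w →
    (∀ i j x, w i j = some x → |x| ≤ (n : ℤ) ^ c) →
    ∃ (t : ℕ) (σ : State), Exec ((n + 2) ^ k) P (inputState w) t σ ∧ IsOutput w σ ∧
      (t : ℝ) ≤ K * (n : ℝ) ^ a

/-- The APSP conjecture: no algorithm solves all pairs shortest paths, with polynomially bounded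
integer weights, in time `O(n ^ (3 - ε))` for any `ε > 0`. -/
def Conjecture : Prop :=
  ∀ ε : ℝ, 0 < ε → ∃ c : ℕ, ¬ SolvableInTime c (3 - ε)

end APSP

/-! ## Planar graphs -/

/-- A drawing of a graph in the plane without crossings: the vertices are distinct points, each
edge is a simple arc joining its endpoints whose interior contains no vertex, and the interiors of
distinct edges are disjoint. -/
structure PlaneDrawing {V : Type*} (G : SimpleGraph V) where
  point : V → ℝ × ℝ
  arc : Sym2 V → C(unitInterval, ℝ × ℝ)
  point_injective : Function.Injective point
  arc_injective : ∀ e ∈ G.edgeSet, Function.Injective (arc e)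
  arc_ends : ∀ e ∈ G.edgeSet, s(arc e 0, arc e 1) = Sym2.map point e
  arc_avoids : ∀ e ∈ G.edgeSet, ∀ t : unitInterval, 0 < t → t < 1 → ∀ v, arc e t ≠ point v
  arc_disjoint : ∀ e ∈ G.edgeSet, ∀ f ∈ G.edgeSet, e ≠ f →
    ∀ s t : unitInterval, 0 < s → s < 1 → 0 < t → t < 1 → arc e s ≠ arc f t

def IsPlanar {V : Type*} (G : SimpleGraph V) : Prop := Nonempty (PlaneDrawing G)

/-! ## The dynamic all pairs shortest paths problem in planar graphs -/

namespace DynAPSP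

open WordRAM

/-- An undirected graph on `N` vertices with nonnegative integer edge weights. (The values of
`weight` on pairs that are not edges are irrelevant.) -/
structure WGraph (N : ℕ) where
  graph : SimpleGraph (Fin N)
  weight : Sym2 (Fin N) → ℕ

/-- `d` is the distance of `u` and `v`: the least total weight of a walk between them. -/
def WGraph.IsDist {N : ℕ} (G : WGraph N) (u v : Fin N) (d : ℕ) : Prop :=
  IsLeast {ℓ | ∃ p : G.graph.Walk u v, (p.edges.map G.weight).sum = ℓ} d

/-- The two variants of the problem: edges are inserted and removed, or the weights of existing
edges are changed. -/
inductive Model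
  | edgeUpdates
  | weightUpdates

/-- The operations. -/
inductive Op (N : ℕ)
  | insertEdge (u v : Fin N) (x : ℕ)
  | removeEdge (u v : Fin N)
  | setWeight (u v : Fin N) (x : ℕ)
  | query (u v : Fin N)

/-- The graph after an operation. -/
def Op.apply {N : ℕ} (G : WGraph N) : Op N → WGraph N
  | .insertEdge u v x => ⟨G.graph ⊔ SimpleGraph.edge u v, Function.update G.weight s(u, v) x⟩
  | .removeEdge u v => ⟨G.graph.deleteEdges {s(u, v)}, G.weight⟩
  | .setWeight u v x => ⟨G.graph, Function.update G.weight s(u, v) x⟩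
  | .query _ _ => G

/-- The operation may be performed on the graph `G`, in the given model and with weights bounded
by `N ^ c`. -/
def Op.Valid {N : ℕ} (M : Model) (c : ℕ) (G : WGraph N) : Op N → Prop
  | .insertEdge u v x => M = .edgeUpdates ∧ u ≠ v ∧ ¬ G.graph.Adj u v ∧
      IsPlanar (G.graph ⊔ SimpleGraph.edge u v) ∧ x ≤ N ^ c
  | .removeEdge u v => M = .edgeUpdates ∧ G.graph.Adj u v
  | .setWeight u v x => M = .weightUpdates ∧ G.graph.Adj u v ∧ x ≤ N ^ c
  | .query _ _ => True

/-- All operations of the sequence may be performed, one after the other, starting from `G`. -/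
def ValidSeq {N : ℕ} (M : Model) (c : ℕ) : WGraph N → List (Op N) → Prop
  | _, [] => True
  | G, o :: os => o.Valid M c G ∧ ValidSeq M c (o.apply G) os

/-- The arguments of an operation, as passed to the program in the registers `0, 1, 2`. -/
def Op.args {N : ℕ} : Op N → List ℤ
  | .insertEdge u v x => [(u : ℤ), (v : ℤ), (x : ℤ)]
  | .removeEdge u v => [(u : ℤ), (v : ℤ)]
  | .setWeight u v x => [(u : ℤ), (v : ℤ), (x : ℤ)]
  | .query u v => [(u : ℤ), (v : ℤ)]

/-- The answer to a query is given in the registers `0` (is `v` reachable from `u`?) and `1` (the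
distance, if so). -/
def Op.Answered {N : ℕ} (G : WGraph N) (σ : State) : Op N → Prop
  | .query u v => (σ.reg 0 = 1 ∧ ∃ d : ℕ, σ.reg 1 = d ∧ G.IsDist u v d) ∨
      (σ.reg 0 = 0 ∧ ¬ G.graph.Reachable u v)
  | _ => True

/-- A dynamic algorithm: a program for the preprocessing and one for each type of operation. They
share the memory, which is kept between the operations. -/
structure Algorithm where
  preprocess : Prog
  insertEdge : Prog
  removeEdge : Prog
  setWeight : Prog
  query : Prog

def Algorithm.prog (D : Algorithm) {N : ℕ} : Op N → Prog
  | .insertEdge _ _ _ => D.insertEdge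
  | .removeEdge _ _ => D.removeEdge
  | .setWeight _ _ _ => D.setWeight
  | .query _ _ => D.query

/-- `D.Serves W G σ os T`: when the memory contents are `σ` and the current graph is `G`, the
algorithm performs the operations `os` one after the other in total time `T`, with correct
answers to all queries. -/
def Algorithm.Serves (D : Algorithm) (W : ℕ) {N : ℕ} :
    WGraph N → State → List (Op N) → ℕ → Prop
  | _, _, [], T => T = 0
  | G, σ, o :: os, T => ∃ (t T' : ℕ) (σ' : State),
      Exec W (D.prog o) (σ.loadRegs o.args) t σ' ∧ o.Answered G σ' ∧
      D.Serves W (o.apply G) σ' os T' ∧ T = t + T'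

/-- The list contains each edge of the graph exactly once, in one of its two orientations. -/
def IsEdgeList {N : ℕ} (G : WGraph N) (L : List (Fin N × Fin N)) : Prop :=
  (L.map fun p => s(p.1, p.2)).Nodup ∧
    ∀ e : Sym2 (Fin N), e ∈ L.map (fun p => s(p.1, p.2)) ↔ e ∈ G.graph.edgeSet

/-- The input of the preprocessing: the numbers of vertices and of edges in the registers `0` and
`1`, and the endpoints and the weights of the edges in the arrays `0`, `1` and `2`. -/
def inputState {N : ℕ} (G : WGraph N) (L : List (Fin N × Fin N)) : State :=
  (((State.zero.loadRegs [(N : ℤ), (L.length : ℤ)]).loadArr 0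
    (L.map fun p => ((p.1 : ℕ) : ℤ))).loadArr 1
    (L.map fun p => ((p.2 : ℕ) : ℤ))).loadArr 2
    (L.map fun p => (G.weight s(p.1, p.2) : ℤ))

/-- In planar graphs on `N` vertices with weights at most `N ^ c`, the dynamic APSP problem can be
solved with preprocessing time `O(N ^ p)` and amortized time `O(N ^ a)` for updates and queries, on
a word RAM with words of `O(log (N + m))` bits, where `m` is the number of operations: every
sequence of `m` operations, together with the preprocessing, takes time
`O(N ^ p + m * N ^ a)`. -/
def SolvableInTime (M : Model) (c p : ℕ) (a : ℝ) : Prop :=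
  ∃ (D : Algorithm) (K : ℝ) (k : ℕ), ∀ (N : ℕ) (G : WGraph N) (L : List (Fin N × Fin N)),
    1 ≤ N → IsPlanar G.graph → (∀ e ∈ G.graph.edgeSet, G.weight e ≤ N ^ c) → IsEdgeList G L →
    ∃ (T₀ : ℕ) (σ₀ : State), Exec ((N + 2) ^ k) D.preprocess (inputState G L) T₀ σ₀ ∧
      ∀ os : List (Op N), ValidSeq M c G os →
        ∃ T : ℕ, D.Serves ((N + os.length + 2) ^ k) G σ₀ os T ∧
          (T₀ + T : ℝ) ≤ K * ((N : ℝ) ^ p + os.length * (N : ℝ) ^ a)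

end DynAPSP

/-! The reduction computes all pairs shortest paths by repeated min-plus squaring of a distance
matrix. Each squaring is cut into small matrix blocks, and every block is handed to the dynamic
planar algorithm as a weighted grid.

The gadget. A `b × b` block `A` and a vector `v` of length `b` are stored in a grid with `2b` rows
and `b` columns. The edges of row `i < b` carry the differences of consecutive entries of row `i` of
`A`, so they telescope along a row. The `b` edges between the two middle rows carry `v`. Large base
weights are added: a row edge costs more the closer its row is to the middle, and column edges are
more expensive still. A shortest path from the first vertex of row `i` to the last vertex of the
mirror row then follows row `i` to some column `x`, goes straight down, and follows the mirror row
to the end. Its length is a known constant, minus `A i 0`, plus the minimum over `x` of `A i x + v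
x`. The upper bound is this explicit walk. The lower bound is a potential that increases along no
edge by more than the weight of the edge (`potential_le`, `isDist_iff`). One query thus returns one
entry of the min-plus product of `A` and `v`, and changing `v` touches only `b` edges, by weight
changes or by deletion and reinsertion.

The count. The input is padded to `P = b ^ q` vertices, with `P` within a constant factor of `n`,
and the matrix is cut into `Q ^ 2` blocks, where `Q = P / b`. For each block the algorithm
preprocesses a grid with `N = 2 b ^ 2` vertices. For each of the `P` columns of the matrix it then
loads `b` entries of the column as the vector and asks `b` queries. Up to constants these are `P ^ 3
/ b` operations per squaring. At amortized cost `N ^ (1/2 - ε)`, which is about `b ^ (1 - 2 ε)`,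
they take time `P ^ 3 * b ^ (-2 ε)`. Because `q = 2 p + 2`, preprocessing costs less than that,
whatever the polynomial exponent `p` is. A logarithmic number of squarings suffices, and the
logarithm is absorbed by half of the gain, leaving `n ^ (3 - ε / q)` (`time_le`).

The machine. Each run of the dynamic algorithm has to start on an empty memory. Erasing is avoided
by interleaving many virtual memories: a program is rewritten to act on the cells of one residue
class (`exec_relocate`), and every block of every squaring gets a class of its own. The amortized
bound concerns only whole operation sequences, so the simulation carries a deadline for the entire
remaining sequence (`Ready`). `run_askProgram`, `run_block`, `run_blocks`, `run_square` and
`run_apsp` build up the program, and `params_of_solves` checks that all numbers fit into words of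
logarithmic length. -/

namespace WordRAM

/-! ## Expressions -/

instance : Add RExpr := ⟨.bin .add⟩
instance : Sub RExpr := ⟨.bin .sub⟩
instance : Mul RExpr := ⟨.bin .mul⟩
instance : Div RExpr := ⟨.bin .div⟩
instance : Mod RExpr := ⟨.bin .mod⟩

namespace RExpr

def lt (e f : RExpr) : RExpr := .bin .lt e f
def le (e f : RExpr) : RExpr := .bin .le e f
def eq (e f : RExpr) : RExpr := .bin .eq e f

/-- `e` if the value of `g` is `1`, and `f` if it is `0`. -/
def sel (g e f : RExpr) : RExpr := g * e + (.const 1 - g) * f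

def pow (e : RExpr) : ℕ → RExpr
  | 0 => .const 1
  | k + 1 => pow e k * e

variable (σ : State) (e f g : RExpr)

@[simp] theorem eval_const (k : ℤ) : (const k).eval σ = k := rfl
@[simp] theorem eval_reg (x : ℕ) : (reg x).eval σ = σ.reg x := rfl
@[simp] theorem eval_get (a : ℕ) : (get a e).eval σ = σ.arr a (e.eval σ) := rfl
@[simp] theorem eval_add : (e + f).eval σ = e.eval σ + f.eval σ := rfl
@[simp] theorem eval_sub : (e - f).eval σ = e.eval σ - f.eval σ := rfl
@[simp] theorem eval_mul : (e * f).eval σ = e.eval σ * f.eval σ := rfl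
@[simp] theorem eval_div : (e / f).eval σ = e.eval σ / f.eval σ := rfl
@[simp] theorem eval_mod : (e % f).eval σ = e.eval σ % f.eval σ := rfl
@[simp] theorem eval_lt : (lt e f).eval σ = if e.eval σ < f.eval σ then 1 else 0 := rfl
@[simp] theorem eval_le : (le e f).eval σ = if e.eval σ ≤ f.eval σ then 1 else 0 := rfl
@[simp] theorem eval_eq : (eq e f).eval σ = if e.eval σ = f.eval σ then 1 else 0 := rfl
@[simp] theorem eval_pow (k : ℕ) : (pow e k).eval σ = e.eval σ ^ k := by
  induction k with
  | zero => simp [pow]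
  | succ k ih => simp [pow, ih, pow_succ]
theorem eval_sel {p : Prop} [Decidable p] (h : g.eval σ = if p then 1 else 0) :
    (sel g e f).eval σ = if p then e.eval σ else f.eval σ := by
  simp only [sel, eval_add, eval_mul, eval_sub, eval_const, h]
  split_ifs <;> ring

@[simp] theorem cost_const (k : ℤ) : (const k).cost = 1 := rfl
@[simp] theorem cost_reg (x : ℕ) : (reg x).cost = 1 := rfl
@[simp] theorem cost_get (a : ℕ) : (get a e).cost = e.cost + 1 := rfl
@[simp] theorem cost_add : (e + f).cost = e.cost + f.cost + 1 := rfl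
@[simp] theorem cost_sub : (e - f).cost = e.cost + f.cost + 1 := rfl
@[simp] theorem cost_mul : (e * f).cost = e.cost + f.cost + 1 := rfl
@[simp] theorem cost_div : (e / f).cost = e.cost + f.cost + 1 := rfl
@[simp] theorem cost_mod : (e % f).cost = e.cost + f.cost + 1 := rfl
@[simp] theorem cost_lt : (lt e f).cost = e.cost + f.cost + 1 := rfl
@[simp] theorem cost_le : (le e f).cost = e.cost + f.cost + 1 := rfl
@[simp] theorem cost_eq : (eq e f).cost = e.cost + f.cost + 1 := rfl
@[simp] theorem cost_sel : (sel g e f).cost = 2 * g.cost + e.cost + f.cost + 5 := by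
  simp only [sel, cost_add, cost_mul, cost_sub, cost_const]; ring
@[simp] theorem cost_pow (k : ℕ) : (pow e k).cost = k * (e.cost + 1) + 1 := by
  induction k with
  | zero => simp [pow]
  | succ k ih => simp only [pow, cost_mul, ih]; ring

/-- The expression uses no bit operations, and all constants, registers and array cells that are
read during its evaluation are at most `Z` in absolute value. -/
def Small (Z : ℕ) (σ : State) : RExpr → Prop
  | .const k => |k| ≤ (Z : ℤ)
  | .reg x => |σ.reg x| ≤ (Z : ℤ)
  | .get a i => i.Small Z σ ∧ |σ.arr a (i.eval σ)| ≤ (Z : ℤ)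
  | .bin o e f => (match o with
      | .band | .bor | .bxor | .shl | .shr => False
      | _ => True) ∧ e.Small Z σ ∧ f.Small Z σ

variable {Z : ℕ}
@[simp] theorem small_const (k : ℤ) : (const k).Small Z σ ↔ |k| ≤ (Z : ℤ) := Iff.rfl
@[simp] theorem small_reg (x : ℕ) : (reg x).Small Z σ ↔ |σ.reg x| ≤ (Z : ℤ) := Iff.rfl
@[simp] theorem small_get (a : ℕ) :
    (get a e).Small Z σ ↔ e.Small Z σ ∧ |σ.arr a (e.eval σ)| ≤ (Z : ℤ) := Iff.rfl
@[simp] theorem small_add : (e + f).Small Z σ ↔ e.Small Z σ ∧ f.Small Z σ := ⟨And.right, .intro trivial⟩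
@[simp] theorem small_sub : (e - f).Small Z σ ↔ e.Small Z σ ∧ f.Small Z σ := ⟨And.right, .intro trivial⟩
@[simp] theorem small_mul : (e * f).Small Z σ ↔ e.Small Z σ ∧ f.Small Z σ := ⟨And.right, .intro trivial⟩
@[simp] theorem small_div : (e / f).Small Z σ ↔ e.Small Z σ ∧ f.Small Z σ := ⟨And.right, .intro trivial⟩
@[simp] theorem small_mod : (e % f).Small Z σ ↔ e.Small Z σ ∧ f.Small Z σ := ⟨And.right, .intro trivial⟩
@[simp] theorem small_lt : (lt e f).Small Z σ ↔ e.Small Z σ ∧ f.Small Z σ := ⟨And.right, .intro trivial⟩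
@[simp] theorem small_le : (le e f).Small Z σ ↔ e.Small Z σ ∧ f.Small Z σ := ⟨And.right, .intro trivial⟩
@[simp] theorem small_eq : (eq e f).Small Z σ ↔ e.Small Z σ ∧ f.Small Z σ := ⟨And.right, .intro trivial⟩
@[simp] theorem small_sel :
    (sel g e f).Small Z σ ↔ g.Small Z σ ∧ e.Small Z σ ∧ f.Small Z σ ∧ 1 ≤ Z := by
  simp only [sel, small_add, small_mul, small_sub, small_const, abs_one]
  norm_cast; tauto
theorem Small.pow {σ : State} {e : RExpr} (h : e.Small Z σ) (hZ : 1 ≤ Z) (k : ℕ) :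
    (pow e k).Small Z σ := by
  induction k with
  | zero => simpa [RExpr.pow] using hZ
  | succ k ih => simpa [RExpr.pow] using ⟨ih, h⟩

theorem one_le_cost (e : RExpr) : 1 ≤ e.cost := by
  cases e <;> simp [cost]

/-- Multiplication is the worst operation, and it adds the exponents of the operands. The additional
factor `Z ≥ 2` that the node itself contributes covers addition, because `x + y ≤ 2 * x * y` for `x,
y ≥ 1`. -/
theorem Small.abs_eval_le {σ : State} (hZ : 2 ≤ Z) :
    ∀ {e : RExpr}, e.Small Z σ → |e.eval σ| ≤ (Z : ℤ) ^ e.cost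
  | .const k, h => by simpa using h
  | .reg x, h => by simpa using h
  | .get a i, h => by
      have hZ' : (1 : ℤ) ≤ Z := by exact_mod_cast (by omega : 1 ≤ Z)
      exact h.2.trans (le_self_pow₀ hZ' (by simp))
  | .bin o e f, ⟨ho, he, hf⟩ => by
      have hZ' : (2 : ℤ) ≤ Z := by exact_mod_cast hZ
      have h1 := he.abs_eval_le hZ
      have h2 := hf.abs_eval_le hZ
      have p1 : (1 : ℤ) ≤ (Z : ℤ) ^ e.cost := one_le_pow₀ (by omega)
      have p2 : (1 : ℤ) ≤ (Z : ℤ) ^ f.cost := one_le_pow₀ (by omega)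
      have key : (Z : ℤ) ^ (bin o e f).cost = (Z : ℤ) ^ e.cost * (Z : ℤ) ^ f.cost * Z := by
        simp only [cost]; ring
      have hmul : (Z : ℤ) ^ e.cost * (Z : ℤ) ^ f.cost ≤ (Z : ℤ) ^ (bin o e f).cost := by
        rw [key]; nlinarith [mul_pos (by omega : (0 : ℤ) < Z ^ e.cost) (by omega : (0 : ℤ) < Z ^ f.cost)]
      have hsum : (Z : ℤ) ^ e.cost + (Z : ℤ) ^ f.cost ≤ (Z : ℤ) ^ (bin o e f).cost := by
        rw [key]; nlinarith [mul_nonneg (sub_nonneg.2 p1) (sub_nonneg.2 p2),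
          mul_pos (by omega : (0 : ℤ) < Z ^ e.cost) (by omega : (0 : ℤ) < Z ^ f.cost)]
      generalize (Z : ℤ) ^ (bin o e f).cost = X at *
      cases o <;> simp only [eval, BinOp.eval] at * <;> try exact ho.elim
      · exact (abs_add_le _ _).trans (by omega)
      · exact (abs_sub _ _).trans (by omega)
      · rw [abs_mul]; exact (mul_le_mul h1 h2 (abs_nonneg _) (by omega)).trans hmul
      · exact (Int.abs_ediv_le_abs _ _).trans (by omega)
      · rcases eq_or_ne (f.eval σ) 0 with h0 | h0
        · simp only [h0, Int.emod_zero]; omega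
        · rw [abs_of_nonneg (Int.emod_nonneg _ h0)]
          have := Int.emod_lt_abs (e.eval σ) h0
          omega
      all_goals split_ifs <;> simp <;> omega

/-- Reduces the word-size conditions at all nodes of an expression to a single inequality between
`Z`, the cost and `W`. -/
theorem Small.fits {W κ : ℕ} {σ : State} (hZ : 2 ≤ Z) (hW : Z ^ κ < W) :
    ∀ {e : RExpr}, e.Small Z σ → e.cost ≤ κ → e.Fits W σ
  | .const k, h, hκ => by
      have := Small.abs_eval_le hZ (e := .const k) h
      exact lt_of_le_of_lt (this.trans (pow_le_pow_right₀ (by exact_mod_cast (by omega : 1 ≤ Z)) hκ))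
        (by exact_mod_cast hW)
  | .reg x, h, hκ => by
      have := Small.abs_eval_le hZ (e := .reg x) h
      exact lt_of_le_of_lt (this.trans (pow_le_pow_right₀ (by exact_mod_cast (by omega : 1 ≤ Z)) hκ))
        (by exact_mod_cast hW)
  | .get a i, h, hκ => by
      have := Small.abs_eval_le hZ (e := .get a i) h
      simp only [cost] at hκ
      exact ⟨h.1.fits hZ hW (by omega), lt_of_le_of_lt (this.trans (pow_le_pow_right₀
        (by exact_mod_cast (by omega : 1 ≤ Z)) hκ)) (by exact_mod_cast hW)⟩
  | .bin o e f, h, hκ => by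
      have := Small.abs_eval_le hZ (e := .bin o e f) h
      simp only [cost] at hκ
      exact ⟨h.2.1.fits hZ hW (by omega), h.2.2.fits hZ hW (by omega), lt_of_le_of_lt (this.trans
        (pow_le_pow_right₀ (by exact_mod_cast (by omega : 1 ≤ Z)) hκ)) (by exact_mod_cast hW)⟩

end RExpr

@[simp] theorem State.setReg_reg (σ : State) (x : ℕ) (v : ℤ) :
    (σ.setReg x v).reg = Function.update σ.reg x v := rfl
@[simp] theorem State.setReg_arr (σ : State) (x : ℕ) (v : ℤ) : (σ.setReg x v).arr = σ.arr := rfl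
@[simp] theorem State.setArr_reg (σ : State) (a : ℕ) (i v : ℤ) : (σ.setArr a i v).reg = σ.reg := rfl
@[simp] theorem State.setArr_arr (σ : State) (a : ℕ) (i v : ℤ) :
    (σ.setArr a i v).arr = Function.update σ.arr a (Function.update (σ.arr a) i v) := rfl

/-! ## Total correctness with a clock -/

/-- With word bound `W`, started in `σ` when the clock shows `c`, the program halts in a state and
at a time satisfying `Q`. -/
def Run (W : ℕ) (p : Prog) (σ : State) (c : ℕ) (Q : State → ℕ → Prop) : Prop :=
  ∃ t σ', Exec W p σ t σ' ∧ Q σ' (c + t)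

namespace Run

variable {W : ℕ} {p p' : Prog} {σ : State} {c : ℕ} {Q Q' : State → ℕ → Prop}

theorem mono (h : Run W p σ c Q) (hQ : ∀ σ' c', Q σ' c' → Q' σ' c') : Run W p σ c Q' :=
  let ⟨t, σ', he, hq⟩ := h
  ⟨t, σ', he, hQ _ _ hq⟩

theorem seq (h : Run W p σ c fun σ' c' => Run W p' σ' c' Q) : Run W (.seq p p') σ c Q := by
  obtain ⟨t, σ', he, t', σ'', he', hq⟩ := h
  exact ⟨t + t', σ'', .seq he he', by rwa [← add_assoc]⟩

theorem assign {x : ℕ} {e : RExpr} (he : e.Fits W σ)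
    (hQ : Q (σ.setReg x (e.eval σ)) (c + (e.cost + 1))) : Run W (.assign x e) σ c Q :=
  ⟨_, _, .assign σ x e he, hQ⟩

theorem put {a : ℕ} {i e : RExpr} (hi : i.Fits W σ) (he : e.Fits W σ)
    (hQ : Q (σ.setArr a (i.eval σ) (e.eval σ)) (c + (i.cost + e.cost + 1))) :
    Run W (.put a i e) σ c Q :=
  ⟨_, _, .put σ a i e hi he, hQ⟩

/-- A loop that makes exactly `m` iterations. -/
theorem loop {e : RExpr} (Inv : ℕ → State → ℕ → Prop) (m : ℕ) (h : Inv 0 σ c)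
    (step : ∀ k < m, ∀ σ c, Inv k σ c →
      e.Fits W σ ∧ e.eval σ ≠ 0 ∧ Run W p σ (c + (e.cost + 1)) (Inv (k + 1)))
    (last : ∀ σ c, Inv m σ c → e.Fits W σ ∧ e.eval σ = 0 ∧ Q σ (c + (e.cost + 1))) :
    Run W (.loop e p) σ c Q := by
  suffices H : ∀ j k, k + j = m → ∀ σ c, Inv k σ c → Run W (.loop e p) σ c Q from
    H m 0 (by omega) σ c h
  intro j
  induction j with
  | zero =>
    intro k hk σ c hI
    obtain rfl : k = m := by omega
    obtain ⟨hf, he, hq⟩ := last σ c hI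
    exact ⟨_, σ, .loopStop hf he, hq⟩
  | succ j ih =>
    intro k hk σ c hI
    obtain ⟨hf, he, t, σ', hx, hI'⟩ := step k (by omega) σ c hI
    obtain ⟨t', σ'', hx', hq⟩ := ih (k + 1) (by omega) σ' _ hI'
    refine ⟨_, σ'', .loopStep hf he hx hx', ?_⟩
    convert hq using 1
    ring

end Run

/-- Repeat `p` with `r = 0, 1, …` as long as `r` is smaller than the value of `e`. -/
def Prog.forLoop (r : ℕ) (e : RExpr) (p : Prog) : Prog :=
  .seq (.assign r (.const 0)) (.loop (.lt (.reg r) e) (.seq p (.assign r (.reg r + .const 1))))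

/-- The clock offsets are `2` for the initialisation of the counter, `e.cost + 3` for each test and
`4` for each increment. The body has to leave the counter at `k`; the invariant is restored only
after the increment. -/
theorem Run.forLoop {W : ℕ} {p : Prog} {σ : State} {c : ℕ} {Q : State → ℕ → Prop} {r : ℕ}
    {e : RExpr} (Inv : ℕ → State → ℕ → Prop) (m : ℕ) (hW : 1 < W)
    (h : Inv 0 (σ.setReg r 0) (c + 2))
    (guard : ∀ k ≤ m, ∀ σ c, Inv k σ c →
      σ.reg r = k ∧ e.eval σ = m ∧ (RExpr.lt (.reg r) e).Fits W σ)
    (step : ∀ k < m, ∀ σ c, Inv k σ c → Run W p σ (c + (e.cost + 3)) fun σ' c' =>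
      σ'.reg r = k ∧ (k + 1 : ℤ) < W ∧ Inv (k + 1) (σ'.setReg r (k + 1 : ℕ)) (c' + 4))
    (last : ∀ σ c, Inv m σ c → Q σ (c + (e.cost + 3))) :
    Run W (Prog.forLoop r e p) σ c Q := by
  refine .seq (.assign (by simpa [RExpr.Fits] using by omega) ?_)
  refine .loop Inv m h (fun k hk σ c hI => ?_) (fun σ c hI => ?_)
  · obtain ⟨h1, h2, h3⟩ := guard k hk.le σ c hI
    refine ⟨h3, ?_, .seq ?_⟩
    · simp [h1, h2, hk]
    · have := step k hk σ c hI
      simp only [RExpr.cost_lt, RExpr.cost_reg]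
      rw [show 1 + e.cost + 1 + 1 = e.cost + 3 by ring]
      refine this.mono fun σ' c' ⟨h4, h5, h6⟩ => .assign ?_ ?_
      · have : ((k : ℤ)) < W := by omega
        refine ⟨?_, ?_, ?_⟩
        · simp only [RExpr.Fits, h4]; rwa [abs_of_nonneg (by positivity)]
        · simp only [RExpr.Fits, abs_one]; exact_mod_cast hW
        · simp only [RExpr.eval, h4, BinOp.eval]; rwa [abs_of_nonneg (by positivity)]
      · simpa [h4] using h6
  · obtain ⟨h1, h2, h3⟩ := guard m le_rfl σ c hI
    refine ⟨h3, by simp [h1, h2], ?_⟩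
    simp only [RExpr.cost_lt, RExpr.cost_reg]
    rw [show 1 + e.cost + 1 + 1 = e.cost + 3 by ring]
    exact last σ c hI

/-- The array `f` after writing `val 0, val 1, …, val (k - 1)` to the cells
`idx 0, idx 1, …, idx (k - 1)`. -/
def fillArr (f : ℤ → ℤ) (idx val : ℕ → ℤ) : ℕ → ℤ → ℤ
  | 0 => f
  | k + 1 => Function.update (fillArr f idx val k) (idx k) (val k)

theorem fillArr_of_ne {f : ℤ → ℤ} {idx val : ℕ → ℤ} {m : ℕ} {j : ℤ} (h : ∀ k < m, idx k ≠ j) :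
    fillArr f idx val m j = f j := by
  induction m with
  | zero => rfl
  | succ m ih =>
    rw [fillArr, Function.update_of_ne (h m (by omega)).symm, ih fun k hk => h k (by omega)]

theorem fillArr_idx {f : ℤ → ℤ} {idx val : ℕ → ℤ} {m k : ℕ} (hidx : Function.Injective idx)
    (hk : k < m) : fillArr f idx val m (idx k) = val k := by
  induction m with
  | zero => omega
  | succ m ih =>
    rcases eq_or_ne k m with rfl | hne
    · simp [fillArr]
    · rw [fillArr, Function.update_of_ne (hidx.ne hne), ih (by omega)]

theorem abs_fillArr_le {f : ℤ → ℤ} {idx val : ℕ → ℤ} {m : ℕ} {Z : ℤ} (hf : ∀ j, |f j| ≤ Z)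
    (hv : ∀ k < m, |val k| ≤ Z) (j : ℤ) : |fillArr f idx val m j| ≤ Z := by
  induction m with
  | zero => exact hf j
  | succ m ih =>
    rw [fillArr, Function.update_apply]
    split_ifs
    · exact hv m (by omega)
    · exact ih fun k hk => hv k (by omega)

/-- The state after a loop with counter `r` filling cells of the array `a`. -/
def State.filled (σ : State) (r a : ℕ) (idx val : ℕ → ℤ) (k : ℕ) : State :=
  ⟨Function.update σ.reg r k, Function.update σ.arr a (fillArr (σ.arr a) idx val k)⟩

@[simp] theorem State.filled_reg (σ : State) (r a : ℕ) (idx val : ℕ → ℤ) (k : ℕ) :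
    (σ.filled r a idx val k).reg = Function.update σ.reg r k := rfl
@[simp] theorem State.filled_arr (σ : State) (r a : ℕ) (idx val : ℕ → ℤ) (k : ℕ) :
    (σ.filled r a idx val k).arr = Function.update σ.arr a (fillArr (σ.arr a) idx val k) := rfl

/-- The state after `k` rounds is known in closed form, so the expressions need to be evaluated in
these states only. The `8` per round is `3` for the test, `1` for the write and `4` for the counter.
-/
theorem Run.fill {W : ℕ} {σ : State} {c : ℕ} {Q : State → ℕ → Prop} {r a : ℕ} {M i e : RExpr}
    (idx val : ℕ → ℤ) (m : ℕ) (hmW : (m : ℤ) < W) (hW : 1 < W)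
    (hM : ∀ k ≤ m, M.eval (σ.filled r a idx val k) = m ∧ M.Fits W (σ.filled r a idx val k))
    (hi : ∀ k < m, i.eval (σ.filled r a idx val k) = idx k ∧ i.Fits W (σ.filled r a idx val k))
    (he : ∀ k < m, e.eval (σ.filled r a idx val k) = val k ∧ e.Fits W (σ.filled r a idx val k))
    (hQ : Q (σ.filled r a idx val m)
      (c + (m * (M.cost + i.cost + e.cost + 8) + M.cost + 5))) :
    Run W (Prog.forLoop r M (.put a i e)) σ c Q := by
  refine Run.forLoop (fun k σ' c' => σ' = σ.filled r a idx val k ∧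
      c' = c + 2 + k * (M.cost + i.cost + e.cost + 8)) m hW ?_ ?_ ?_ ?_
  · exact ⟨by simp [State.setReg, State.filled, fillArr], by omega⟩
  · rintro k hk _ c' ⟨rfl, hc⟩
    refine ⟨by simp, (hM k hk).1, ?_, (hM k hk).2, ?_⟩
    · simp only [RExpr.Fits, State.filled_reg, Function.update_self, Nat.abs_cast]; omega
    · simp only [BinOp.eval]
      split_ifs <;> simp <;> omega
  · rintro k hk _ c' ⟨rfl, hc⟩
    refine .put (hi k hk).2 (he k hk).2 ⟨by simp, by omega, ?_, ?_⟩
    · rw [(hi k hk).1, (he k hk).1]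
      simp [State.setReg, State.setArr, State.filled, fillArr]
    · rw [add_mul]; omega
  · rintro _ c' ⟨rfl, hc⟩
    convert hQ using 1
    omega

end WordRAM

namespace WordRAM

/-! ## Running a program on one of several interleaved memories

The memories are numbered `0, …, S - 1`. Cell `i` of the array `a` of memory `I` is cell `i * S + I`
of the array `a + 7`, and its register `x` is cell `x * S + I` of the array `6`. The numbers `S` and
`I` are kept in the registers `5` and `6`. -/

def RExpr.cell (e : RExpr) : RExpr := e * .reg 5 + .reg 6

def RExpr.relocate : RExpr → RExpr
  | .const k => .const k
  | .reg x => .get 6 (cell (.const x))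
  | .get a i => .get (a + 7) (cell i.relocate)
  | .bin o e f => .bin o e.relocate f.relocate

def Prog.relocate : Prog → Prog
  | .skip => .skip
  | .assign x e => .put 6 (.cell (.const x)) e.relocate
  | .put a i e => .put (a + 7) (.cell i.relocate) e.relocate
  | .seq p q => .seq p.relocate q.relocate
  | .cond e p q => .cond e.relocate p.relocate q.relocate
  | .loop e p => .loop e.relocate p.relocate

/-- All registers in the expression are smaller than this number. -/
def RExpr.regBound : RExpr → ℕ
  | .const _ => 0
  | .reg x => x + 1
  | .get _ i => i.regBound
  | .bin _ e f => e.regBound + f.regBound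

/-- After relocation a register number becomes part of an address, so it must fit in a word itself.
Sums in place of maxima keep the bounds for subprograms linear. -/
def Prog.regBound : Prog → ℕ
  | .skip => 0
  | .assign x e => x + 1 + e.regBound
  | .put _ i e => i.regBound + e.regBound
  | .seq p q => p.regBound + q.regBound
  | .cond e p q => e.regBound + p.regBound + q.regBound
  | .loop e p => e.regBound + p.regBound

/-- Memory `I` of the state `τ` is `σ`. -/
structure Holds (S I : ℕ) (τ σ : State) : Prop where
  size : τ.reg 5 = S
  index : τ.reg 6 = I
  reg : ∀ x : ℕ, τ.arr 6 (x * S + I) = σ.reg x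
  arr : ∀ a i, τ.arr (a + 7) (i * S + I) = σ.arr a i

/-- The states `τ` and `τ'` differ at most in memory `I`. -/
structure Agree (S I : ℕ) (τ τ' : State) : Prop where
  reg : τ'.reg = τ.reg
  arr : ∀ a < 6, τ'.arr a = τ.arr a
  cell : ∀ a j, j % (S : ℤ) ≠ I → τ'.arr a j = τ.arr a j

theorem RExpr.Fits.abs_eval_lt {W : ℕ} {σ : State} {e : RExpr} (h : e.Fits W σ) :
    |e.eval σ| < (W : ℤ) := by
  cases e with
  | const k => exact h
  | reg x => exact h
  | get a i => exact h.2
  | bin o e f => exact h.2.2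

variable {S I W W' : ℕ} {τ σ : State}

theorem Agree.refl (τ : State) : Agree S I τ τ := ⟨rfl, fun _ _ => rfl, fun _ _ _ => rfl⟩

theorem Agree.trans {τ₁ τ₂ τ₃ : State} (h : Agree S I τ₁ τ₂) (h' : Agree S I τ₂ τ₃) :
    Agree S I τ₁ τ₃ :=
  ⟨h'.reg.trans h.reg, fun a ha => (h'.arr a ha).trans (h.arr a ha),
    fun a j hj => (h'.cell a j hj).trans (h.cell a j hj)⟩

theorem cell_emod (hI : I < S) (i : ℤ) : (i * S + I) % (S : ℤ) = I := by
  rw [Int.mul_add_emod_self_right]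
  exact Int.emod_eq_of_lt (by positivity) (by exact_mod_cast hI)

theorem cell_inj (hI : I < S) {i j : ℤ} : i * S + I = j * S + I ↔ i = j := by
  have : S ≠ 0 := by omega
  simp [this]

theorem Agree.setArr {a : ℕ} (ha : 6 ≤ a) (hI : I < S) (i v : ℤ) :
    Agree S I τ (τ.setArr a (i * S + I) v) where
  reg := rfl
  arr b hb := by simp [show b ≠ a by omega]
  cell b j hj := by
    rcases eq_or_ne b a with rfl | hb
    · have : j ≠ i * S + I := by rintro rfl; exact hj (cell_emod hI i)
      simp [this]
    · simp [hb]

theorem Holds.eval_relocate (h : Holds S I τ σ) : ∀ e : RExpr, e.relocate.eval τ = e.eval σ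
  | .const k => rfl
  | .reg x => by simp [RExpr.relocate, RExpr.cell, h.size, h.index, h.reg]
  | .get a i => by simp [RExpr.relocate, RExpr.cell, h.size, h.index, h.arr, h.eval_relocate i]
  | .bin o e f => by simp [RExpr.relocate, RExpr.eval, h.eval_relocate e, h.eval_relocate f]

/-- The factor is attained by reading a register: one step becomes an array access at an address
computed as `x * S + I`. -/
theorem RExpr.cost_relocate : ∀ e : RExpr, e.relocate.cost ≤ 6 * e.cost
  | .const k => by simp [relocate]
  | .reg x => by simp [relocate, cell]
  | .get a i => by
      have := i.cost_relocate
      simp only [relocate, cell, cost_get, cost_add, cost_mul, cost_reg]; omega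
  | .bin o e f => by
      have := e.cost_relocate
      have := f.cost_relocate
      simp only [relocate, cost]; omega

/-- Strictness of `|e.eval τ| < V` leaves one block of length `S`, which is room enough for the
offset `I`. -/
theorem cell_fits (hS : τ.reg 5 = S) (hI : τ.reg 6 = I) (hIS : I < S) {V : ℕ} (hW : V * S < W')
    {e : RExpr} (he : e.Fits W' τ) (hv : |e.eval τ| < (V : ℤ)) : e.cell.Fits W' τ := by
  have hV : (0 : ℤ) < V := lt_of_le_of_lt (abs_nonneg _) hv
  have hV' : 1 ≤ V := by exact_mod_cast hV
  have hSW : S < W' := lt_of_le_of_lt (by nlinarith) hW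
  have hWz : (V : ℤ) * S < W' := by exact_mod_cast hW
  have hSp : (0 : ℤ) < S := by exact_mod_cast (by omega : 0 < S)
  rw [abs_lt] at hv
  have hIS' : (I : ℤ) < S := by exact_mod_cast hIS
  have hI0 : (0 : ℤ) ≤ I := by positivity
  have h1 : e.eval τ * S ≤ (V - 1) * S := mul_le_mul_of_nonneg_right (by omega) hSp.le
  have h2 : -((V - 1 : ℤ) * S) ≤ e.eval τ * S := by
    rw [← neg_mul]; exact mul_le_mul_of_nonneg_right (by omega) hSp.le
  rw [sub_mul] at h1 h2
  refine ⟨⟨he, ?_, ?_⟩, ?_, ?_⟩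
  · simp only [RExpr.Fits, hS, Nat.abs_cast]; 
    exact_mod_cast hSW
  · simp only [RExpr.eval, BinOp.eval, hS, abs_lt]; constructor <;> linarith
  · simp only [RExpr.Fits, hI, Nat.abs_cast]; omega
  · simp only [RExpr.eval, BinOp.eval, hS, hI, abs_lt]; constructor <;> linarith

theorem Holds.fits_relocate (h : Holds S I τ σ) (hIS : I < S) (hW : W * S < W') :
    ∀ {e : RExpr}, e.Fits W σ → e.regBound * S < W' → e.relocate.Fits W' τ
  | .const k, he, _ => by
      have : W ≤ W' := le_trans (by nlinarith) hW.le
      exact lt_of_lt_of_le he (by exact_mod_cast this)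
  | .reg x, he, hx => by
      have hxW : x + 1 ≤ W' := by
        simp only [RExpr.regBound] at hx; nlinarith [Nat.le_mul_of_pos_right (x + 1) (by omega : 0 < S)]
      have : W ≤ W' := le_trans (by nlinarith) hW.le
      refine ⟨cell_fits h.size h.index hIS hx ?_ ?_, ?_⟩
      · simp only [RExpr.Fits, Nat.abs_cast]; omega
      · simp [RExpr.regBound]
      · exact lt_of_lt_of_le (by simpa [RExpr.Fits, RExpr.cell, h.size, h.index, h.reg] using he)
          (by exact_mod_cast this)
  | .get a i, he, hx => by
      have : W ≤ W' := le_trans (by nlinarith) hW.le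
      refine ⟨cell_fits h.size h.index hIS hW (h.fits_relocate hIS hW he.1 hx) ?_, ?_⟩
      · rw [h.eval_relocate]; exact he.1.abs_eval_lt
      · exact lt_of_lt_of_le (by simpa [RExpr.cell, h.size, h.index, h.arr, h.eval_relocate] using he.2)
          (by exact_mod_cast this)
  | .bin o e f, he, hx => by
      have : W ≤ W' := le_trans (by nlinarith) hW.le
      simp only [RExpr.regBound, add_mul] at hx
      refine ⟨h.fits_relocate hIS hW he.1 (by omega), h.fits_relocate hIS hW he.2.1 (by omega), ?_⟩
      rw [h.eval_relocate, h.eval_relocate]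
      exact lt_of_lt_of_le he.2.2 (by exact_mod_cast this)

theorem Holds.setReg (h : Holds S I τ σ) (hIS : I < S) (x : ℕ) (v : ℤ) :
    Holds S I (τ.setArr 6 (x * S + I) v) (σ.setReg x v) where
  size := h.size
  index := h.index
  reg y := by
    rcases eq_or_ne y x with rfl | hne
    · simp
    · have : (y : ℤ) * S + I ≠ x * S + I := by rw [Ne, cell_inj hIS]; exact_mod_cast hne
      simp [hne, this, h.reg]
  arr a i := by simp [h.arr]

theorem Holds.setArr (h : Holds S I τ σ) (hIS : I < S) (a : ℕ) (i v : ℤ) :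
    Holds S I (τ.setArr (a + 7) (i * S + I) v) (σ.setArr a i v) where
  size := h.size
  index := h.index
  reg y := by simp [h.reg]
  arr b j := by
    rcases eq_or_ne b a with rfl | hne
    · rcases eq_or_ne j i with rfl | hj
      · simp
      · have : j * S + I ≠ i * S + I := by rwa [Ne, cell_inj hIS]
        simp [hj, this, h.arr]
    · simp [hne, h.arr]

/-- Step by step simulation, by induction on the execution. Relocated programs write neither
registers nor arrays below `6`, and elsewhere only addresses congruent to `I` modulo `S`. The
registers and low arrays thus remain available to the surrounding program, and the other memories
stay intact. -/
theorem Holds.exec_relocate {p : Prog} {t : ℕ} {σ' : State} (hx : Exec W p σ t σ') (hIS : I < S)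
    (hW : W * S < W') : ∀ {τ : State}, Holds S I τ σ → p.regBound * S < W' →
      ∃ t' τ', Exec W' p.relocate τ t' τ' ∧ t' ≤ 6 * t ∧ Holds S I τ' σ' ∧ Agree S I τ τ' := by
  induction hx with
  | skip σ =>
    intro τ h _
    exact ⟨1, τ, .skip τ, by omega, h, .refl τ⟩
  | assign σ x e he =>
    intro τ h hp
    simp only [Prog.regBound, add_mul _ e.regBound] at hp
    have hi : (RExpr.cell (.const x)).Fits W' τ := by
      refine cell_fits h.size h.index hIS (V := x + 1) (by omega) ?_ (by simp)
      have : x < W' := lt_of_le_of_lt (by nlinarith) (by omega : (x + 1) * S < W')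
      simpa [RExpr.Fits] using this
    refine ⟨_, _, .put τ _ _ _ hi (h.fits_relocate hIS hW he (by omega)), ?_, ?_, ?_⟩
    · have := e.cost_relocate
      simp only [RExpr.cell, RExpr.cost_add, RExpr.cost_mul, RExpr.cost_reg, RExpr.cost_const]
      omega
    · simpa [RExpr.cell, h.size, h.index, h.eval_relocate] using h.setReg hIS x (e.eval σ)
    · simpa [RExpr.cell, h.size, h.index] using Agree.setArr le_rfl hIS x _
  | put σ a i e hi he =>
    intro τ h hp
    simp only [Prog.regBound, add_mul] at hp
    have hi' : (RExpr.cell i.relocate).Fits W' τ :=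
      cell_fits h.size h.index hIS hW (h.fits_relocate hIS hW hi (by omega))
        (by rw [h.eval_relocate]; exact hi.abs_eval_lt)
    refine ⟨_, _, .put τ _ _ _ hi' (h.fits_relocate hIS hW he (by omega)), ?_, ?_, ?_⟩
    · have := e.cost_relocate
      have := i.cost_relocate
      have := i.one_le_cost
      simp only [RExpr.cell, RExpr.cost_add, RExpr.cost_mul, RExpr.cost_reg]
      omega
    · simpa [RExpr.cell, h.size, h.index, h.eval_relocate] using
        h.setArr hIS a (i.eval σ) (e.eval σ)
    · simpa [RExpr.cell, h.size, h.index] using Agree.setArr (by omega) hIS _ _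
  | seq _ _ ih₁ ih₂ =>
    intro τ h hp
    simp only [Prog.regBound, add_mul] at hp
    obtain ⟨t₁, τ₁, x₁, c₁, h₁, a₁⟩ := ih₁ h (by omega)
    obtain ⟨t₂, τ₂, x₂, c₂, h₂, a₂⟩ := ih₂ h₁ (by omega)
    exact ⟨_, τ₂, .seq x₁ x₂, by omega, h₂, a₁.trans a₂⟩
  | @condTrue e _ _ _ _ _ hf he _ ih =>
    intro τ h hp
    simp only [Prog.regBound, add_mul] at hp
    obtain ⟨t₁, τ₁, x₁, c₁, h₁, a₁⟩ := ih h (by omega)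
    have := e.cost_relocate
    exact ⟨_, τ₁, .condTrue (h.fits_relocate hIS hW hf (by omega)) (by rwa [h.eval_relocate]) x₁,
      by omega, h₁, a₁⟩
  | @condFalse e _ _ _ _ _ hf he _ ih =>
    intro τ h hp
    simp only [Prog.regBound, add_mul] at hp
    obtain ⟨t₁, τ₁, x₁, c₁, h₁, a₁⟩ := ih h (by omega)
    have := e.cost_relocate
    exact ⟨_, τ₁, .condFalse (h.fits_relocate hIS hW hf (by omega)) (by rwa [h.eval_relocate]) x₁,
      by omega, h₁, a₁⟩
  | @loopStop e _ _ hf he =>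
    intro τ h hp
    simp only [Prog.regBound, add_mul] at hp
    have := e.cost_relocate
    exact ⟨_, τ, .loopStop (h.fits_relocate hIS hW hf (by omega)) (by rwa [h.eval_relocate]),
      by omega, h, .refl τ⟩
  | @loopStep e p _ _ _ _ _ hf he _ _ ih₁ ih₂ =>
    intro τ h hp
    have hp' := hp
    simp only [Prog.regBound, add_mul] at hp
    obtain ⟨t₁, τ₁, x₁, c₁, h₁, a₁⟩ := ih₁ h (by omega)
    obtain ⟨t₂, τ₂, x₂, c₂, h₂, a₂⟩ := ih₂ h₁ hp'
    have := e.cost_relocate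
    exact ⟨_, τ₂, .loopStep (h.fits_relocate hIS hW hf (by omega)) (by rwa [h.eval_relocate]) x₁ x₂,
      by omega, h₂, a₁.trans a₂⟩

theorem Run.relocate {p : Prog} {t c : ℕ} {σ' : State} {Q : State → ℕ → Prop}
    (hx : Exec W p σ t σ') (h : Holds S I τ σ) (hIS : I < S) (hW : W * S < W')
    (hp : p.regBound * S < W')
    (hQ : ∀ τ' c', Holds S I τ' σ' → Agree S I τ τ' → c' ≤ c + 6 * t → Q τ' c') :
    Run W' p.relocate τ c Q :=
  let ⟨t', τ', x, ht, h', a⟩ := h.exec_relocate hx hIS hW hp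
  ⟨t', τ', x, hQ _ _ h' a (by omega)⟩

end WordRAM

/-! ## Planarity of unit grid graphs -/

theorem Sym2.map_out {α β : Type*} (f : α → β) (e : Sym2 α) :
    e.map f = s(f e.out.1, f e.out.2) := by
  conv_lhs => rw [← Quot.out_eq e]
  rfl

section UnitGrid

variable {V : Type*} {G : SimpleGraph V} (f : V → ℤ × ℤ)

/-- The straight-line segment between the points of an edge. -/
noncomputable def segmentArc (e : Sym2 V) : C(unitInterval, ℝ × ℝ) where
  toFun t := ((f e.out.1).1 + t * ((f e.out.2).1 - (f e.out.1).1),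
    (f e.out.1).2 + t * ((f e.out.2).2 - (f e.out.1).2))
  continuous_toFun := by fun_prop

/-- Two lattice points at distance one. -/
def UnitStep (p q : ℤ × ℤ) : Prop := q = (p.1 + 1, p.2) ∨ q = (p.1, p.2 + 1)

theorem intCast_add_inj {m n : ℤ} {s t : ℝ} (hs : 0 < s ∧ s < 1) (ht : 0 < t ∧ t < 1)
    (h : (m : ℝ) + s = n + t) : m = n := by
  have h1 : (m : ℝ) < n + 1 := by linarith
  have h2 : (n : ℝ) < m + 1 := by linarith
  have h1' : m < n + 1 := by exact_mod_cast h1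
  have h2' : n < m + 1 := by exact_mod_cast h2
  omega

theorem intCast_add_ne {m n : ℤ} {s : ℝ} (hs : 0 < s ∧ s < 1) : (m : ℝ) + s ≠ n := by
  intro h
  have h1 : (m : ℝ) < n := by linarith
  have h2 : (n : ℝ) < m + 1 := by linarith
  have h1' : m < n := by exact_mod_cast h1
  have h2' : n < m + 1 := by exact_mod_cast h2
  omega

/-- An interior point of a unit lattice segment has one integer and one non-integer coordinate, and
these determine the lower left endpoint `p` and the direction. Naming `p` removes the dependence on
the arbitrary orientation chosen by `e.out`. -/
theorem segmentArc_interior {e : Sym2 V}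
    (h : UnitStep (f e.out.1) (f e.out.2) ∨ UnitStep (f e.out.2) (f e.out.1)) :
    ∃ p : ℤ × ℤ, (e.map f = s(p, (p.1 + 1, p.2)) ∧ ∀ t : unitInterval, 0 < t → t < 1 →
        ∃ s : ℝ, (0 < s ∧ s < 1) ∧ segmentArc f e t = ((p.1 : ℝ) + s, (p.2 : ℝ))) ∨
      (e.map f = s(p, (p.1, p.2 + 1)) ∧ ∀ t : unitInterval, 0 < t → t < 1 →
        ∃ s : ℝ, (0 < s ∧ s < 1) ∧ segmentArc f e t = ((p.1 : ℝ), (p.2 : ℝ) + s)) := by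
  have he := Sym2.map_out f e
  have pos : ∀ t : unitInterval, 0 < t → t < 1 → (0 : ℝ) < t ∧ (t : ℝ) < 1 := fun t h0 h1 => ⟨h0, h1⟩
  rcases h with (h | h) | (h | h)
  · refine ⟨f e.out.1, .inl ⟨by rw [he, h], fun t h0 h1 => ⟨t, pos t h0 h1, ?_⟩⟩⟩
    simp [segmentArc, h]
  · refine ⟨f e.out.1, .inr ⟨by rw [he, h], fun t h0 h1 => ⟨t, pos t h0 h1, ?_⟩⟩⟩
    simp [segmentArc, h]
  · refine ⟨f e.out.2, .inl ⟨by rw [he, h, Sym2.eq_swap], fun t h0 h1 => ⟨1 - t, ?_, ?_⟩⟩⟩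
    · have := pos t h0 h1; constructor <;> linarith
    · simp [segmentArc, h]; ring
  · refine ⟨f e.out.2, .inr ⟨by rw [he, h, Sym2.eq_swap], fun t h0 h1 => ⟨1 - t, ?_, ?_⟩⟩⟩
    · have := pos t h0 h1; constructor <;> linarith
    · simp [segmentArc, h]; ring

/-- A graph whose vertices are lattice points and whose edges join points at distance one is
planar. -/
theorem isPlanar_of_unitStep (hf : Function.Injective f)
    (hG : ∀ u v, G.Adj u v → UnitStep (f u) (f v) ∨ UnitStep (f v) (f u)) : IsPlanar G := by
  have hout : ∀ e ∈ G.edgeSet, G.Adj e.out.1 e.out.2 := by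
    intro e he
    rw [← Quot.out_eq e] at he
    exact he
  have hstep := fun e he => segmentArc_interior f (hG _ _ (hout e he))
  refine ⟨⟨fun v => ((f v).1, (f v).2), segmentArc f, ?_, ?_, ?_, ?_, ?_⟩⟩
  · intro u v h
    simp only [Prod.mk.injEq, Int.cast_inj] at h
    exact hf (Prod.ext h.1 h.2)
  · intro e he s t hst
    have := hG _ _ (hout e he)
    simp only [segmentArc, ContinuousMap.coe_mk, Prod.mk.injEq, add_right_inj, mul_eq_mul_right_iff] at hst
    apply Subtype.ext
    rcases this with (h | h) | (h | h) <;> rw [h] at hst <;> simpa using hst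
  · intro e he
    rw [Sym2.map_out]
    simp [segmentArc]
  · intro e he t h0 h1 v
    obtain ⟨p, ⟨-, h⟩ | ⟨-, h⟩⟩ := hstep e he <;> obtain ⟨s, hs, h⟩ := h t h0 h1 <;> rw [h] <;>
      simp only [ne_eq, Prod.mk.injEq, not_and_or]
    · exact .inl (intCast_add_ne hs)
    · exact .inr (intCast_add_ne hs)
  · intro e he e' he' hne s t hs0 hs1 ht0 ht1
    -- Parallel segments with a common interior point have the same `p`, hence are the same edge.
    -- For a horizontal and a vertical one, some coordinate would be both an integer and not.
    have hinj : e.map f ≠ e'.map f := (Sym2.map.injective hf).ne hne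
    obtain ⟨p, ⟨hp, h⟩ | ⟨hp, h⟩⟩ := hstep e he <;> obtain ⟨x, hx, h⟩ := h s hs0 hs1 <;>
      obtain ⟨p', ⟨hp', h'⟩ | ⟨hp', h'⟩⟩ := hstep e' he' <;> obtain ⟨x', hx', h'⟩ := h' t ht0 ht1 <;>
      rw [h, h'] <;> rw [hp, hp'] at hinj <;> simp only [ne_eq, Prod.mk.injEq] <;> rintro ⟨h1, h2⟩
    · have := intCast_add_inj hx hx' h1
      have h2 : p.2 = p'.2 := by exact_mod_cast h2
      rw [Prod.ext this h2] at hinj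
      exact hinj rfl
    · exact intCast_add_ne hx h1
    · exact intCast_add_ne hx h2
    · have := intCast_add_inj hx hx' h2
      have h1 : p.1 = p'.1 := by exact_mod_cast h1
      rw [Prod.ext h1 this] at hinj
      exact hinj rfl

end UnitGrid

/-! ## The grid graph of a matrix and a vector -/

namespace Grid

open DynAPSP

/-- The grid with `2 * b` rows of `b` vertices each: `R * b + x` is vertex `x` of row `R`. -/
def graph (b : ℕ) : SimpleGraph (Fin (2 * b * b)) :=
  SimpleGraph.fromRel fun u v => (v : ℕ) = u + b ∨ ((v : ℕ) = u + 1 ∧ (u : ℕ) % b + 1 < b)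

/-- The distance of a row from the nearer end of the grid. -/
def depth (b R : ℕ) : ℕ := min R (2 * b - 1 - R)

/-- The weight of the edge from `u` to `u + 1`. -/
def rowWeight (b U : ℕ) (A : ℕ → ℕ → ℤ) (u : ℕ) : ℤ :=
  4 * U * (depth b (u / b) + 1) +
    if u / b < b then A (u / b) (u % b + 1) - A (u / b) (u % b) else 0

/-- The weight of the edge from `u` to `u + b`. -/
def colWeight (b U : ℕ) (v : ℕ → ℤ) (u : ℕ) : ℤ :=
  4 * U * b + if u / b + 1 = b then v (u % b) else 0

/-- For `b = 1` consecutive numbers also satisfy the first condition, but in that case the grid has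
no row edges. Weights are integers here, so that differences of matrix entries can be handled
directly; on edges they turn out to be nonnegative, so `Int.toNat` loses nothing. -/
def weight (b U : ℕ) (A : ℕ → ℕ → ℤ) (v : ℕ → ℤ) (x y : ℕ) : ℤ :=
  if max x y = min x y + b then colWeight b U v (min x y) else rowWeight b U A (min x y)

def wgraph (b U : ℕ) (A : ℕ → ℕ → ℤ) (v : ℕ → ℤ) : WGraph (2 * b * b) where
  graph := graph b
  weight := Sym2.lift ⟨fun x y => (weight b U A v x y).toNat, fun x y => by
    simp only [weight, max_comm, min_comm]⟩

variable {b U : ℕ} {A : ℕ → ℕ → ℤ} {v : ℕ → ℤ}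

theorem adj_iff (hb : 0 < b) {x y : Fin (2 * b * b)} : (graph b).Adj x y ↔
    ((y : ℕ) = x + b ∨ ((y : ℕ) = x + 1 ∧ (x : ℕ) % b + 1 < b)) ∨
    ((x : ℕ) = y + b ∨ ((x : ℕ) = y + 1 ∧ (y : ℕ) % b + 1 < b)) := by
  rw [graph, SimpleGraph.fromRel_adj, and_iff_right_iff_imp]
  rintro h rfl
  omega

theorem add_one_divMod {u : ℕ} (h : u % b + 1 < b) : (u + 1) / b = u / b ∧ (u + 1) % b = u % b + 1 := by
  have hb : 0 < b := by omega
  have e : u + 1 = (u % b + 1) + b * (u / b) := by have := Nat.mod_add_div u b; omega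
  constructor
  · rw [e, Nat.add_mul_div_left _ _ hb, Nat.div_eq_of_lt h, zero_add]
  · rw [e, Nat.add_mul_mod_self_left, Nat.mod_eq_of_lt h]

theorem graph_isPlanar (hb : 0 < b) : IsPlanar (graph b) := by
  refine isPlanar_of_unitStep (fun u => (((u : ℕ) % b : ℕ), ((u : ℕ) / b : ℕ))) ?_ ?_
  · intro u v h
    simp only [Prod.mk.injEq, Nat.cast_inj] at h
    apply Fin.ext
    rw [← Nat.mod_add_div u b, ← Nat.mod_add_div v b, h.1, h.2]
  · intro u v h
    have key : ∀ u v : ℕ, (v = u + b ∨ (v = u + 1 ∧ u % b + 1 < b)) →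
        UnitStep ((u % b : ℕ), (u / b : ℕ)) ((v % b : ℕ), (v / b : ℕ)) := by
      rintro u v (rfl | ⟨rfl, h⟩)
      · right; simp [Nat.add_div_right _ hb]
      · left; simp [add_one_divMod h]
    rw [adj_iff hb] at h
    exact h.imp (key u v) (key v u)

theorem weight_col (u : ℕ) : weight b U A v u (u + b) = colWeight b U v u := by
  simp [weight]

theorem weight_row {u : ℕ} (h : u % b + 1 < b) : weight b U A v u (u + 1) = rowWeight b U A u := by
  simp [weight]; omega

theorem weight_comm (x y : ℕ) : weight b U A v x y = weight b U A v y x := by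
  simp only [weight, max_comm, min_comm]

/-- The entries of the matrix and the vector are at most `U` in absolute value. -/
structure Bounded (b U : ℕ) (A : ℕ → ℕ → ℤ) (v : ℕ → ℤ) : Prop where
  matrix : ∀ i < b, ∀ x < b, |A i x| ≤ U
  vector : ∀ x < b, |v x| ≤ U

/-- The base weight lies between `4 * U` and `4 * U * b`, whereas a difference of matrix entries or
a vector entry perturbs it by at most `2 * U`. -/
theorem Bounded.weight_le (h : Bounded b U A v) (hb : 0 < b) {x y : Fin (2 * b * b)}
    (hxy : (graph b).Adj x y) :
    0 ≤ weight b U A v x y ∧ weight b U A v x y ≤ 6 * U * b := by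
  have hU : (0 : ℤ) ≤ U := by positivity
  have hb' : (1 : ℤ) ≤ b := by exact_mod_cast hb
  have hUb : (U : ℤ) ≤ U * b := by nlinarith
  have key : ∀ x y : ℕ, x < 2 * b * b → (y = x + b ∨ (y = x + 1 ∧ x % b + 1 < b)) →
      0 ≤ weight b U A v x y ∧ weight b U A v x y ≤ 6 * U * b := by
    rintro x y hx (rfl | ⟨rfl, hxb⟩)
    · rw [weight_col, colWeight]
      have := abs_le.1 (h.vector (x % b) (Nat.mod_lt _ hb))
      split_ifs <;> constructor <;> linarith
    · rw [weight_row hxb, rowWeight]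
      have hd : depth b (x / b) + 1 ≤ b := by
        have : x / b < 2 * b := by rw [Nat.div_lt_iff_lt_mul hb]; exact hx
        simp only [depth]; omega
      have hd' : (depth b (x / b) : ℤ) + 1 ≤ b := by exact_mod_cast hd
      have hd0 : (0 : ℤ) ≤ depth b (x / b) := by positivity
      have h1 : 4 * (U : ℤ) * (depth b (x / b) + 1) ≤ 4 * U * b :=
        mul_le_mul_of_nonneg_left hd' (by positivity)
      have h2 : 4 * (U : ℤ) * 1 ≤ 4 * U * (depth b (x / b) + 1) :=
        mul_le_mul_of_nonneg_left (by omega) (by positivity)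
      split_ifs with hR
      · have e1 := abs_le.1 (h.matrix _ hR _ hxb)
        have e2 := abs_le.1 (h.matrix _ hR _ (by omega : x % b < b))
        constructor <;> linarith
      · constructor <;> linarith
  rcases (adj_iff hb).1 hxy with h | h
  · exact key x y x.2 h
  · rw [weight_comm]; exact key y x y.2 h

theorem Bounded.natCast_weight (h : Bounded b U A v) (hb : 0 < b) {x y : Fin (2 * b * b)}
    (hxy : (graph b).Adj x y) : ((wgraph b U A v).weight s(x, y) : ℤ) = weight b U A v x y := by
  simp only [wgraph, Sym2.lift_mk]
  exact Int.toNat_of_nonneg (h.weight_le hb hxy).1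

theorem Bounded.wgraph_weight_le (h : Bounded b U A v) (hb : 0 < b) {e : Sym2 (Fin (2 * b * b))}
    (he : e ∈ (wgraph b U A v).graph.edgeSet) : (wgraph b U A v).weight e ≤ 6 * U * b := by
  induction e using Sym2.ind with
  | _ x y =>
    have := (h.weight_le hb he).2
    rw [← h.natCast_weight hb he] at this
    exact_mod_cast this

end Grid

/-! ### Vertices, updates, edges and distances of the grid -/

namespace Grid

open DynAPSP

variable {b U : ℕ} {A : ℕ → ℕ → ℤ} {v : ℕ → ℤ}

theorem vertex_lt {R x : ℕ} (hR : R < 2 * b) (hx : x < b) : R * b + x < 2 * b * b := by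
  have : (R + 1) * b ≤ 2 * b * b := Nat.mul_le_mul_right _ hR
  rw [add_mul] at this; omega

theorem vertex_div {R x : ℕ} (hx : x < b) : (R * b + x) / b = R := by
  rw [mul_comm, Nat.mul_add_div (by omega), Nat.div_eq_of_lt hx, add_zero]

theorem vertex_mod {R x : ℕ} (hx : x < b) : (R * b + x) % b = x := by
  rw [Nat.mul_add_mod_self_right, Nat.mod_eq_of_lt hx]

/-! ### Updates -/

/-- Replacing an entry of the vector amounts to changing the weight of one edge. -/
theorem update_weight (hb : 0 < b) {x : ℕ} (hx : x < b) (y : ℤ) {p q : Fin (2 * b * b)}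
    (hp : (p : ℕ) = (b - 1) * b + x) (hq : (q : ℕ) = p + b) :
    Function.update (wgraph b U A v).weight s(p, q) (4 * U * b + y).toNat =
      (wgraph b U A (Function.update v x y)).weight := by
  funext e
  induction e using Sym2.ind with
  | _ r s =>
  have hpd : (p : ℕ) / b = b - 1 := by rw [hp, vertex_div hx]
  have hpm : (p : ℕ) % b = x := by rw [hp, vertex_mod hx]
  rw [Function.update_apply]
  split_ifs with h
  · simp only [wgraph, h, Sym2.lift_mk, hq, weight_col, colWeight, hpd, hpm]
    rw [if_pos (by omega), Function.update_self]
  · simp only [wgraph, Sym2.lift_mk, weight]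
    split_ifs with hc
    · simp only [colWeight]
      split_ifs with hd
      -- The two weight functions must agree on all pairs, edges or not. A pair across the middle in
      -- column `x` has its smaller element equal to `p`, so it is the pair excluded by `h`.
      · rw [Function.update_of_ne]
        rintro hx'
        have hmin : min (r : ℕ) s = p := by
          rw [← Nat.div_add_mod (min (r : ℕ) s) b, hx', hp, mul_comm]
          congr 2; omega
        apply h
        rw [Sym2.eq_iff]
        rcases le_total (r : ℕ) s with hrs | hrs
        · left; constructor <;> apply Fin.ext <;> omega
        · right; constructor <;> apply Fin.ext <;> omega
      · rfl
    · rfl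

theorem setWeight_apply (hb : 0 < b) {x : ℕ} (hx : x < b) (y : ℤ) {p q : Fin (2 * b * b)}
    (hp : (p : ℕ) = (b - 1) * b + x) (hq : (q : ℕ) = p + b) :
    (Op.setWeight p q (4 * U * b + y).toNat).apply (wgraph b U A v) =
      wgraph b U A (Function.update v x y) := by
  simp only [Op.apply, update_weight hb hx y hp hq]
  rfl

theorem deleteEdges_sup_edge {V : Type*} {G : SimpleGraph V} {p q : V} (h : G.Adj p q) :
    G.deleteEdges {s(p, q)} ⊔ SimpleGraph.edge p q = G := by
  ext r s
  simp only [SimpleGraph.sup_adj, SimpleGraph.deleteEdges_adj, SimpleGraph.edge_adj,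
    Set.mem_singleton_iff, Sym2.eq_iff]
  constructor
  · rintro (h' | ⟨⟨rfl, rfl⟩ | ⟨rfl, rfl⟩, -⟩)
    exacts [h'.1, h, h.symm]
  · intro h'
    have := h'.ne
    tauto

/-- Removing an edge and inserting it again with another weight has the effect of one weight update.
This lets both variants of the problem share the rest of the argument. -/
theorem removeEdge_insertEdge_apply (hb : 0 < b) {x : ℕ} (hx : x < b) (y : ℤ)
    {p q : Fin (2 * b * b)} (hp : (p : ℕ) = (b - 1) * b + x) (hq : (q : ℕ) = p + b) :
    (Op.insertEdge p q (4 * U * b + y).toNat).apply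
      ((Op.removeEdge p q).apply (wgraph b U A v)) = wgraph b U A (Function.update v x y) := by
  have h : (wgraph b U A v).graph.Adj p q := (adj_iff hb).2 (.inl (.inl hq))
  simp only [Op.apply, update_weight hb hx y hp hq]
  rw [deleteEdges_sup_edge h]
  rfl

/-! ### The list of edges -/

/-- The edge with number `k`; the first `(2 * b - 1) * b` edges join consecutive rows. -/
def edgeStart (b k : ℕ) : ℕ :=
  if k < (2 * b - 1) * b then k
  else (k - (2 * b - 1) * b) / (b - 1) * b + (k - (2 * b - 1) * b) % (b - 1)

def edgeEnd (b k : ℕ) : ℕ := if k < (2 * b - 1) * b then k + b else edgeStart b k + 1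

def edgeCount (b : ℕ) : ℕ := (2 * b - 1) * b + 2 * b * (b - 1)

theorem edgeStart_row {k : ℕ} (h : ¬ k < (2 * b - 1) * b) (hk : k < edgeCount b) :
    edgeStart b k / b = (k - (2 * b - 1) * b) / (b - 1) ∧
      edgeStart b k % b = (k - (2 * b - 1) * b) % (b - 1) ∧ edgeStart b k / b < 2 * b ∧
      edgeStart b k % b + 1 < b := by
  -- For `b = 1` there are no row edges, so `h` and `hk` contradict each other and the division by
  -- `b - 1` is meaningful.
  have hb : 0 < b - 1 := by
    rcases Nat.eq_zero_or_pos (b - 1) with h0 | h0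
    · rw [edgeCount, h0, Nat.mul_zero] at hk; omega
    · exact h0
  have hm := Nat.mod_lt (k - (2 * b - 1) * b) hb
  have e1 : edgeStart b k / b = (k - (2 * b - 1) * b) / (b - 1) := by
    rw [edgeStart, if_neg h, vertex_div (by omega)]
  have e2 : edgeStart b k % b = (k - (2 * b - 1) * b) % (b - 1) := by
    rw [edgeStart, if_neg h, vertex_mod (by omega)]
  refine ⟨e1, e2, ?_, by omega⟩
  rw [e1, Nat.div_lt_iff_lt_mul hb]
  simp only [edgeCount] at hk; omega

theorem edge_spec (hb : 0 < b) {k : ℕ} (hk : k < edgeCount b) :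
    edgeEnd b k < 2 * b * b ∧ (edgeEnd b k = edgeStart b k + b ∨
      (edgeEnd b k = edgeStart b k + 1 ∧ edgeStart b k % b + 1 < b)) := by
  by_cases h : k < (2 * b - 1) * b
  · have : (2 * b - 1) * b + b = 2 * b * b := by
      rw [← Nat.succ_mul]; congr 1; omega
    rw [edgeEnd, edgeStart, if_pos h, if_pos h]
    exact ⟨by omega, .inl rfl⟩
  · obtain ⟨-, -, h1, h2⟩ := edgeStart_row h hk
    simp only [edgeEnd, if_neg h]
    refine ⟨?_, .inr ⟨trivial, h2⟩⟩
    have := vertex_lt h1 (by omega : edgeStart b k % b + 1 < b)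
    have e := Nat.div_add_mod (edgeStart b k) b
    rw [mul_comm] at e
    omega

theorem edge_injective (hb : 0 < b) {k k' : ℕ} (hk : k < edgeCount b) (hk' : k' < edgeCount b)
    (h1 : edgeStart b k = edgeStart b k') (h2 : edgeEnd b k = edgeEnd b k') : k = k' := by
  have key : ∀ k k', k < (2 * b - 1) * b → ¬ k' < (2 * b - 1) * b → k' < edgeCount b →
      edgeStart b k = edgeStart b k' → edgeEnd b k ≠ edgeEnd b k' := by
    intro k k' h h' hk' h1 h2
    have := (edgeStart_row h' hk').2.2.2
    simp only [edgeEnd, if_pos h, if_neg h'] at h2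
    rw [← h1] at this h2
    simp only [edgeStart, if_pos h] at this h2
    -- A column edge and a row edge with the same start can share their end only if `b = 1`, where
    -- row edges do not exist.
    have : b = 1 := by omega
    subst this
    omega
  by_cases h : k < (2 * b - 1) * b <;> by_cases h' : k' < (2 * b - 1) * b
  · simpa [edgeStart, h, h'] using h1
  · exact (key k k' h h' hk' h1 h2).elim
  · exact (key k' k h' h hk h1.symm h2.symm).elim
  · obtain ⟨e1, e2, -, -⟩ := edgeStart_row h hk
    obtain ⟨e1', e2', -, -⟩ := edgeStart_row h' hk'
    rw [h1] at e1 e2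
    have : k - (2 * b - 1) * b = k' - (2 * b - 1) * b := by
      rw [← Nat.div_add_mod (k - (2 * b - 1) * b) (b - 1),
        ← Nat.div_add_mod (k' - (2 * b - 1) * b) (b - 1), ← e1, ← e2, ← e1', ← e2']
    omega

theorem exists_edge (hb : 0 < b) {u w : ℕ} (hw : w < 2 * b * b)
    (h : w = u + b ∨ (w = u + 1 ∧ u % b + 1 < b)) :
    ∃ k < edgeCount b, edgeStart b k = u ∧ edgeEnd b k = w := by
  have hN : (2 * b - 1) * b + b = 2 * b * b := by
    rw [← Nat.succ_mul]; congr 1; omega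
  rcases h with rfl | ⟨rfl, h⟩
  · have : u < (2 * b - 1) * b := by omega
    exact ⟨u, by simp only [edgeCount]; omega, by simp [edgeStart, this], by simp [edgeEnd, this]⟩
  · have hR : u / b < 2 * b := by rw [Nat.div_lt_iff_lt_mul hb]; omega
    have hlt : u / b * (b - 1) + u % b < 2 * b * (b - 1) := by
      have : (u / b + 1) * (b - 1) ≤ 2 * b * (b - 1) := Nat.mul_le_mul_right _ hR
      rw [add_mul] at this; omega
    have hk : ¬ (2 * b - 1) * b + (u / b * (b - 1) + u % b) < (2 * b - 1) * b := by omega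
    have hs : edgeStart b ((2 * b - 1) * b + (u / b * (b - 1) + u % b)) = u := by
      rw [edgeStart, if_neg hk, Nat.add_sub_cancel_left, vertex_div (by omega),
        vertex_mod (by omega), mul_comm, Nat.div_add_mod]
    refine ⟨(2 * b - 1) * b + (u / b * (b - 1) + u % b), by simp only [edgeCount]; omega, hs, ?_⟩
    rw [edgeEnd, if_neg hk, hs]

def edges (b : ℕ) (hb : 0 < b) : List (Fin (2 * b * b) × Fin (2 * b * b)) :=
  List.ofFn fun k : Fin (edgeCount b) =>
    (⟨edgeStart b k, by have := edge_spec hb k.2; omega⟩, ⟨edgeEnd b k, (edge_spec hb k.2).1⟩)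

theorem isEdgeList_edges (hb : 0 < b) : IsEdgeList (wgraph b U A v) (edges b hb) := by
  constructor
  · rw [edges, List.map_ofFn, List.nodup_ofFn]
    intro k k' h
    have := edge_spec hb k.2
    have := edge_spec hb k'.2
    simp only [Function.comp, Sym2.eq_iff, Fin.mk.injEq] at h
    apply Fin.ext
    rcases h with h | h
    · exact edge_injective hb k.2 k'.2 h.1 h.2
    · omega
  · intro e
    induction e using Sym2.ind with
    | _ x y =>
    have hadj : s(x, y) ∈ (wgraph b U A v).graph.edgeSet ↔ (graph b).Adj x y := Iff.rfl
    rw [hadj, adj_iff hb, edges, List.map_ofFn, List.mem_ofFn]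
    constructor
    · rintro ⟨k, hk⟩
      simp only [Function.comp, Sym2.eq_iff, Fin.ext_iff] at hk
      have := (edge_spec hb k.2).2
      rcases hk with ⟨h1, h2⟩ | ⟨h1, h2⟩ <;> rw [h1, h2] at this
      exacts [.inl this, .inr this]
    · rintro (h | h)
      · obtain ⟨k, hk, h1, h2⟩ := exists_edge hb y.2 h
        exact ⟨⟨k, hk⟩, by simp [h1, h2]⟩
      · obtain ⟨k, hk, h1, h2⟩ := exists_edge hb x.2 h
        exact ⟨⟨k, hk⟩, by simp [h1, h2]⟩

/-! ### Distances -/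

/-- Weak duality for shortest paths: the increments of the potential telescope along the walk. -/
theorem le_sum_of_walk {V : Type*} {G : SimpleGraph V} {w : Sym2 V → ℕ} {φ : V → ℤ}
    (h : ∀ x y, G.Adj x y → φ y - φ x ≤ w s(x, y)) {x y : V} (p : G.Walk x y) :
    φ y - φ x ≤ ((p.edges.map w).sum : ℕ) := by
  induction p with
  | nil => simp
  | cons hxy p ih =>
    have := h _ _ hxy
    simp only [SimpleGraph.Walk.edges_cons, List.map_cons, List.sum_cons, Nat.cast_add]
    linarith

/-- The length of a walk from vertex `0` of row `i` to the last vertex of row `2 * b - 1 - i` that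
leaves these two rows only for a column with offset `m`. -/
def span (b U i : ℕ) (m : ℤ) : ℤ :=
  (b - 1) * (4 * U * (i + 1)) + (2 * (b - 1 - i) + 1) * (4 * U * b) + m

/-- A potential for bounding from below the distances from row `i`. -/
def potential (b U i : ℕ) (A : ℕ → ℕ → ℤ) (m : ℤ) (R x : ℕ) : ℤ :=
  if R < b then
    x * (4 * U * (min R i + 1 : ℕ)) + A (min R i) x + (R - min R i : ℕ) * (4 * U * b)
  else span b U i m - ((b - 1 - x) * (4 * U * (min (2 * b - 1 - R) i + 1 : ℕ)) +
    (2 * b - 1 - R - min (2 * b - 1 - R) i : ℕ) * (4 * U * b))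

/-- In row `R ≤ i` of the upper half the increment equals the weight of the edge. Beyond row `i` the
potential keeps the increments of row `i`, and the edges there are heavier. In the lower half it
measures an idealised remaining length to the target without matrix entries, with row costs capped
at the level of row `i`. -/
theorem abs_potential_row_le (h : Bounded b U A v) {i : ℕ} (hi : i < b) (m : ℤ) {R x : ℕ}
    (hx : x + 1 < b) : |potential b U i A m R (x + 1) - potential b U i A m R x| ≤
      4 * U * (depth b R + 1) + if R < b then A R (x + 1) - A R x else 0 := by
  have hU : (0 : ℤ) ≤ U := by positivity
  by_cases hR : R < b
  · have hd : depth b R = R := by simp only [depth]; omega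
    rw [hd]
    simp only [potential, if_pos hR]
    rcases le_or_gt R i with hRi | hRi
    · rw [min_eq_left hRi]
      have e1 := abs_le.1 (h.matrix R hR _ hx)
      have e2 := abs_le.1 (h.matrix R hR x (by omega))
      have : (0 : ℤ) ≤ R * U := by positivity
      push_cast
      rw [abs_le]; constructor <;> nlinarith
    · rw [min_eq_right hRi.le]
      have e1 := abs_le.1 (h.matrix R hR _ hx)
      have e2 := abs_le.1 (h.matrix R hR x (by omega))
      have e3 := abs_le.1 (h.matrix i hi _ hx)
      have e4 := abs_le.1 (h.matrix i hi x (by omega))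
      have : (0 : ℤ) ≤ i * U := by positivity
      have hRi' : (i : ℤ) + 1 ≤ R := by exact_mod_cast hRi
      -- The edge is at least one level deeper than row `i`, which adds at least `4 * U` to its base
      -- weight. This pays for exchanging the difference of entries in row `i` for the one in row
      -- `R`, since each is at most `2 * U`.
      have : (U : ℤ) * (i + 1) ≤ U * R := mul_le_mul_of_nonneg_left hRi' hU
      push_cast
      rw [abs_le]; constructor <;> nlinarith
  · simp only [potential, if_neg hR]
    have hd : min (2 * b - 1 - R) i ≤ depth b R := by simp only [depth]; omega
    generalize min (2 * b - 1 - R) i = k at *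
    have hd' : (k : ℤ) ≤ depth b R := by exact_mod_cast hd
    have : (U : ℤ) * k ≤ U * depth b R := mul_le_mul_of_nonneg_left hd' hU
    have : (0 : ℤ) ≤ U * k := by positivity
    push_cast
    rw [abs_le]; constructor <;> nlinarith

/-- Between row `i` and its mirror row, apart from the crossing, the increment is exactly `4 * U *
b`. Farther out, changing the row gains at most `4 * U` for each of at most `b - 1` columns, plus at
most `2 * U` from the matrix entries; the column weight `4 * U * b` is chosen to dominate this. -/
theorem abs_potential_col_le (h : Bounded b U A v) {i : ℕ} (hi : i < b) {m : ℤ}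
    (hm : ∀ x < b, m ≤ A i x + v x) (hm' : -(2 * U) ≤ m) {R x : ℕ} (hR : R + 1 < 2 * b)
    (hx : x < b) : |potential b U i A m (R + 1) x - potential b U i A m R x| ≤
      4 * U * b + if R + 1 = b then v x else 0 := by
  have hU : (0 : ℤ) ≤ U := by positivity
  have hb' : (1 : ℤ) ≤ b := by exact_mod_cast (by omega : 1 ≤ b)
  have hxb : (x : ℤ) + 1 ≤ b := by exact_mod_cast hx
  have hUb : (U : ℤ) * (x + 1) ≤ U * b := mul_le_mul_of_nonneg_left hxb hU
  have hUx : (0 : ℤ) ≤ U * x := by positivity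
  rcases lt_trichotomy (R + 1) b with hRb | hRb | hRb
  · have hR' : R < b := by omega
    simp only [potential, if_pos hRb, if_pos hR', if_neg hRb.ne]
    rcases le_or_gt i R with hRi | hRi
    · rw [min_eq_right hRi, min_eq_right (by omega : i ≤ R + 1),
        show R + 1 - i = (R - i) + 1 by omega]
      push_cast
      rw [abs_le]; constructor <;> nlinarith
    · rw [min_eq_left hRi.le, min_eq_left (by omega : R + 1 ≤ i)]
      have e1 := abs_le.1 (h.matrix (R + 1) hRb x hx)
      have e2 := abs_le.1 (h.matrix R hR' x hx)
      simp only [Nat.sub_self]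
      push_cast
      rw [abs_le]; constructor <;> nlinarith
  · have hR' : R < b := by omega
    simp only [potential, if_pos hR', hRb, lt_irrefl, if_false]
    -- On a crossing edge the increment is `4 * U * b + m - A i x`. It is at most the weight
    -- precisely because `m ≤ A i x + v x`; the opposite direction needs only the crude bound `hm'`.
    rw [show 2 * b - 1 - b = R by omega, min_eq_right (by omega : i ≤ R)]
    have e1 := abs_le.1 (h.matrix i hi x hx)
    have e2 := abs_le.1 (h.vector x hx)
    have e3 := hm x hx
    have hRi : ((R - i : ℕ) : ℤ) = b - 1 - i := by omega
    rw [hRi, span]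
    push_cast
    rw [abs_le]; constructor <;> nlinarith
  · have hR1 : ¬ R + 1 < b := by omega
    have hR2 : ¬ R < b := by omega
    simp only [potential, if_neg hR1, if_neg hR2, if_neg hRb.ne']
    obtain ⟨k, hk⟩ : ∃ k, 2 * b - 1 - (R + 1) = k := ⟨_, rfl⟩
    have hk' : 2 * b - 1 - R = k + 1 := by omega
    rw [hk, hk']
    have hbx : (0 : ℤ) ≤ U * (b - 1 - x) := mul_nonneg hU (by omega)
    have hbx' : (U : ℤ) * (b - 1 - x) ≤ U * b := mul_le_mul_of_nonneg_left (by omega) hU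
    rcases le_or_gt i k with hki | hki
    · rw [min_eq_right hki, min_eq_right (by omega : i ≤ k + 1),
        show k + 1 - i = (k - i) + 1 by omega]
      push_cast
      rw [abs_le]; constructor <;> nlinarith
    · rw [min_eq_left hki.le, min_eq_left (by omega : k + 1 ≤ i)]
      simp only [Nat.sub_self]
      push_cast
      rw [abs_le]; constructor <;> nlinarith

/-- The preceding estimates bound absolute values because an undirected edge may be traversed either
way. -/
theorem potential_le (h : Bounded b U A v) (hb : 0 < b) {i : ℕ} (hi : i < b) {m : ℤ}
    (hm : ∀ x < b, m ≤ A i x + v x) (hm' : -(2 * U) ≤ m) (x y : Fin (2 * b * b))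
    (hxy : (graph b).Adj x y) :
    potential b U i A m (y / b) (y % b) - potential b U i A m (x / b) (x % b) ≤
      (wgraph b U A v).weight s(x, y) := by
  rw [h.natCast_weight hb hxy]
  have key : ∀ x y : ℕ, y < 2 * b * b → (y = x + b ∨ (y = x + 1 ∧ x % b + 1 < b)) →
      |potential b U i A m (y / b) (y % b) - potential b U i A m (x / b) (x % b)| ≤
        weight b U A v x y := by
    rintro x y hy (rfl | ⟨rfl, hxb⟩)
    · have hR : (x + b) / b < 2 * b := by rw [Nat.div_lt_iff_lt_mul hb]; exact hy
      rw [Nat.add_div_right _ hb] at hR ⊢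
      rw [Nat.add_mod_right, weight_col]
      exact abs_potential_col_le h hi hm hm' hR (Nat.mod_lt _ hb)
    · rw [weight_row hxb, (add_one_divMod hxb).1, (add_one_divMod hxb).2]
      exact abs_potential_row_le h hi m hxb
  rcases (adj_iff hb).1 hxy with h | h
  · exact (le_abs_self _).trans (key x y y.2 h)
  · rw [weight_comm, ← neg_sub]; exact (neg_le_abs _).trans (key y x x.2 h)

/-- There is a walk of length `ℓ`. -/
def HasWalk (b U : ℕ) (A : ℕ → ℕ → ℤ) (v : ℕ → ℤ) (x y : ℕ) (ℓ : ℤ) : Prop :=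
  ∃ (hx : x < 2 * b * b) (hy : y < 2 * b * b) (p : (graph b).Walk ⟨x, hx⟩ ⟨y, hy⟩),
    ((p.edges.map (wgraph b U A v).weight).sum : ℕ) = ℓ

theorem HasWalk.refl {x : ℕ} (hx : x < 2 * b * b) : HasWalk b U A v x x 0 :=
  ⟨hx, hx, .nil, by simp⟩

theorem HasWalk.trans {x y z : ℕ} {ℓ ℓ' : ℤ} (h : HasWalk b U A v x y ℓ)
    (h' : HasWalk b U A v y z ℓ') : HasWalk b U A v x z (ℓ + ℓ') := by
  obtain ⟨hx, hy, p, hp⟩ := h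
  obtain ⟨hy', hz, p', hp'⟩ := h'
  refine ⟨hx, hz, p.append p', ?_⟩
  rw [SimpleGraph.Walk.edges_append, List.map_append, List.sum_append, Nat.cast_add, hp, hp']

theorem HasWalk.step (h : Bounded b U A v) (hb : 0 < b) {x y : ℕ} (hy : y < 2 * b * b)
    (hxy : y = x + b ∨ (y = x + 1 ∧ x % b + 1 < b)) : HasWalk b U A v x y (weight b U A v x y) := by
  have hx : x < 2 * b * b := by omega
  have hadj : (graph b).Adj ⟨x, hx⟩ ⟨y, hy⟩ := (adj_iff hb).2 (.inl hxy)
  refine ⟨hx, hy, .cons hadj .nil, ?_⟩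
  rw [SimpleGraph.Walk.edges_cons, List.map_cons, List.sum_cons, SimpleGraph.Walk.edges_nil,
    List.map_nil, List.sum_nil, add_zero, h.natCast_weight hb hadj]

theorem hasWalk_row (h : Bounded b U A v) (hb : 0 < b) {R : ℕ} (hR : R < 2 * b) (x : ℕ) :
    ∀ k, x + k < b → HasWalk b U A v (R * b + x) (R * b + (x + k))
      (k * (4 * U * (depth b R + 1)) + if R < b then A R (x + k) - A R x else 0)
  | 0, hk => by
      simpa using HasWalk.refl (vertex_lt hR hk)
  | k + 1, hk => by
      have h1 := hasWalk_row h hb hR x k (by omega)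
      have hm : (R * b + (x + k)) % b + 1 < b := by rw [vertex_mod (by omega)]; omega
      have h2 := HasWalk.step h hb (x := R * b + (x + k)) (y := R * b + (x + k) + 1)
        (vertex_lt hR hk) (.inr ⟨rfl, hm⟩)
      rw [← add_assoc x k 1, ← add_assoc (R * b)]
      convert h1.trans h2 using 1
      rw [weight_row hm, rowWeight, vertex_div (by omega), vertex_mod (by omega)]
      split_ifs
      · push_cast; ring
      · push_cast; ring

theorem hasWalk_col (h : Bounded b U A v) (hb : 0 < b) (R : ℕ) {x : ℕ} (hx : x < b) :
    ∀ k, R + k < 2 * b → HasWalk b U A v (R * b + x) ((R + k) * b + x)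
      (k * (4 * U * b) + if R < b ∧ b ≤ R + k then v x else 0)
  | 0, hk => by
      rw [if_neg (by omega)]
      simpa using HasWalk.refl (vertex_lt hk hx)
  | k + 1, hk => by
      have h1 := hasWalk_col h hb R hx k (by omega)
      have e : (R + (k + 1)) * b + x = (R + k) * b + x + b := by ring
      have h2 := HasWalk.step h hb (x := (R + k) * b + x) (y := (R + k) * b + x + b)
        (by rw [← e]; exact vertex_lt hk hx) (.inl rfl)
      rw [e]
      convert h1.trans h2 using 1
      rw [weight_col, colWeight, vertex_div hx, vertex_mod hx]
      split_ifs <;> first | omega | (push_cast; ring)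

/-- The distance from the first vertex of row `i` to the last vertex of row `2 * b - 1 - i`. -/
theorem isDist_iff (h : Bounded b U A v) (hb : 0 < b) {i : ℕ} (hi : i < b) {m : ℤ}
    (hm : IsLeast {y | ∃ x < b, y = A i x + v x} m) {p q : Fin (2 * b * b)}
    (hp : (p : ℕ) = i * b) (hq : (q : ℕ) = (2 * b - 1 - i) * b + (b - 1)) :
    (wgraph b U A v).graph.Reachable p q ∧
      ∀ d : ℕ, (wgraph b U A v).IsDist p q d → (d : ℤ) = span b U i m - A i 0 := by
  obtain ⟨⟨x, hx, rfl⟩, hmin⟩ := hm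
  have hm1 : ∀ y < b, A i x + v x ≤ A i y + v y := fun y hy => hmin ⟨y, hy, rfl⟩
  have hm2 : -(2 * U : ℤ) ≤ A i x + v x := by
    have e1 := abs_le.1 (h.matrix i hi x hx)
    have e2 := abs_le.1 (h.vector x hx)
    linarith
  -- The walk turns down at the minimising column `x`. The entries of `A` along row `i` telescope to
  -- `A i x - A i 0`, and the mirror row carries no entries.
  have hwalk : HasWalk b U A v (i * b) ((2 * b - 1 - i) * b + (b - 1))
      (span b U i (A i x + v x) - A i 0) := by
    have h1 := hasWalk_row h hb (R := i) (by omega) 0 x (by omega)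
    have h2 := hasWalk_col h hb i hx (2 * (b - 1 - i) + 1) (by omega)
    have h3 := hasWalk_row h hb (R := 2 * b - 1 - i) (by omega) x (b - 1 - x) (by omega)
    rw [show i + (2 * (b - 1 - i) + 1) = 2 * b - 1 - i by omega] at h2
    rw [show x + (b - 1 - x) = b - 1 by omega] at h3
    rw [zero_add, add_zero] at h1
    convert (h1.trans h2).trans h3 using 1
    rw [if_pos hi, if_pos (by omega), if_neg (by omega), span,
      show depth b i = i by simp only [depth]; omega,
      show depth b (2 * b - 1 - i) = i by simp only [depth]; omega]
    rw [Nat.cast_add, Nat.cast_mul, Nat.cast_sub (by omega : i ≤ b - 1),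
      Nat.cast_sub (by omega : x ≤ b - 1), Nat.cast_sub (by omega : 1 ≤ b)]
    push_cast; ring
  obtain ⟨hp', hq', w, hw⟩ := hwalk
  obtain rfl : p = ⟨_, hp'⟩ := Fin.ext hp
  obtain rfl : q = ⟨_, hq'⟩ := Fin.ext hq
  refine ⟨⟨w⟩, fun d hd => ?_⟩
  apply le_antisymm
  · rw [← hw]; exact_mod_cast hd.2 ⟨w, rfl⟩
  -- The potential equals `A i 0` at the start and `span b U i m` at the target.
  · obtain ⟨w', hw'⟩ := hd.1
    have := le_sum_of_walk (G := (wgraph b U A v).graph) (potential_le h hb hi hm1 hm2) w'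
    have h1 : i * b / b = i := Nat.mul_div_cancel _ hb
    have h2 : i * b % b = 0 := Nat.mul_mod_left _ _
    rw [hw'] at this
    simp only [h1, h2, vertex_div (by omega : b - 1 < b), vertex_mod (by omega : b - 1 < b)] at this
    simp only [potential, if_pos hi, if_neg (by omega : ¬ 2 * b - 1 - i < b), min_self,
      show 2 * b - 1 - (2 * b - 1 - i) = i by omega] at this
    rw [Nat.cast_sub (by omega : 1 ≤ b)] at this
    push_cast at this
    simp at this
    linarith

end Grid

/-! ### Walks with few arcs and min-plus squaring -/

namespace APSP

variable {n : ℕ} {w : WDigraph n}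

/-- Walks with a given number of arcs; the vertices are natural numbers, of which those that are
at least `n` are isolated. -/
inductive StepWalk (w : WDigraph n) : ℕ → ℕ → ℕ → ℤ → Prop
  | nil (i : ℕ) : StepWalk w 0 i i 0
  | cons {k i j l : ℕ} {x ℓ : ℤ} (hi : i < n) (hj : j < n) (h : w ⟨i, hi⟩ ⟨j, hj⟩ = some x)
      (p : StepWalk w k j l ℓ) : StepWalk w (k + 1) i l (x + ℓ)

theorem StepWalk.isWalk {k i j : ℕ} {ℓ : ℤ} (p : StepWalk w k i j ℓ) (hi : i < n) (hj : j < n) :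
    IsWalk w ⟨i, hi⟩ ⟨j, hj⟩ ℓ := by
  induction p with
  | nil i => exact .nil _
  | cons hi hj' h p ih => exact .cons h (ih hj' hj)

theorem IsWalk.exists_stepWalk {i j : Fin n} {ℓ : ℤ} (p : IsWalk w i j ℓ) :
    ∃ k, StepWalk w k i j ℓ := by
  induction p with
  | nil i => exact ⟨0, .nil _⟩
  | cons h p ih =>
    obtain ⟨k, hk⟩ := ih
    exact ⟨k + 1, .cons _ _ h hk⟩

theorem StepWalk.abs_weight_le {X : ℤ} (hw : ∀ i j x, w i j = some x → |x| ≤ X) {k i j : ℕ} {ℓ : ℤ}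
    (p : StepWalk w k i j ℓ) : |ℓ| ≤ k * X := by
  induction p with
  | nil i => simp
  | cons hi hj h p ih =>
    have := (abs_add_le _ _).trans (add_le_add (hw _ _ _ h) ih)
    push_cast; linarith

theorem StepWalk.append {k k' i j l : ℕ} {ℓ ℓ' : ℤ} (p : StepWalk w k i j ℓ)
    (p' : StepWalk w k' j l ℓ') : StepWalk w (k + k') i l (ℓ + ℓ') := by
  induction p with
  | nil i => simpa using p'
  | cons hi hj h p ih =>
    convert StepWalk.cons hi hj h (ih p') using 1 <;> ring

/-- The midpoint is bounded by `P` and not by `n`, since an empty first part may sit at a padding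
vertex. -/
theorem StepWalk.split {P : ℕ} (hP : n ≤ P) : ∀ {k k' i l : ℕ} {ℓ : ℤ}, i < P →
    StepWalk w (k + k') i l ℓ → ∃ j < P, ∃ a a', StepWalk w k i j a ∧ StepWalk w k' j l a' ∧
      ℓ = a + a'
  | 0, k', i, l, ℓ, hi, p => ⟨i, hi, 0, ℓ, .nil i, by simpa using p, by simp⟩
  | k + 1, k', i, l, ℓ, hi, p => by
      rw [Nat.add_right_comm] at p
      cases p with
      | cons hi hj h p =>
        obtain ⟨m, hm, a, a', q, q', rfl⟩ := p.split hP (by omega)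
        exact ⟨m, hm, _, a', .cons hi hj h q, q', by ring⟩

/-- With the prefix weights `a`, the weight of any segment of the walk is a difference, which makes
it easy to cut out a cycle. -/
theorem StepWalk.exists_seq {k i j : ℕ} {ℓ : ℤ} (p : StepWalk w k i j ℓ) :
    ∃ (f : ℕ → ℕ) (a : ℕ → ℤ), f 0 = i ∧ f k = j ∧ a 0 = 0 ∧ a k = ℓ ∧
      ∀ t < k, StepWalk w 1 (f t) (f (t + 1)) (a (t + 1) - a t) := by
  induction p with
  | nil i => exact ⟨fun _ => i, fun _ => 0, rfl, rfl, rfl, rfl, by simp⟩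
  | @cons k i j l x ℓ hi hj h p ih =>
    obtain ⟨f, a, h0, hk, a0, ak, hs⟩ := ih
    refine ⟨fun t => t.casesOn i f, fun t => t.casesOn 0 fun t => x + a t, rfl, hk, rfl,
      by simp [ak], fun t ht => ?_⟩
    cases t with
    | zero => simpa [h0, a0] using StepWalk.cons hi hj h (.nil j)
    | succ t => simpa using hs t (by omega)

theorem StepWalk.of_seq {k : ℕ} {f : ℕ → ℕ} {a : ℕ → ℤ}
    (h : ∀ t < k, StepWalk w 1 (f t) (f (t + 1)) (a (t + 1) - a t)) (s : ℕ) :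
    ∀ d, s + d ≤ k → StepWalk w d (f s) (f (s + d)) (a (s + d) - a s)
  | 0, _ => by simpa using StepWalk.nil _
  | d + 1, hd => by
      have := (StepWalk.of_seq h s d (by omega)).append (h (s + d) (by omega))
      simpa [add_assoc] using this

theorem StepWalk.lt_of_one {i j : ℕ} {ℓ : ℤ} (p : StepWalk w 1 i j ℓ) : i < n := by
  cases p with
  | cons hi _ _ _ => exact hi

/-- Without negative cycles, walks with at most `n` arcs suffice. -/
theorem StepWalk.shorten (hw : NoNegativeCycle w) {i j : ℕ} :
    ∀ {k : ℕ} {ℓ : ℤ}, StepWalk w k i j ℓ → ∃ k' ≤ n, ∃ ℓ' ≤ ℓ, StepWalk w k' i j ℓ' := by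
  intro k
  induction k using Nat.strong_induction_on with
  | _ k ih =>
    intro ℓ p
    rcases le_or_gt k n with hk | hk
    · exact ⟨k, hk, ℓ, le_rfl, p⟩
    obtain ⟨f, a, h0, hj, a0, ak, hs⟩ := p.exists_seq
    have hlt : ∀ t : Fin k, f t < n := fun t => (hs t t.2).lt_of_one
    -- Only the starting points of the `k` arcs are used. Each of them has an outgoing arc, hence is
    -- a genuine vertex, and there are more than `n` of them.
    obtain ⟨s, t, hne, hst⟩ := Fintype.exists_ne_map_eq_of_card_lt
      (fun t : Fin k => (⟨f t, hlt t⟩ : Fin n)) (by simpa using hk)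
    wlog hlt' : s < t generalizing s t
    · exact this t s hne.symm hst.symm (lt_of_le_of_ne (not_lt.1 hlt') hne.symm)
    have hst : f s = f t := by simpa using hst
    have hlt' : (s : ℕ) < t := hlt'
    have htk := t.2
    obtain ⟨d, hd⟩ : ∃ d, (t : ℕ) = s + d := ⟨t - s, by omega⟩
    have c := StepWalk.of_seq hs s d (by omega)
    rw [← hd, ← hst] at c
    -- The part between the repetitions is a cycle of nonnegative weight; dropping it shortens the
    -- walk without making it heavier.
    have hc := hw _ _ (c.isWalk (hlt s) (hlt s))
    have q := StepWalk.of_seq hs 0 s (by omega)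
    have q' := StepWalk.of_seq hs t (k - t) (by omega)
    rw [show (t : ℕ) + (k - t) = k by omega, ← hst, hj, ak] at q'
    rw [zero_add, h0, a0] at q
    obtain ⟨k', hk', ℓ', hℓ', r⟩ := ih _ (by omega) (q.append q')
    exact ⟨k', hk', ℓ', by linarith, r⟩

/-- The matrix `C` contains the distances between the vertices less than `P` with respect to walks
of at most `L` arcs, with `4 * B` for pairs without such a walk. -/
structure Represents (w : WDigraph n) (P L B : ℕ) (C : ℕ → ℕ → ℤ) : Prop where
  le : ∀ i < P, ∀ j < P, ∀ k ≤ L, ∀ ℓ, StepWalk w k i j ℓ → C i j ≤ ℓ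
  eq : ∀ i < P, ∀ j < P, C i j = 4 * B ∨ ∃ k ≤ L, StepWalk w k i j (C i j)

theorem Represents.eq_or_abs_le {P L B X : ℕ} {C : ℕ → ℕ → ℤ} (h : Represents w P L B C)
    (hw : ∀ i j x, w i j = some x → |x| ≤ (X : ℤ)) (hB : L * X ≤ B) {i j : ℕ} (hi : i < P)
    (hj : j < P) : C i j = 4 * B ∨ |C i j| ≤ B := by
  refine (h.eq i hi j hj).imp_right ?_
  rintro ⟨k, hk, p⟩
  have h1 := p.abs_weight_le hw
  have h2 : k * X ≤ B := (Nat.mul_le_mul_right _ hk).trans hB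
  have h3 : (k : ℤ) * X ≤ B := by exact_mod_cast h2
  exact h1.trans h3

/-- A walk with at most `2 * L` arcs is a concatenation of two with at most `L`. The value `4 * B`
plays the role of infinity, and proper entries lie in `[-B, B]`, so a sum involving infinity is at
least `3 * B`. Truncating above `B` therefore removes exactly the meaningless sums. The entry `D i j
= 4 * B` is allowed because the array of results is initialised with this value. -/
theorem Represents.square {P L B X : ℕ} {C D : ℕ → ℕ → ℤ} (h : Represents w P L B C) (hP : n ≤ P)
    (hw : ∀ i j x, w i j = some x → |x| ≤ (X : ℤ)) (hB : L * 2 * X ≤ B) (hB0 : 0 < B)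
    (hle : ∀ i < P, ∀ j < P, ∀ k < P, D i j ≤ C i k + C k j)
    (heq : ∀ i < P, ∀ j < P, D i j = 4 * B ∨ ∃ k < P, D i j = C i k + C k j) :
    Represents w P (L * 2) B fun i j => if D i j ≤ B then D i j else 4 * B where
  le i hi j hj k hk ℓ p := by
    have h1 := p.abs_weight_le hw
    have h2 : k * X ≤ B := (Nat.mul_le_mul_right _ hk).trans hB
    have h3 : (k : ℤ) * X ≤ B := by exact_mod_cast h2
    have key : D i j ≤ ℓ := by
      obtain ⟨k₁, k₂, rfl, h₁, h₂⟩ : ∃ k₁ k₂, k = k₁ + k₂ ∧ k₁ ≤ L ∧ k₂ ≤ L :=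
        ⟨min k L, k - min k L, by omega, by omega, by omega⟩
      obtain ⟨m, hm, a, a', q, q', rfl⟩ := p.split hP hi
      have := h.le i hi m hm _ h₁ _ q
      have := h.le m hm j hj _ h₂ _ q'
      have := hle i hi j hj m hm
      linarith
    have := (abs_le.1 h1).2
    rw [if_pos (by linarith)]
    exact key
  eq i hi j hj := by
    split_ifs with hD
    · right
      have hB' : L * X ≤ B := le_trans (by rw [mul_assoc]; exact Nat.mul_le_mul_left _ (by omega)) hB
      have hB0' : (0 : ℤ) < B := by exact_mod_cast hB0
      rcases heq i hi j hj with h4 | ⟨m, hm, h4⟩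
      · omega
      · have b1 := h.eq_or_abs_le hw hB' hi hm
        have b2 := h.eq_or_abs_le hw hB' hm hj
        -- An infinite summand would force `D i j ≥ 3 * B`, contradicting `hD`.
        rcases h.eq i hi m hm with e1 | ⟨k, hk, q⟩
        · rcases b2 with b2 | b2
          · omega
          · rw [abs_le] at b2; omega
        rcases h.eq m hm j hj with e2 | ⟨k', hk', q'⟩
        · rcases b1 with b1 | b1
          · omega
          · rw [abs_le] at b1; omega
        rw [h4]
        exact ⟨k + k', by omega, q.append q'⟩
    · exact .inl rfl

/-- Zeros on the diagonal are correct even in the presence of loops, because these have nonnegative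
weight. -/
theorem Represents.init {P B : ℕ} {C : ℕ → ℕ → ℤ} (hw : NoNegativeCycle w)
    (hdiag : ∀ i < P, C i i = 0)
    (hsome : ∀ i j (hi : i < n) (hj : j < n) x, i ≠ j → w ⟨i, hi⟩ ⟨j, hj⟩ = some x → C i j = x)
    (hnone : ∀ i < P, ∀ j < P, i ≠ j → (∀ (hi : i < n) (hj : j < n), w ⟨i, hi⟩ ⟨j, hj⟩ = none) →
      C i j = 4 * B) : Represents w P 1 B C where
  le i hi j hj k hk ℓ p := by
    rcases eq_or_ne i j with rfl | hne
    · rw [hdiag i hi]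
      cases p with
      | nil => rfl
      | cons hi' hj' h p => exact hw _ _ ((StepWalk.cons hi' hj' h p).isWalk hi' hi')
    · cases p with
      | nil => exact (hne rfl).elim
      | cons hi' hj' h p =>
        obtain rfl := Nat.le_zero.1 (Nat.le_of_succ_le_succ hk)
        cases p
        simp [hsome _ _ hi' hj' _ hne h]
  eq i hi j hj := by
    rcases eq_or_ne i j with rfl | hne
    · exact .inr ⟨0, by omega, by rw [hdiag i hi]; exact .nil i⟩
    by_cases h : ∃ (hi : i < n) (hj : j < n) (x : ℤ), w ⟨i, hi⟩ ⟨j, hj⟩ = some x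
    · obtain ⟨hi', hj', x, hx⟩ := h
      refine .inr ⟨1, le_rfl, ?_⟩
      rw [hsome i j hi' hj' x hne hx, ← add_zero x]
      exact .cons hi' hj' hx (.nil j)
    · refine .inl (hnone i hi j hj hne fun hi' hj' => ?_)
      by_contra hx
      obtain ⟨x, hx⟩ := Option.ne_none_iff_exists'.1 hx
      exact h ⟨hi', hj', x, hx⟩

/-- Once `n ≤ L`, the matrix contains the distances. -/
theorem Represents.isLeast {P L B X : ℕ} {C : ℕ → ℕ → ℤ} (h : Represents w P L B C) (hP : n ≤ P)
    (hn : NoNegativeCycle w) (hL : n ≤ L) (hw : ∀ i j x, w i j = some x → |x| ≤ (X : ℤ))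
    (hB : L * X ≤ B) (hB0 : 0 < B) (i j : Fin n) :
    (C i j < 4 * B → IsLeast {ℓ | IsWalk w i j ℓ} (C i j)) ∧
      (¬ C i j < 4 * B → ¬ ∃ ℓ, IsWalk w i j ℓ) := by
  have hle : ∀ ℓ, IsWalk w i j ℓ → C i j ≤ ℓ ∧ C i j < 4 * B := by
    intro ℓ p
    obtain ⟨k, q⟩ := p.exists_stepWalk
    obtain ⟨k', hk', ℓ', hℓ', q'⟩ := q.shorten hn
    have h1 := h.le i (by omega) j (by omega) k' (by omega) ℓ' q'
    have h2 := (abs_le.1 (q'.abs_weight_le hw)).2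
    have h3 : k' * X ≤ B := (Nat.mul_le_mul_right _ (hk'.trans hL)).trans hB
    have h4 : (k' : ℤ) * X ≤ B := by exact_mod_cast h3
    have hB0' : (0 : ℤ) < B := by exact_mod_cast hB0
    exact ⟨h1.trans hℓ', by linarith⟩
  constructor
  · intro hC
    refine ⟨?_, fun ℓ p => (hle ℓ p).1⟩
    rcases h.eq i (by omega) j (by omega) with e | ⟨k, hk, p⟩
    · exact (hC.ne e).elim
    · exact p.isWalk i.2 j.2
  · rintro hC ⟨ℓ, p⟩
    exact hC (hle ℓ p).2

end APSP

namespace WordRAM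

/-! ## States with small contents -/

/-- The first registers and the first arrays contain only numbers of absolute value at most `Z`. -/
structure Tidy (Z : ℕ) (τ : State) : Prop where
  reg : ∀ r < 13, |τ.reg r| ≤ (Z : ℤ)
  arr : ∀ a < 6, ∀ j, |τ.arr a j| ≤ (Z : ℤ)

/-- The expression uses no bit operations, only the first registers and arrays, and only small
constants. -/
def RExpr.plain : RExpr → Bool
  | .const k => decide (|k| ≤ 100)
  | .reg x => decide (x < 13)
  | .get a i => decide (a < 6) && i.plain
  | .bin o e f => (match o with
      | .band | .bor | .bxor | .shl | .shr => false
      | _ => true) && (e.plain && f.plain)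

variable {Z W S I : ℕ} {τ τ' : State}

theorem Tidy.small (h : Tidy Z τ) (hZ : 100 ≤ Z) : ∀ {e : RExpr}, e.plain = true → e.Small Z τ
  | .const k, he => by
      have : |k| ≤ 100 := by simpa [RExpr.plain] using he
      exact this.trans (by exact_mod_cast hZ)
  | .reg x, he => h.reg x (by simpa [RExpr.plain] using he)
  | .get a i, he => by
      simp only [RExpr.plain, Bool.and_eq_true, decide_eq_true_eq] at he
      exact ⟨h.small hZ he.2, h.arr a he.1 _⟩
  | .bin o e f, he => by
      simp only [RExpr.plain, Bool.and_eq_true] at he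
      refine ⟨?_, h.small hZ he.2.1, h.small hZ he.2.2⟩
      cases o <;> simp at he ⊢

/-- Word bounds that leave room for expressions of cost at most `1000` in numbers up to `Z`. -/
structure Roomy (Z W : ℕ) : Prop where
  le : 100 ≤ Z
  lt : Z ^ 1000 < W

theorem Roomy.lt_word (h : Roomy Z W) : Z < W :=
  lt_of_le_of_lt (Nat.le_self_pow (by norm_num) Z) h.lt

theorem Roomy.fits (h : Roomy Z W) {e : RExpr} (he : e.Small Z τ) (hc : e.cost ≤ 1000) :
    e.Fits W τ :=
  he.fits (by have := h.le; omega) h.lt hc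

theorem Tidy.fits (h : Tidy Z τ) (hZ : Roomy Z W) {e : RExpr} (he : e.plain = true)
    (hc : e.cost ≤ 1000) : e.Fits W τ :=
  hZ.fits (h.small hZ.le he) hc

theorem Tidy.setReg (h : Tidy Z τ) {r : ℕ} {v : ℤ} (hv : |v| ≤ (Z : ℤ)) : Tidy Z (τ.setReg r v) where
  reg x hx := by
    rw [State.setReg_reg, Function.update_apply]
    split_ifs
    exacts [hv, h.reg x hx]
  arr := h.arr

theorem Tidy.setArr (h : Tidy Z τ) {a : ℕ} {i v : ℤ} (hv : |v| ≤ (Z : ℤ)) :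
    Tidy Z (τ.setArr a i v) where
  reg := h.reg
  arr x hx j := by
    rcases eq_or_ne x a with rfl | hne
    · rw [State.setArr_arr, Function.update_self, Function.update_apply]
      split_ifs
      exacts [hv, h.arr x hx j]
    · rw [State.setArr_arr, Function.update_of_ne hne]
      exact h.arr x hx j

theorem Tidy.filled (h : Tidy Z τ) {r a m : ℕ} {idx val : ℕ → ℤ} (hm : m ≤ Z)
    (hv : ∀ k < m, |val k| ≤ (Z : ℤ)) : Tidy Z (τ.filled r a idx val m) where
  reg x hx := by
    rw [State.filled_reg, Function.update_apply]
    split_ifs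
    · simpa using hm
    · exact h.reg x hx
  arr x hx j := by
    rcases eq_or_ne x a with rfl | hne
    · rw [State.filled_arr, Function.update_self]
      exact abs_fillArr_le (h.arr x hx) hv j
    · rw [State.filled_arr, Function.update_of_ne hne]
      exact h.arr x hx j

theorem Tidy.filled_of_le (h : Tidy Z τ) {r a m : ℕ} (ha : 6 ≤ a) (idx val : ℕ → ℤ) (hm : m ≤ Z) :
    Tidy Z (τ.filled r a idx val m) where
  reg x hx := by
    rw [State.filled_reg, Function.update_apply]
    split_ifs
    · simpa using hm
    · exact h.reg x hx
  arr x hx j := by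
    rw [State.filled_arr, Function.update_of_ne (by omega)]
    exact h.arr x hx j

theorem Agree.tidy (h : Agree S I τ τ') (ht : Tidy Z τ) : Tidy Z τ' where
  reg x hx := by rw [h.reg]; exact ht.reg x hx
  arr a ha j := by rw [h.arr a ha]; exact ht.arr a ha j

/-- The states agree except for the registers from `11`, the array `5` and the memory `I`. -/
structure Near (S I : ℕ) (τ τ' : State) : Prop where
  reg : ∀ r < 11, τ'.reg r = τ.reg r
  arr : ∀ a < 5, τ'.arr a = τ.arr a
  cell : ∀ a ≥ 6, ∀ j, j % (S : ℤ) ≠ I → τ'.arr a j = τ.arr a j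

theorem Near.refl (τ : State) : Near S I τ τ := ⟨fun _ _ => rfl, fun _ _ => rfl, fun _ _ _ _ => rfl⟩

theorem Near.trans {τ₁ τ₂ τ₃ : State} (h : Near S I τ₁ τ₂) (h' : Near S I τ₂ τ₃) :
    Near S I τ₁ τ₃ :=
  ⟨fun r hr => (h'.reg r hr).trans (h.reg r hr), fun a ha => (h'.arr a ha).trans (h.arr a ha),
    fun a ha j hj => (h'.cell a ha j hj).trans (h.cell a ha j hj)⟩

theorem Agree.near (h : Agree S I τ τ') : Near S I τ τ' :=
  ⟨fun r _ => by rw [h.reg], fun a ha => h.arr a (by omega), fun a _ => h.cell a⟩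

theorem Near.setReg (h : Near S I τ τ') {r : ℕ} (hr : 11 ≤ r) (v : ℤ) :
    Near S I τ (τ'.setReg r v) :=
  ⟨fun x hx => by rw [State.setReg_reg, Function.update_of_ne (by omega)]; exact h.reg x hx,
    h.arr, h.cell⟩

theorem Near.setArr (h : Near S I τ τ') (i v : ℤ) : Near S I τ (τ'.setArr 5 i v) :=
  ⟨h.reg, fun x hx => by rw [State.setArr_arr, Function.update_of_ne (by omega)]; exact h.arr x hx,
    fun x hx => by rw [State.setArr_arr, Function.update_of_ne (by omega)]; exact h.cell x hx⟩

theorem Near.filled (h : Near S I τ τ') (hI : I < S) {r a m : ℕ} (hr : 11 ≤ r) (ha : 6 ≤ a)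
    (val : ℕ → ℤ) : Near S I τ (τ'.filled r a (fun k => k * S + I) val m) where
  reg x hx := by rw [State.filled_reg, Function.update_of_ne (by omega)]; exact h.reg x hx
  arr x hx := by rw [State.filled_arr, Function.update_of_ne (by omega)]; exact h.arr x hx
  cell x hx j hj := by
    rw [← h.cell x hx j hj, State.filled_arr]
    rcases eq_or_ne x a with rfl | hne
    · rw [Function.update_self, fillArr_of_ne]
      rintro k - rfl
      exact hj (cell_emod hI k)
    · rw [Function.update_of_ne hne]

theorem Holds.of_near {σ : State} (h : Holds S I τ σ) (hr5 : τ'.reg 5 = τ.reg 5)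
    (hr6 : τ'.reg 6 = τ.reg 6) (ha : ∀ a ≥ 6, τ'.arr a = τ.arr a) : Holds S I τ' σ :=
  ⟨hr5.trans h.size, hr6.trans h.index, fun x => by rw [ha 6 le_rfl]; exact h.reg x,
    fun a i => by rw [ha (a + 7) (by omega)]; exact h.arr a i⟩

theorem State.loadRegs_two (σ : State) (x y : ℤ) :
    σ.loadRegs [x, y] = (σ.setReg 0 x).setReg 1 y := by
  simp only [loadRegs, setReg, State.mk.injEq, and_true]
  funext r
  match r with
  | 0 => simp
  | 1 => simp
  | r + 2 => simp

theorem State.loadRegs_three (σ : State) (x y z : ℤ) :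
    σ.loadRegs [x, y, z] = ((σ.setReg 0 x).setReg 1 y).setReg 2 z := by
  simp only [loadRegs, setReg, State.mk.injEq, and_true]
  funext r
  match r with
  | 0 => simp
  | 1 => simp
  | 2 => simp
  | r + 3 => simp

/-- Setting a register of the memory `I`. -/
theorem Run.setCell {σ : State} {c r : ℕ} {e : RExpr} {Q : State → ℕ → Prop} (h : Holds S I τ σ)
    (hIS : I < S) (ht : Tidy Z τ) (hZ : Roomy Z W) (hr : r ≤ 100) (he : e.plain = true)
    (hc : e.cost ≤ 1000)
    (hQ : ∀ τ', Holds S I τ' (σ.setReg r (e.eval τ)) → Agree S I τ τ' → Q τ' (c + (e.cost + 6))) :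
    Run W (.put 6 (.cell (.const r)) e) τ c Q := by
  refine .put (ht.fits hZ ?_ ?_) (ht.fits hZ he hc) ?_
  · change (decide _ && (decide _) && decide _) = true
    simpa using hr
  · simp [RExpr.cell]
  · simp only [RExpr.cell, RExpr.eval_add, RExpr.eval_mul, RExpr.eval_const, RExpr.eval_reg, h.size,
      h.index, RExpr.cost_add, RExpr.cost_mul, RExpr.cost_const, RExpr.cost_reg]
    convert hQ _ (h.setReg hIS r _) (Agree.setArr le_rfl hIS r _) using 1
    omega

end WordRAM

namespace Reduction

open WordRAM DynAPSP Grid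

/-! ## The operations on the grid -/

/-- Change an entry of the vector, or ask for the entry of the product in a row. -/
inductive Command
  | set (x : ℕ) (y : ℤ)
  | ask (i : ℕ)

/-- The reduction modulo the number of vertices makes the function total; it is applied only to
valid indices. -/
def vertex (b : ℕ) (hb : 0 < b) (k : ℕ) : Fin (2 * b * b) :=
  ⟨k % (2 * b * b), Nat.mod_lt _ (by positivity)⟩

theorem vertex_val {b k : ℕ} (hb : 0 < b) (hk : k < 2 * b * b) : (vertex b hb k : ℕ) = k :=
  Nat.mod_eq_of_lt hk

def Command.ops (M : Model) (b U : ℕ) (hb : 0 < b) : Command → List (Op (2 * b * b))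
  | .set x y => match M with
    | .weightUpdates => [.setWeight (vertex b hb ((b - 1) * b + x)) (vertex b hb (b * b + x))
        (4 * U * b + y).toNat]
    | .edgeUpdates => [.removeEdge (vertex b hb ((b - 1) * b + x)) (vertex b hb (b * b + x)),
        .insertEdge (vertex b hb ((b - 1) * b + x)) (vertex b hb (b * b + x))
          (4 * U * b + y).toNat]
  | .ask i => [.query (vertex b hb (i * b)) (vertex b hb ((2 * b - 1 - i) * b + (b - 1)))]

def Command.Ok (b U : ℕ) : Command → Prop
  | .set x y => x < b ∧ |y| ≤ U
  | .ask i => i < b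

variable {M : Model} {b U : ℕ} {A : ℕ → ℕ → ℤ} {v : ℕ → ℤ}

theorem crossing_lt (hb : 0 < b) {x : ℕ} (hx : x < b) :
    (b - 1) * b + x < 2 * b * b ∧ b * b + x < 2 * b * b ∧ b * b + x = (b - 1) * b + x + b := by
  refine ⟨Grid.vertex_lt (by omega) hx, Grid.vertex_lt (by omega) hx, ?_⟩
  have : (b - 1 + 1) * b = (b - 1) * b + b := by ring
  rw [Nat.sub_add_cancel hb] at this
  omega

theorem bounded_update (h : Bounded b U A v) {x : ℕ} {y : ℤ} (hy : |y| ≤ U) :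
    Bounded b U A (Function.update v x y) where
  matrix := h.matrix
  vector z hz := by
    rw [Function.update_apply]
    split_ifs
    exacts [hy, h.vector z hz]

theorem toNat_crossing_le (hb : 0 < b) {y : ℤ} (hy : |y| ≤ U) :
    0 ≤ 4 * U * b + y ∧ (4 * U * b + y).toNat ≤ 6 * U * b := by
  have hb' : (1 : ℤ) ≤ b := by exact_mod_cast hb
  have hU : (0 : ℤ) ≤ U := by positivity
  have := abs_le.1 hy
  have : (U : ℤ) ≤ U * b := by nlinarith
  refine ⟨by linarith, Int.toNat_le.2 ?_⟩
  push_cast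
  linarith

theorem validSeq_ops {c : ℕ} (hb : 0 < b) (hc : 6 * U * b ≤ (2 * b * b) ^ c) :
    ∀ (l : List Command) (v : ℕ → ℤ), Bounded b U A v → (∀ k ∈ l, k.Ok b U) →
      ValidSeq M c (wgraph b U A v) (l.flatMap (Command.ops M b U hb))
  | [], _, _, _ => trivial
  | .ask i :: l, v, h, hl =>
      ⟨trivial, validSeq_ops hb hc l v h fun k hk => hl k (List.mem_cons_of_mem _ hk)⟩
  | .set x y :: l, v, h, hl => by
      obtain ⟨hx, hy⟩ : x < b ∧ |y| ≤ U := hl _ List.mem_cons_self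
      obtain ⟨c1, c2, c3⟩ := crossing_lt hb hx
      have hp := vertex_val hb c1
      have hq := vertex_val hb c2
      have hq := hq.trans (c3.trans (congrArg (· + b) hp.symm))
      have ih := validSeq_ops hb hc l _ (bounded_update h (x := x) hy)
        fun k hk => hl k (List.mem_cons_of_mem _ hk)
      have hadj : (graph b).Adj (vertex b hb ((b - 1) * b + x)) (vertex b hb (b * b + x)) :=
        (adj_iff hb).2 (.inl (.inl hq))
      have hle := (toNat_crossing_le hb hy).2.trans hc
      rw [List.flatMap_cons]
      cases M with
      | weightUpdates =>
        rw [← setWeight_apply hb hx y hp hq] at ih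
        exact ⟨⟨rfl, hadj, hle⟩, ih⟩
      | edgeUpdates =>
        rw [← removeEdge_insertEdge_apply hb hx y hp hq] at ih
        refine ⟨⟨rfl, hadj⟩, ⟨rfl, hadj.ne, ?_, ?_, hle⟩, ih⟩
        · simp [Op.apply]
        -- Reinserting the removed edge gives back the original grid.
        · change IsPlanar ((graph b).deleteEdges _ ⊔ _)
          rw [deleteEdges_sup_edge hadj]
          exact graph_isPlanar hb

theorem length_ops_le (hb : 0 < b) (l : List Command) :
    (l.flatMap (Command.ops M b U hb)).length ≤ 2 * l.length := by
  induction l with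
  | nil => simp
  | cons k l ih =>
    rw [List.flatMap_cons, List.length_append, List.length_cons]
    have : (k.ops M b U hb).length ≤ 2 := by
      cases k with
      | set x y => cases M <;> simp [Command.ops]
      | ask i => simp [Command.ops]
    omega

/-! ## Performing the operations -/

abbrev rN : RExpr := .reg 0
abbrev rb : RExpr := .reg 1
abbrev rP : RExpr := .reg 2
abbrev rQ : RExpr := .reg 3
abbrev rB : RExpr := .reg 4
abbrev rI : RExpr := .reg 6
abbrev rL : RExpr := .reg 7
abbrev rBlock : RExpr := .reg 8
abbrev rRow : RExpr := .reg 9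
abbrev rCol : RExpr := .reg 10
abbrev rl : RExpr := .reg 11
abbrev rx : RExpr := .reg 12

def setArgs (p : Prog) : Prog :=
  .seq (.put 6 (.cell (.const (0 : ℕ))) ((rb - .const 1) * rb + rx))
    (.seq (.put 6 (.cell (.const (1 : ℕ))) (rb * rb + rx)) p)

/-- The entries are bounded by `U = 4 * B`, so `16 * B * b` is the base weight `4 * U * b` of a
column edge. -/
def setWeightArg (p : Prog) : Prog :=
  .seq (.put 6 (.cell (.const (2 : ℕ)))
    (.const 16 * rB * rb + .get 4 ((rCol + rx) * rP + rl))) p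

def updateProgram (D : Algorithm) : Model → Prog
  | .weightUpdates => setArgs (setWeightArg D.setWeight.relocate)
  | .edgeUpdates => .seq (setArgs D.removeEdge.relocate)
      (setArgs (setWeightArg D.insertEdge.relocate))

/-- The answer is read from the simulated register `1`. Adding the first entry of the row and
subtracting the length of the route without `m` leaves `m`, and array `5` keeps the minimum over the
blocks treated so far. -/
def askProgram (D : Algorithm) : Prog :=
  .seq (.put 6 (.cell (.const (0 : ℕ))) (rx * rb))
  (.seq (.put 6 (.cell (.const (1 : ℕ)))
    ((.const 2 * rb - .const 1 - rx) * rb + (rb - .const 1)))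
  (.seq D.query.relocate
  (.seq (.put 5 ((rRow + rx) * rP + rl)
    (.sel (.lt (.get 6 (.cell (.const (1 : ℕ))) + .get 4 ((rRow + rx) * rP + rCol) -
        ((rb - .const 1) * (.const 16 * rB * (rx + .const 1)) +
          (.const 2 * (rb - .const 1 - rx) + .const 1) * (.const 16 * rB * rb)))
          (.get 5 ((rRow + rx) * rP + rl)))
      (.get 6 (.cell (.const (1 : ℕ))) + .get 4 ((rRow + rx) * rP + rCol) -
        ((rb - .const 1) * (.const 16 * rB * (rx + .const 1)) +
          (.const 2 * (rb - .const 1 - rx) + .const 1) * (.const 16 * rB * rb)))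
      (.get 5 ((rRow + rx) * rP + rl))))
    .skip)))

/-- The contents of the registers while a block of the matrix is processed, and the bounds for the
sizes of the numbers. -/
structure Setting (D : Algorithm) (V W Z b P B S I row col : ℕ) (τ : State) : Prop where
  roomy : Roomy Z W
  word : V * S < W
  preprocess : D.preprocess.regBound * S < W
  insertEdge : D.insertEdge.regBound * S < W
  removeEdge : D.removeEdge.regBound * S < W
  setWeight : D.setWeight.regBound * S < W
  query : D.query.regBound * S < W
  regb : τ.reg 1 = b
  regP : τ.reg 2 = P
  regB : τ.reg 4 = B
  regS : τ.reg 5 = S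
  regI : τ.reg 6 = I
  regRow : τ.reg 9 = row
  regCol : τ.reg 10 = col
  pos : 0 < b
  lt : I < S
  row_le : row + b ≤ P
  col_le : col + b ≤ P
  entry : ∀ j, |τ.arr 4 j| ≤ 4 * B
  size : 100 * B * b * b ≤ Z
  size' : 4 * b * b ≤ Z
  sizeP : P ≤ Z

theorem Setting.near {D : Algorithm} {V W Z b P B S I row col : ℕ} {τ τ' : State}
    (h : Setting D V W Z b P B S I row col τ) (h' : Near S I τ τ') :
    Setting D V W Z b P B S I row col τ' where
  __ := h
  regb := by rw [h'.reg 1 (by norm_num), h.regb]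
  regP := by rw [h'.reg 2 (by norm_num), h.regP]
  regB := by rw [h'.reg 4 (by norm_num), h.regB]
  regS := by rw [h'.reg 5 (by norm_num), h.regS]
  regI := by rw [h'.reg 6 (by norm_num), h.regI]
  regRow := by rw [h'.reg 9 (by norm_num), h.regRow]
  regCol := by rw [h'.reg 10 (by norm_num), h.regCol]
  entry := by rw [h'.arr 4 (by norm_num)]; exact h.entry

/-- The block of the matrix in array `4` whose first entry is in row `row` and column `col`. -/
def block (τ : State) (P row col : ℕ) (i x : ℕ) : ℤ := τ.arr 4 ((row + i) * P + (col + x))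

/-- Part of a column of the matrix in array `4`. -/
def column (τ : State) (P col l : ℕ) (x : ℕ) : ℤ := τ.arr 4 ((col + x) * P + l)

/-- Memory `I` is ready for performing the given commands in time, where `v` is the current
vector. -/
def Ready (M : Model) (D : Algorithm) (V S I b U : ℕ) (hb : 0 < b) (A : ℕ → ℕ → ℤ) (v : ℕ → ℤ)
    (l : List Command) (R : ℕ) (τ : State) (c : ℕ) : Prop :=
  ∃ σ T, Holds S I τ σ ∧ D.Serves V (wgraph b U A v) σ (l.flatMap (Command.ops M b U hb)) T ∧
    c + 6 * T ≤ R

variable {D : Algorithm} {V W Z P B S I row col R c : ℕ} {τ τ' : State} {l : List Command}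

/-- The number `R` is a deadline for all remaining operations. No individual operation has a time
bound of its own, so only the overhead of the surrounding program is charged, by moving the
deadline. -/
theorem Ready.of_near {hb : 0 < b} {c' R' : ℕ} (h : Ready M D V S I b U hb A v l R τ c)
    (hr5 : τ'.reg 5 = τ.reg 5) (hr6 : τ'.reg 6 = τ.reg 6) (ha : ∀ a ≥ 6, τ'.arr a = τ.arr a)
    (hc : c' + R ≤ c + R') : Ready M D V S I b U hb A v l R' τ' c' :=
  let ⟨σ, T, hh, hs, hT⟩ := h
  ⟨σ, T, hh.of_near hr5 hr6 ha, hs, by omega⟩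

theorem run_setArgs {σ : State} {x : ℕ} {p : Prog} {Q : State → ℕ → Prop}
    (hs : Setting D V W Z b P B S I row col τ) (ht : Tidy Z τ) (h : Holds S I τ σ)
    (hx : τ.reg 12 = x)
    (hQ : ∀ τ', Holds S I τ' ((σ.setReg 0 ((b - 1) * b + x)).setReg 1 (b * b + x)) →
      Agree S I τ τ' → Run W p τ' (c + 24) Q) : Run W (setArgs p) τ c Q := by
  refine .seq (.setCell h hs.lt ht hs.roomy (by norm_num) (by decide) (by decide)
    fun τ₁ h₁ a₁ => .seq (.setCell h₁ hs.lt (a₁.tidy ht) hs.roomy (by norm_num) (by decide)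
      (by decide) fun τ₂ h₂ a₂ => ?_))
  have := hQ τ₂ (by simpa [a₁.reg, hs.regb, hx] using h₂) (a₁.trans a₂)
  exact this

theorem run_setWeightArg {σ : State} {x l : ℕ} {p : Prog} {Q : State → ℕ → Prop}
    (hs : Setting D V W Z b P B S I row col τ) (ht : Tidy Z τ) (h : Holds S I τ σ)
    (hx : τ.reg 12 = x) (hl : τ.reg 11 = l)
    (hQ : ∀ τ', Holds S I τ' (σ.setReg 2 (4 * (4 * B : ℕ) * b + column τ P col l x)) →
      Agree S I τ τ' → Run W p τ' (c + 20) Q) : Run W (setWeightArg p) τ c Q := by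
  refine .seq (.setCell h hs.lt ht hs.roomy (by norm_num) (by decide) (by decide)
    fun τ₁ h₁ a₁ => ?_)
  have := hQ τ₁ ?_ a₁
  · exact this
  · convert h₁ using 2
    simp only [RExpr.eval_add, RExpr.eval_mul, RExpr.eval_get, RExpr.eval_const, RExpr.eval_reg,
      hs.regb, hs.regB, hs.regP, hs.regCol, hx, hl, column]
    push_cast; ring

theorem cast_vertex {b k : ℕ} (hb : 0 < b) (hk : k < 2 * b * b) :
    (((vertex b hb k : Fin _) : ℕ) : ℤ) = k := by
  rw [vertex_val hb hk]

theorem args_removeEdge (hb : 0 < b) {x : ℕ} (hx : x < b) (σ : State) :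
    σ.loadRegs (Op.removeEdge (vertex b hb ((b - 1) * b + x)) (vertex b hb (b * b + x))).args =
      (σ.setReg 0 ((b - 1) * b + x)).setReg 1 (b * b + x) := by
  obtain ⟨c1, c2, -⟩ := crossing_lt hb hx
  rw [Op.args, State.loadRegs_two, cast_vertex hb c1, cast_vertex hb c2]
  push_cast [Nat.cast_sub (by omega : 1 ≤ b)]
  rfl

theorem args_setWeight (hb : 0 < b) {x : ℕ} (hx : x < b) {y : ℤ} (hy : |y| ≤ U) (σ : State) :
    σ.loadRegs (Op.setWeight (vertex b hb ((b - 1) * b + x)) (vertex b hb (b * b + x))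
      (4 * U * b + y).toNat).args =
      ((σ.setReg 0 ((b - 1) * b + x)).setReg 1 (b * b + x)).setReg 2 (4 * U * b + y) := by
  obtain ⟨c1, c2, -⟩ := crossing_lt hb hx
  rw [Op.args, State.loadRegs_three, cast_vertex hb c1, cast_vertex hb c2,
    Int.toNat_of_nonneg (toNat_crossing_le hb hy).1]
  push_cast [Nat.cast_sub (by omega : 1 ≤ b)]
  rfl

theorem run_updateProgram {x y : ℕ} (hs : Setting D V W Z b P B S I row col τ) (ht : Tidy Z τ)
    (hx : τ.reg 12 = x) (hy : τ.reg 11 = y) (hxb : x < b)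
    (h : Ready M D V S I b (4 * B) hs.pos A v (.set x (column τ P col y x) :: l) R τ c) :
    Run W (updateProgram D M) τ c fun τ' c' => Agree S I τ τ' ∧
      Ready M D V S I b (4 * B) hs.pos A (Function.update v x (column τ P col y x)) l (R + 100)
        τ' c' := by
  obtain ⟨σ, T, hh, hserve, hT⟩ := h
  have hb := hs.pos
  have hcol : |column τ P col y x| ≤ (4 * B : ℕ) := by
    push_cast; exact hs.entry _
  obtain ⟨c1, c2, c3⟩ := crossing_lt hb hxb
  have hp := vertex_val hb c1
  have hq := vertex_val hb c2
  have hq := hq.trans (c3.trans (congrArg (· + b) hp.symm))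
  rw [List.flatMap_cons] at hserve
  cases M with
  | weightUpdates =>
    obtain ⟨t, T', σ', hx', -, hserve, rfl⟩ := hserve
    rw [args_setWeight hb hxb hcol] at hx'
    rw [setWeight_apply hb hxb _ hp hq] at hserve
    refine run_setArgs hs ht hh hx fun τ₁ h₁ a₁ => ?_
    refine run_setWeightArg (hs.near a₁.near) (a₁.tidy ht) h₁ (by rw [a₁.reg, hx])
      (by rw [a₁.reg, hy]) fun τ₂ h₂ a₂ => ?_
    rw [column, a₁.arr 4 (by norm_num)] at h₂
    refine .relocate hx' h₂ hs.lt hs.word hs.setWeight fun τ₃ c₃ h₃ a₃ hc => ?_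
    exact ⟨(a₁.trans a₂).trans a₃, σ', T', h₃, hserve, by omega⟩
  | edgeUpdates =>
    obtain ⟨t, T', σ', hx', -, hserve, rfl⟩ := hserve
    obtain ⟨t₂, T₂, σ₂, hx₂, -, hserve, rfl⟩ := hserve
    rw [args_removeEdge hb hxb] at hx'
    -- An insertion takes the same three arguments as a weight update, so `args_setWeight` applies.
    change Exec _ _ (σ'.loadRegs (Op.setWeight (vertex b hb ((b - 1) * b + x))
      (vertex b hb (b * b + x)) (4 * (4 * B : ℕ) * b + column τ P col y x).toNat).args) _ _ at hx₂
    rw [args_setWeight hb hxb hcol] at hx₂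
    rw [removeEdge_insertEdge_apply hb hxb _ hp hq] at hserve
    refine .seq (run_setArgs hs ht hh hx fun τ₁ h₁ a₁ => ?_)
    refine .relocate hx' h₁ hs.lt hs.word hs.removeEdge fun τ₂ c₂ h₂ a₂ hc₂ => ?_
    have a := a₁.trans a₂
    refine run_setArgs (hs.near a.near) (a.tidy ht) h₂ (by rw [a.reg, hx]) fun τ₃ h₃ a₃ => ?_
    have a := a.trans a₃
    refine run_setWeightArg (hs.near a.near) (a.tidy ht) h₃ (by rw [a.reg, hx])
      (by rw [a.reg, hy]) fun τ₄ h₄ a₄ => ?_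
    rw [column, a.arr 4 (by norm_num)] at h₄
    refine .relocate hx₂ h₄ hs.lt hs.word hs.insertEdge fun τ₅ c₅ h₅ a₅ hc₅ => ?_
    exact ⟨(a.trans a₄).trans a₅, σ₂, T₂, h₅, hserve, by omega⟩

/-- Needed so that a distance read from the simulated memory is known to be small. The horizontal
parts contribute at most `4 * U * b * b`, the vertical part at most `8 * U * b * b`. -/
theorem abs_span_le (hb : 0 < b) {i : ℕ} (hi : i < b) (U : ℕ) (m : ℤ) :
    0 ≤ span b U i m - m ∧ span b U i m - m ≤ 12 * U * b * b := by
  have hb' : (1 : ℤ) ≤ b := by exact_mod_cast hb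
  have hi' : (i : ℤ) + 1 ≤ b := by exact_mod_cast hi
  have hi0 : (0 : ℤ) ≤ i := by positivity
  have hU : (0 : ℤ) ≤ U := by positivity
  have hUb : (0 : ℤ) ≤ U * b := by positivity
  have h1 : 0 ≤ (b - 1 : ℤ) * (4 * U * (i + 1)) := mul_nonneg (by omega) (by positivity)
  have h2 : (b - 1 : ℤ) * (4 * U * (i + 1)) ≤ b * (4 * U * b) :=
    mul_le_mul (by omega) (mul_le_mul_of_nonneg_left hi' (by positivity)) (by positivity)
      (by positivity)
  have h3 : 0 ≤ (2 * (b - 1 - i) + 1 : ℤ) * (4 * U * b) := mul_nonneg (by omega) (by positivity)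
  have h4 : (2 * (b - 1 - i) + 1 : ℤ) * (4 * U * b) ≤ (2 * b) * (4 * U * b) :=
    mul_le_mul_of_nonneg_right (by omega) (by positivity)
  simp only [span]
  constructor <;> nlinarith

theorem run_askProgram {i y : ℕ} (hs : Setting D V W Z b P B S I row col τ) (ht : Tidy Z τ)
    (hx : τ.reg 12 = i) (hy : τ.reg 11 = y) (hi : i < b)
    (hv : ∀ x < b, v x = column τ P col y x)
    (h : Ready M D V S I b (4 * B) hs.pos (block τ P row col) v (.ask i :: l) R τ c) :
    Run W (askProgram D) τ c fun τ' c' => ∃ m,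
      IsLeast {z | ∃ x < b, z = block τ P row col i x + column τ P col y x} m ∧
      Near S I τ τ' ∧ τ'.reg = τ.reg ∧ τ'.arr 5 = Function.update (τ.arr 5) ((row + i) * P + y)
        (min (τ.arr 5 ((row + i) * P + y)) m) ∧ Tidy Z τ' ∧
      Ready M D V S I b (4 * B) hs.pos (block τ P row col) v l (R + 400) τ' c' := by
  obtain ⟨σ, T, hh, hserve, hT⟩ := h
  have hb := hs.pos
  obtain ⟨t, T', σ', hx', hans, hserve, rfl⟩ := hserve
  have hbd : Bounded b (4 * B) (block τ P row col) v :=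
    ⟨fun i _ x _ => by push_cast; exact hs.entry _,
      fun x hx => by rw [hv x hx]; push_cast; exact hs.entry _⟩
  obtain ⟨x₀, hx₀, hmin⟩ := Finset.exists_min_image (Finset.range b)
    (fun x => block τ P row col i x + v x) ⟨0, by simpa using hb⟩
  have hx₀ := Finset.mem_range.1 hx₀
  set m := block τ P row col i x₀ + v x₀ with hm
  have hleast : IsLeast {z | ∃ x < b, z = block τ P row col i x + v x} m :=
    ⟨⟨x₀, hx₀, hm⟩, by rintro _ ⟨x, hx, rfl⟩; exact hmin x (Finset.mem_range.2 hx)⟩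
  have hleast' : IsLeast {z | ∃ x < b, z = block τ P row col i x + column τ P col y x} m := by
    convert hleast using 3 with z
    exact exists_congr fun x => and_congr_right fun h => by rw [hv x h]
  have hmabs : |m| ≤ 8 * B := by
    have h1 := hbd.matrix i hi x₀ hx₀
    have h2 := hbd.vector x₀ hx₀
    push_cast at h1 h2
    exact (abs_add_le _ _).trans (by linarith)
  have hp1 : i * b < 2 * b * b := by
    have := Grid.vertex_lt (R := i) (by omega) hb; omega
  have hq1 : (2 * b - 1 - i) * b + (b - 1) < 2 * b * b := Grid.vertex_lt (by omega) (by omega)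
  obtain ⟨hreach, hdist⟩ := isDist_iff hbd hb hi hleast (vertex_val hb hp1) (vertex_val hb hq1)
  have hreg : σ'.reg 1 = span b (4 * B) i m - block τ P row col i 0 := by
    rcases hans with ⟨-, d, hd, hd'⟩ | ⟨-, hnot⟩
    · rw [hd]; exact hdist d hd'
    · exact (hnot hreach).elim
  rw [Op.args, State.loadRegs_two, cast_vertex hb hp1, cast_vertex hb hq1] at hx'
  have hZ := hs.size
  have hZ' : (100 : ℤ) * B * b * b ≤ Z := by exact_mod_cast hZ
  have hb1 : (1 : ℤ) ≤ b := by exact_mod_cast hb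
  have hB0 : (0 : ℤ) ≤ B := by positivity
  have hBb : (B : ℤ) ≤ B * b * b := by
    have : (B : ℤ) * 1 ≤ B * (b * b) := mul_le_mul_of_nonneg_left (by nlinarith) hB0
    linarith
  refine .seq (.setCell hh hs.lt ht hs.roomy (by norm_num) (by decide) (by decide)
    fun τ₁ h₁ a₁ => .seq (.setCell h₁ hs.lt (a₁.tidy ht) hs.roomy (by norm_num) (by decide)
      (by decide) fun τ₂ h₂ a₂ => .seq ?_))
  have h₂' : Holds S I τ₂ ((σ.setReg 0 (i * b : ℕ)).setReg 1
      ((2 * b - 1 - i) * b + (b - 1) : ℕ)) := by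
    convert h₂ using 2
    · simp [hx, hs.regb]
    · simp only [RExpr.eval_add, RExpr.eval_mul, RExpr.eval_sub, RExpr.eval_const, RExpr.eval_reg,
        a₁.reg, hs.regb, hx]
      push_cast [Nat.cast_sub (by omega : i ≤ 2 * b - 1), Nat.cast_sub (by omega : 1 ≤ 2 * b),
        Nat.cast_sub (by omega : 1 ≤ b)]
      rfl
  refine .relocate hx' h₂' hs.lt hs.word hs.query fun τ₃ c₃ h₃ a₃ hc₃ => ?_
  have a := (a₁.trans a₂).trans a₃
  have ht₃ := a.tidy ht
  have hs₃ := hs.near a.near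
  have hcell : τ₃.arr 6 (1 * S + I) = span b (4 * B) i m - block τ P row col i 0 := by
    rw [← hreg, ← h₃.reg 1, Nat.cast_one]
  -- `Tidy` says nothing about the simulated memories, whose contents belong to an arbitrary
  -- algorithm. This one cell is bounded because it holds a correct distance.
  have hread : |τ₃.arr 6 (1 * S + I)| ≤ (Z : ℤ) := by
    rw [hcell]
    have h1 := abs_span_le hb hi (4 * B) m
    have h2 := abs_le.1 hmabs
    have h3 := abs_le.1 (hs.entry ((row + i) * P + (col + 0)))
    push_cast at h1
    simp only [block, Nat.cast_zero]
    rw [abs_le]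
    constructor <;> linarith
  have hget : (RExpr.get 6 (.cell (.const (1 : ℕ)))).eval τ₃ =
      span b (4 * B) i m - block τ P row col i 0 := by
    rw [← hcell]; simp [RExpr.cell, hs₃.regS, hs₃.regI]
  have hsmall : (RExpr.get 6 (.cell (.const (1 : ℕ)))).Small Z τ₃ :=
    ⟨ht₃.small hs.roomy.le (by decide), by
      simpa [RExpr.cell, hs₃.regS, hs₃.regI] using hread⟩
  refine .seq (.put (ht₃.fits hs.roomy (by decide) (by decide)) (hs.roomy.fits ?_ (by decide)) ?_)
  · have hh := hs.roomy.le
    refine (RExpr.small_sel ..).2 ⟨?_, ?_, ht₃.small hh (by decide), by omega⟩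
    · exact (RExpr.small_lt ..).2 ⟨(RExpr.small_sub ..).2 ⟨(RExpr.small_add ..).2
        ⟨hsmall, ht₃.small hh (by decide)⟩, ht₃.small hh (by decide)⟩, ht₃.small hh (by decide)⟩
    · exact (RExpr.small_sub ..).2 ⟨(RExpr.small_add ..).2
        ⟨hsmall, ht₃.small hh (by decide)⟩, ht₃.small hh (by decide)⟩
  have hidx : ((rRow + rx) * rP + rl).eval τ₃ = (row + i) * P + y := by
    simp [hs₃.regRow, hs₃.regP, a.reg, hx, hy]
  have hval : (RExpr.get 6 (.cell (.const (1 : ℕ))) + .get 4 ((rRow + rx) * rP + rCol) -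
        ((rb - .const 1) * (.const 16 * rB * (rx + .const 1)) +
          (.const 2 * (rb - .const 1 - rx) + .const 1) * (.const 16 * rB * rb))).eval τ₃ = m := by
    rw [RExpr.eval_sub, RExpr.eval_add, hget]
    simp only [RExpr.eval_add, RExpr.eval_mul, RExpr.eval_sub, RExpr.eval_get, RExpr.eval_const,
      RExpr.eval_reg, hs₃.regRow, hs₃.regP, hs₃.regCol, hs₃.regb, hs₃.regB, a.reg, hx,
      a.arr 4 (by norm_num), span, block]
    push_cast
    rw [add_zero]; ring
  rw [hidx, RExpr.eval_sel _ _ _ _ (RExpr.eval_lt ..), hval, RExpr.eval_get, hidx,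
    a.arr 5 (by norm_num)]
  have hmin' : (if m < τ.arr 5 ((row + i) * P + y) then m else τ.arr 5 ((row + i) * P + y)) =
      min (τ.arr 5 ((row + i) * P + y)) m := by
    rw [min_def]; split_ifs <;> omega
  rw [hmin']
  have hold := ht.arr 5 (by norm_num) ((row + i) * P + y)
  have hmZ : |m| ≤ (Z : ℤ) := hmabs.trans (by linarith)
  refine ⟨_, _, .skip _, m, hleast', (a.near.setArr _ _), a.reg, ?_, ?_, ?_⟩
  · rw [State.setArr_arr, Function.update_self, a.arr 5 (by norm_num)]
  · refine ht₃.setArr ?_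
    rcases min_choice (τ.arr 5 ((row + i) * P + y)) m with e | e <;> rw [e] <;> assumption
  · refine Ready.of_near (c := c₃) (τ := τ₃) (R := R + 100) ⟨σ', T', h₃, hserve, ?_⟩ rfl rfl
      (fun a ha => by rw [State.setArr_arr, Function.update_of_ne (by omega)]) ?_
    · simp at hc₃; omega
    · simp [RExpr.cell]; omega

end Reduction

/-! ### Loading an array into an interleaved memory -/

namespace WordRAM

/-- `State.loadArr` also puts zeros in all other cells of the array, which the loop does not do;
hence the requirement that the array be zero beforehand. -/
theorem Holds.loadArr {S I r a : ℕ} {τ σ : State} (h : Holds S I τ σ) (hIS : I < S)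
    (hr : 7 ≤ r) (l : List ℤ) (hσ : ∀ j, σ.arr a j = 0) :
    Holds S I (τ.filled r (a + 7) (fun k => k * S + I) (fun k => l.getD k 0) l.length)
      (σ.loadArr a l) where
  size := by rw [State.filled_reg, Function.update_of_ne (by omega), h.size]
  index := by rw [State.filled_reg, Function.update_of_ne (by omega), h.index]
  reg x := by
    rw [State.filled_arr, Function.update_of_ne (by omega)]
    exact h.reg x
  arr a' i := by
    have hinj : Function.Injective fun k : ℕ => (k * S + I : ℤ) := fun k k' hk => by
      have := (cell_inj hIS).1 hk
      exact_mod_cast this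
    rcases eq_or_ne a' a with rfl | hne
    · rw [State.filled_arr, Function.update_self]
      simp only [State.loadArr, Function.update_self]
      by_cases hi : 0 ≤ i ∧ i.toNat < l.length
      · rw [if_pos hi.1]
        have := fillArr_idx (f := τ.arr (a' + 7)) (val := fun k => l.getD k 0) hinj hi.2
        simpa [Int.toNat_of_nonneg hi.1] using this
      · rw [fillArr_of_ne, h.arr, hσ]
        · split_ifs with h0
          · rw [List.getD_eq_default _ _ (by omega)]
          · rfl
        · intro k hk hki
          have := (cell_inj hIS).1 hki
          omega
    · rw [State.filled_arr, Function.update_of_ne (by omega), h.arr]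
      simp [State.loadArr, hne]

end WordRAM

namespace Reduction

open WordRAM DynAPSP Grid

/-! ## Writing down the grid -/

def colEdges : RExpr := (.const 2 * rb - .const 1) * rb
def edgeCountExpr : RExpr := colEdges + .const 2 * rb * (rb - .const 1)

def edgeStartExpr : RExpr :=
  .sel (.lt rx colEdges) rx
    ((rx - colEdges) / (rb - .const 1) * rb + (rx - colEdges) % (rb - .const 1))

def edgeEndExpr : RExpr := .sel (.lt rx colEdges) (rx + rb) (edgeStartExpr + .const 1)

def startRow : RExpr := .get 7 (.cell rx) / rb
def startCol : RExpr := .get 7 (.cell rx) % rb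

/-- The vector is zero initially, so all column edges have the same weight. The start of the edge is
read back from array `7`, where the first loop of `loadProgram` has stored it, which keeps the
expression short. -/
def weightExpr : RExpr :=
  .sel (.lt rx colEdges) (.const 16 * rB * rb)
    (.const 16 * rB * (.sel (.lt startRow rb) startRow (.const 2 * rb - .const 1 - startRow)
      + .const 1) + .sel (.lt startRow rb)
        (.get 4 ((rRow + startRow) * rP + (rCol + (startCol + .const 1))) -
          .get 4 ((rRow + startRow) * rP + (rCol + startCol))) (.const 0))

def loadProgram : Prog :=
  .seq (.put 6 (.cell (.const (0 : ℕ))) (.const 2 * rb * rb))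
  (.seq (.put 6 (.cell (.const (1 : ℕ))) edgeCountExpr)
  (.seq (.forLoop 12 edgeCountExpr (.put 7 (.cell rx) edgeStartExpr))
  (.seq (.forLoop 12 edgeCountExpr (.put 8 (.cell rx) edgeEndExpr))
    (.forLoop 12 edgeCountExpr (.put 9 (.cell rx) weightExpr)))))

variable {D : Algorithm} {V W Z b P B S I row col R c : ℕ} {τ τ' : State} {A : ℕ → ℕ → ℤ}

theorem eval_colEdges (hb : 0 < b) (h : τ.reg 1 = b) :
    colEdges.eval τ = ((2 * b - 1) * b : ℕ) := by
  simp only [colEdges, RExpr.eval_mul, RExpr.eval_sub, RExpr.eval_const, RExpr.eval_reg, h]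
  push_cast [Nat.cast_sub (by omega : 1 ≤ 2 * b)]
  rfl

theorem eval_edgeCountExpr (hb : 0 < b) (h : τ.reg 1 = b) :
    edgeCountExpr.eval τ = edgeCount b := by
  simp only [edgeCountExpr, RExpr.eval_add, eval_colEdges hb h, RExpr.eval_mul, RExpr.eval_sub,
    RExpr.eval_const, RExpr.eval_reg, h, edgeCount]
  push_cast [Nat.cast_sub (by omega : 1 ≤ b)]
  rfl

theorem eval_edgeStartExpr (hb : 0 < b) (h : τ.reg 1 = b) {k : ℕ} (hk : τ.reg 12 = k) :
    edgeStartExpr.eval τ = edgeStart b k := by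
  rw [edgeStartExpr, RExpr.eval_sel _ _ _ _ (RExpr.eval_lt ..), edgeStart]
  simp only [RExpr.eval_add, RExpr.eval_mul, RExpr.eval_sub, RExpr.eval_div, RExpr.eval_mod,
    RExpr.eval_const, RExpr.eval_reg, eval_colEdges hb h, h, hk, Nat.cast_lt]
  split_ifs with hlt
  · rfl
  · rw [← Nat.cast_sub (by omega : (2 * b - 1) * b ≤ k), ← Nat.cast_one (R := ℤ),
      ← Nat.cast_sub (by omega : 1 ≤ b)]
    push_cast
    rfl

theorem eval_edgeEndExpr (hb : 0 < b) (h : τ.reg 1 = b) {k : ℕ} (hk : τ.reg 12 = k) :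
    edgeEndExpr.eval τ = edgeEnd b k := by
  rw [edgeEndExpr, RExpr.eval_sel _ _ _ _ (RExpr.eval_lt ..), edgeEnd, eval_colEdges hb h]
  simp only [eval_edgeStartExpr hb h hk, RExpr.eval_add, RExpr.eval_const, RExpr.eval_reg, h, hk, Nat.cast_lt]
  split_ifs <;> push_cast <;> rfl

theorem eval_weightExpr (hs : Setting D V W Z b P B S I row col τ) {k : ℕ} (hk : τ.reg 12 = k)
    (hkE : k < edgeCount b) (hstart : τ.arr 7 (k * S + I) = edgeStart b k) :
    weightExpr.eval τ = weight b (4 * B) (block τ P row col) (fun _ => 0) (edgeStart b k)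
      (edgeEnd b k) := by
  have hb := hs.pos
  have hR : startRow.eval τ = (edgeStart b k / b : ℕ) := by
    simp [startRow, RExpr.cell, hk, hs.regS, hs.regI, hstart, hs.regb]
  have hX : startCol.eval τ = (edgeStart b k % b : ℕ) := by
    simp [startCol, RExpr.cell, hk, hs.regS, hs.regI, hstart, hs.regb]
  rw [weightExpr, RExpr.eval_sel _ _ _ _ (RExpr.eval_lt ..), eval_colEdges hb hs.regb]
  simp only [RExpr.eval_add, RExpr.eval_mul, RExpr.eval_sub, RExpr.eval_const, RExpr.eval_reg,
    RExpr.eval_sel _ _ _ _ (RExpr.eval_lt ..), RExpr.eval_get, hR, hX, hk, Nat.cast_lt, hs.regb,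
    hs.regB, hs.regRow, hs.regCol, hs.regP]
  by_cases hlt : k < (2 * b - 1) * b
  · rw [if_pos hlt, edgeEnd, if_pos hlt, edgeStart, if_pos hlt, weight_col, colWeight, ite_self]
    push_cast; ring
  · obtain ⟨-, -, h2b, hm⟩ := edgeStart_row hlt hkE
    rw [if_neg hlt, edgeEnd, if_neg hlt, weight_row hm, rowWeight]
    simp only [block, depth]
    have hd : (if edgeStart b k / b < b then ((edgeStart b k / b : ℕ) : ℤ) else
        2 * b - 1 - (edgeStart b k / b : ℕ)) =
          (min (edgeStart b k / b) (2 * b - 1 - edgeStart b k / b) : ℕ) := by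
      split_ifs <;> omega
    rw [hd]
    push_cast; ring_nf

theorem getD_edges (hb : 0 < b) (f : Fin (2 * b * b) × Fin (2 * b * b) → ℤ) {k : ℕ}
    (hk : k < edgeCount b) : ((edges b hb).map f).getD k 0 =
      f (⟨edgeStart b k, by have := edge_spec hb hk; omega⟩, ⟨edgeEnd b k, (edge_spec hb hk).1⟩) := by
  have : k < ((edges b hb).map f).length := by simpa [edges] using hk
  rw [List.getD_eq_getElem _ _ this]
  simp [edges]

theorem length_edges (hb : 0 < b) : (edges b hb).length = edgeCount b := by simp [edges]

theorem edgeCount_le (b : ℕ) : edgeCount b ≤ 4 * b * b := by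
  have h1 : (2 * b - 1) * b ≤ 2 * b * b := Nat.mul_le_mul_right _ (by omega)
  have h2 : 2 * b * (b - 1) ≤ 2 * b * b := Nat.mul_le_mul_left _ (by omega)
  rw [edgeCount, show 4 * b * b = 2 * b * b + 2 * b * b by ring]
  omega

/-- One of the loops writing an array of the input. -/
theorem run_loadArr (hs : Setting D V W Z b P B S I row col τ) (ht : Tidy Z τ) {a : ℕ} {σ : State}
    {e : RExpr} (f : Fin (2 * b * b) × Fin (2 * b * b) → ℤ)
    (h : Holds S I τ σ) (hσ : ∀ j, σ.arr a j = 0) (hc : e.cost ≤ 1000)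
    (he : ∀ k (hk : k < edgeCount b) τ', Near S I τ τ' → Tidy Z τ' → τ'.reg 12 = k →
      (∀ a', a' ≠ a + 7 → τ'.arr a' = τ.arr a') →
      e.eval τ' = f (⟨edgeStart b k, by have := edge_spec hs.pos hk; omega⟩,
        ⟨edgeEnd b k, (edge_spec hs.pos hk).1⟩) ∧ e.Small Z τ') :
    Run W (.forLoop 12 edgeCountExpr (.put (a + 7) (.cell rx) e)) τ c fun τ' c' =>
      Holds S I τ' (σ.loadArr a ((edges b hs.pos).map f)) ∧ Near S I τ τ' ∧ Tidy Z τ' ∧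
      (∀ a', a' ≠ a + 7 → τ'.arr a' = τ.arr a') ∧ c' ≤ c + (edgeCount b + 1) * 1100 := by
  have hb := hs.pos
  have hE : edgeCount b ≤ Z := (edgeCount_le b).trans hs.size'
  set val : ℕ → ℤ := fun k => ((edges b hs.pos).map f).getD k 0
  have hnear : ∀ k, Near S I τ (τ.filled 12 (a + 7) (fun k => k * S + I) val k) :=
    fun k => (Near.refl τ).filled hs.lt (by norm_num) (by omega) _
  have htidy : ∀ k ≤ edgeCount b, Tidy Z (τ.filled 12 (a + 7) (fun k => k * S + I) val k) :=
    fun k hk => ht.filled_of_le (by omega) _ _ (by omega)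
  have hlen : ((edges b hs.pos).map f).length = edgeCount b := by
    rw [List.length_map, length_edges]
  have hW := hs.roomy.lt_word
  have h100 := hs.roomy.le
  have harr : ∀ k, ∀ a', a' ≠ a + 7 →
      (τ.filled 12 (a + 7) (fun k => k * S + I) val k).arr a' = τ.arr a' := fun k a' ha' => by
    rw [State.filled_arr, Function.update_of_ne ha']
  refine Run.fill (fun k => k * S + I) val (edgeCount b) (by omega) (by omega) ?_ ?_ ?_ ?_
  · intro k hk
    exact ⟨eval_edgeCountExpr hb (hs.near (hnear k)).regb,
      (htidy k hk).fits hs.roomy (by decide) (by decide)⟩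
  · intro k hk
    refine ⟨?_, (htidy k hk.le).fits hs.roomy (by decide) (by decide)⟩
    have := hs.near (hnear k)
    simp only [RExpr.cell, RExpr.eval_add, RExpr.eval_mul, RExpr.eval_reg, this.regS, this.regI]
    simp
  · intro k hk
    have := he k hk _ (hnear k) (htidy k hk.le) (by simp) (harr k)
    exact ⟨by rw [this.1]; exact (getD_edges hb f hk).symm, hs.roomy.fits this.2 hc⟩
  · refine ⟨?_, hnear _, htidy _ le_rfl, harr _, ?_⟩
    · have := h.loadArr hs.lt (r := 12) (by norm_num) ((edges b hs.pos).map f) hσ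
      rwa [hlen] at this
    · have e1 : edgeCountExpr.cost ≤ 50 := by decide
      have e2 : (RExpr.cell rx).cost = 5 := by decide
      rw [e2]
      have := Nat.mul_le_mul_left (edgeCount b)
        (by omega : edgeCountExpr.cost + 5 + e.cost + 8 ≤ 1100)
      rw [add_mul]
      omega

theorem weightExpr_small (hs : Setting D V W Z b P B S I row col τ) (ht : Tidy Z τ) {k : ℕ}
    (hk : τ.reg 12 = k) (hkE : k < edgeCount b) (hstart : τ.arr 7 (k * S + I) = edgeStart b k) :
    weightExpr.Small Z τ := by
  have hh := hs.roomy.le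
  have h7 : (RExpr.get 7 (.cell rx)).Small Z τ := by
    refine ⟨ht.small hh (by decide), ?_⟩
    have : (RExpr.cell rx).eval τ = k * S + I := by simp [RExpr.cell, hs.regS, hs.regI, hk]
    have h1 := edge_spec hs.pos hkE
    have h2 := hs.size'
    rw [this, hstart, Nat.abs_cast]
    have : 4 * b * b = 2 * b * b + 2 * b * b := by ring
    exact_mod_cast (by omega : edgeStart b k ≤ Z)
  have hR : startRow.Small Z τ := (RExpr.small_div ..).2 ⟨h7, ht.small hh (by decide)⟩
  have hX : startCol.Small Z τ := (RExpr.small_mod ..).2 ⟨h7, ht.small hh (by decide)⟩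
  have hc : ∀ k : ℤ, |k| ≤ 100 → |k| ≤ (Z : ℤ) := fun k hk => hk.trans (by exact_mod_cast hh)
  simp only [weightExpr, RExpr.small_sel, RExpr.small_add, RExpr.small_sub, RExpr.small_mul,
    RExpr.small_lt, RExpr.small_const, RExpr.small_get, RExpr.small_reg, hR, hX, true_and]
  repeat' apply And.intro
  all_goals first
    | exact trivial
    | exact hR
    | exact hX
    | exact ht.reg _ (by norm_num)
    | exact ht.arr 4 (by norm_num) _
    | exact hc _ (by norm_num)
    | exact ht.small hh (by decide)
    | omega

/-- An untouched residue class holds the zero state; two register writes and three loops turn it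
into the input of the preprocessing. -/
theorem run_load (hs : Setting D V W Z b P B S I row col τ) (ht : Tidy Z τ)
    (hfresh : ∀ a ≥ 6, ∀ j, j % (S : ℤ) = I → τ.arr a j = 0) :
    Run W loadProgram τ c fun τ' c' =>
      Holds S I τ' (inputState (wgraph b (4 * B) (block τ P row col) fun _ => 0) (edges b hs.pos)) ∧
      Near S I τ τ' ∧ τ'.arr 5 = τ.arr 5 ∧ Tidy Z τ' ∧ c' ≤ c + 20000 * (b * b) := by
  have hb := hs.pos
  have hzero : Holds S I τ State.zero :=
    ⟨hs.regS, hs.regI, fun x => hfresh 6 le_rfl _ (cell_emod hs.lt _),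
      fun a i => hfresh _ (by omega) _ (cell_emod hs.lt _)⟩
  refine .seq (.setCell hzero hs.lt ht hs.roomy (by norm_num) (by decide) (by decide)
    fun τ₁ h₁ a₁ => .seq (.setCell h₁ hs.lt (a₁.tidy ht) hs.roomy (by norm_num) (by decide)
      (by decide) fun τ₂ h₂ a₂ => ?_))
  have h₂' : Holds S I τ₂ (State.zero.loadRegs [((2 * b * b : ℕ) : ℤ), (edges b hs.pos).length]) := by
    rw [State.loadRegs_two]
    convert h₂ using 2
    · simp [hs.regb]
    · rw [length_edges, eval_edgeCountExpr hb (by rw [a₁.reg, hs.regb])]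
  have a := a₁.trans a₂
  have hs₂ := hs.near a.near
  have hmat : ∀ {τ'}, Near S I τ τ' → block τ' P row col = block τ P row col := fun h => by
    funext i x
    rw [block, block, h.arr 4 (by norm_num)]
  have ht₂ := a.tidy ht
  have hh := hs.roomy.le
  refine .seq ((run_loadArr hs₂ ht₂ (a := 0) (fun p => ((p.1 : ℕ) : ℤ)) h₂' (fun _ => rfl)
    (by decide) fun k hk τ' hn ht' hk' _ => ⟨eval_edgeStartExpr hb (hs₂.near hn).regb hk',
      ht'.small hh (by decide)⟩).mono ?_)
  rintro τ₃ c₃ ⟨h₃, n₃, ht₃, ha₃, hc₃⟩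
  have hs₃ := hs₂.near n₃
  refine .seq ((run_loadArr hs₃ ht₃ (a := 1) (fun p => ((p.2 : ℕ) : ℤ)) h₃ (fun _ => rfl)
    (by decide) fun k hk τ' hn ht' hk' _ => ⟨eval_edgeEndExpr hb (hs₃.near hn).regb hk',
      ht'.small hh (by decide)⟩).mono ?_)
  rintro τ₄ c₄ ⟨h₄, n₄, ht₄, ha₄, hc₄⟩
  have hs₄ := hs₃.near n₄
  refine (run_loadArr hs₄ ht₄ (a := 2) (fun p => (((wgraph b (4 * B) (block τ P row col)
    fun _ => 0).weight s(p.1, p.2) : ℕ) : ℤ)) h₄ (fun _ => rfl) (by decide) ?_).mono ?_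
  · intro k hk τ' hn ht' hk' ha'
    have hs' := hs₄.near hn
    have hst : τ'.arr 7 (k * S + I) = edgeStart b k := by
      have h0 := h₄.arr 0 k
      rw [ha' 7 (by norm_num), h0]
      simp only [State.loadArr]
      rw [Function.update_of_ne (by norm_num), Function.update_self, if_pos (by positivity),
        Int.toNat_natCast, getD_edges hb _ hk]
    have hbd : Bounded b (4 * B) (block τ P row col) fun _ => 0 :=
      ⟨fun i _ x _ => by push_cast; exact hs.entry _, fun x hx => by simp⟩
    refine ⟨?_, weightExpr_small hs' ht' hk' hk hst⟩
    rw [eval_weightExpr hs' hk' hk hst, hmat (((a.near.trans n₃).trans n₄).trans hn),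
      hbd.natCast_weight hb]
    exact (adj_iff hb).2 (.inl (edge_spec hb hk).2)
  · rintro τ₅ c₅ ⟨h₅, n₅, ht₅, ha₅, hc₅⟩
    refine ⟨h₅, ((a.near.trans n₃).trans n₄).trans n₅, ?_, ht₅, ?_⟩
    · rw [ha₅ 5 (by norm_num), ha₄ 5 (by norm_num), ha₃ 5 (by norm_num), a.arr 5 (by norm_num)]
    · have e1 : edgeCountExpr.cost ≤ 50 := by decide
      have e2 : (RExpr.const 2 * rb * rb).cost = 5 := by decide
      have := edgeCount_le b
      have : 1 ≤ b * b := Nat.mul_pos hb hb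
      rw [mul_assoc] at *
      omega

end Reduction

namespace Reduction

open WordRAM DynAPSP Grid

/-! ## Processing a block of the matrix -/

/-- The array `g` arises from `f` by decreasing entries to entries of the sum matrices of the
matrix `C` with `P` rows and columns. -/
structure Improves (P : ℕ) (C f g : ℤ → ℤ) : Prop where
  le : ∀ j, g j ≤ f j
  eq : ∀ j, g j = f j ∨ ∃ i < P, ∃ k < P, ∃ y < P, j = (i : ℤ) * P + y ∧
    g j = C (i * P + k) + C (k * P + y)

theorem Improves.refl (P : ℕ) (C f : ℤ → ℤ) : Improves P C f f :=
  ⟨fun _ => le_rfl, fun _ => .inl rfl⟩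

theorem Improves.trans {P : ℕ} {C f g h : ℤ → ℤ} (h₁ : Improves P C f g) (h₂ : Improves P C g h) :
    Improves P C f h :=
  ⟨fun j => (h₂.le j).trans (h₁.le j), fun j => (h₂.eq j).elim
    (fun e => (h₁.eq j).imp e.trans fun ⟨i, hi, k, hk, y, hy, e₁, e₂⟩ =>
      ⟨i, hi, k, hk, y, hy, e₁, e.trans e₂⟩) .inr⟩

theorem Improves.update {P : ℕ} {C f : ℤ → ℤ} {i k y : ℕ} (hi : i < P) (hk : k < P) (hy : y < P) :
    Improves P C f (Function.update f (i * P + y) (min (f (i * P + y))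
      (C (i * P + k) + C (k * P + y)))) where
  le j := by
    rw [Function.update_apply]
    split_ifs with h
    · rw [h]; exact min_le_left _ _
    · rfl
  eq j := by
    rw [Function.update_apply]
    split_ifs with h
    · rw [h]
      exact (min_choice _ _).imp id fun e => ⟨i, hi, k, hk, y, hy, rfl, e⟩
    · exact .inl rfl

/-- Part of column `y` is made the vector, and then the product with every row of the block is asked
for. -/
def columnCommands (τ : State) (P col b y : ℕ) : List Command :=
  (List.range b).map (fun x => .set x (column τ P col y x)) ++ (List.range b).map .ask

def allCommands (τ : State) (P col b : ℕ) : List Command :=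
  (List.range P).flatMap (columnCommands τ P col b)

theorem length_allCommands (τ : State) (P col b : ℕ) :
    (allCommands τ P col b).length = P * (2 * b) := by
  simp [allCommands, columnCommands, List.length_flatMap, two_mul]

theorem range'_eq_cons {k m : ℕ} (h : k < m) :
    List.range' k (m - k) = k :: List.range' (k + 1) (m - (k + 1)) := by
  rw [show m - k = (m - (k + 1)) + 1 by omega, List.range'_succ]

def opsProgram (D : Algorithm) (M : Model) : Prog :=
  .forLoop 11 rP (.seq (.forLoop 12 rb (updateProgram D M)) (.forLoop 12 rb (askProgram D)))

def blockProgram (D : Algorithm) (M : Model) : Prog :=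
  .seq (.assign 9 (rBlock / rQ * rb))
  (.seq (.assign 10 (rBlock % rQ * rb))
  (.seq loadProgram
  (.seq D.preprocess.relocate
  (.seq (opsProgram D M)
  (.assign 6 (rI + .const 1))))))

variable {M : Model} {D : Algorithm} {V W Z b P B S I row col R c y : ℕ} {τ τ' : State}
  {A : ℕ → ℕ → ℤ} {v : ℕ → ℤ} {l : List Command}

theorem _root_.WordRAM.Near.block_eq (h : Near S I τ τ') : block τ' P row col = block τ P row col := by
  funext i x
  rw [block, block, h.arr 4 (by norm_num)]

theorem _root_.WordRAM.Near.column_eq (h : Near S I τ τ') : column τ' P col y = column τ P col y := by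
  funext x
  rw [column, column, h.arr 4 (by norm_num)]

theorem abs_natCast_le {k : ℕ} (h : k ≤ Z) : |(k : ℤ)| ≤ (Z : ℤ) := by
  rw [Nat.abs_cast]; exact_mod_cast h

theorem Setting.b_le (hs : Setting D V W Z b P B S I row col τ) : b ≤ Z := by
  have := hs.row_le
  have := hs.sizeP
  omega

/-- The vector left by the previous column is irrelevant: only the entries already overwritten are
tracked, and after `b` updates these are all that matter. -/
theorem run_updates (hs : Setting D V W Z b P B S I row col τ) (ht : Tidy Z τ) (hy : τ.reg 11 = y)
    (h : Ready M D V S I b (4 * B) hs.pos A v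
      ((List.range b).map (fun x => .set x (column τ P col y x)) ++ l) R τ c) :
    Run W (.forLoop 12 rb (updateProgram D M)) τ c fun τ' c' =>
      Near S I τ τ' ∧ Tidy Z τ' ∧ τ'.reg 11 = y ∧ τ'.arr 5 = τ.arr 5 ∧
      ∃ v', (∀ x < b, v' x = column τ P col y x) ∧
        Ready M D V S I b (4 * B) hs.pos A v' l (R + 200 * b + 10) τ' c' := by
  have hZ := hs.roomy.le
  have hW := hs.roomy.lt_word
  have hbZ := hs.b_le
  refine Run.forLoop (fun k τ' c' => Near S I τ τ' ∧ Tidy Z τ' ∧ τ'.reg 11 = y ∧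
    τ'.reg 12 = k ∧ τ'.arr 5 = τ.arr 5 ∧ ∃ v', (∀ x < k, v' x = column τ P col y x) ∧
      Ready M D V S I b (4 * B) hs.pos A v' ((List.range' k (b - k)).map
        (fun x => .set x (column τ P col y x)) ++ l) (R + 2 + 200 * k) τ' c') b (by omega) ?_ ?_ ?_ ?_
  · refine ⟨(Near.refl τ).setReg (by norm_num) _, ht.setReg (by simp), by simp [hy], by simp, rfl,
      v, by simp, ?_⟩
    refine Ready.of_near (τ := τ) (c := c) (R := R) ?_ (by simp) (by simp) (fun _ _ => rfl) (by omega)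
    simpa [List.range_eq_range'] using h
  · rintro k hk τ' c' ⟨hn, ht', -, hk', -⟩
    exact ⟨hk', (hs.near hn).regb, ht'.fits hs.roomy (by decide) (by decide)⟩
  · rintro k hk τ' c' ⟨hn, ht', hy', hk', h5, v', hv', hr⟩
    rw [range'_eq_cons hk, List.map_cons, List.cons_append, ← hn.column_eq] at hr
    have hr := hr.of_near (τ' := τ') (c' := c' + (rb.cost + 3)) (R' := R + 2 + 200 * k + 4) rfl rfl
      (fun _ _ => rfl) (by simp; omega)
    refine (run_updateProgram (hs.near hn) ht' hk' hy' hk hr).mono ?_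
    rintro τ'' c'' ⟨a, hr⟩
    refine ⟨by rw [a.reg, hk'], by omega, (hn.trans a.near).setReg (by norm_num) _,
      (a.tidy ht').setReg (abs_natCast_le (by omega)), by simp [a.reg, hy'], by simp,
      by rw [State.setReg_arr, a.arr 5 (by norm_num), h5],
      Function.update v' k (column τ' P col y k), ?_, ?_⟩
    · intro x hx
      rw [Function.update_apply, hn.column_eq]
      split_ifs with h
      · rw [h]
      · exact hv' x (by omega)
    · rw [hn.column_eq] at hr ⊢
      exact hr.of_near (by simp) (by simp) (fun _ _ => rfl) (by omega)
  · rintro τ' c' ⟨hn, ht', hy', -, h5, v', hv', hr⟩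
    refine ⟨hn, ht', hy', h5, v', hv', ?_⟩
    rw [Nat.sub_self] at hr
    exact hr.of_near rfl rfl (fun _ _ => rfl) (by simp; omega)

theorem run_asks (hs : Setting D V W Z b P B S I row col τ) (ht : Tidy Z τ) (hy : τ.reg 11 = y)
    (hyP : y < P) (hv : ∀ x < b, v x = column τ P col y x)
    (h : Ready M D V S I b (4 * B) hs.pos (block τ P row col) v
      ((List.range b).map .ask ++ l) R τ c) :
    Run W (.forLoop 12 rb (askProgram D)) τ c fun τ' c' =>
      Near S I τ τ' ∧ Tidy Z τ' ∧ τ'.reg 11 = y ∧ Improves P (τ.arr 4) (τ.arr 5) (τ'.arr 5) ∧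
      (∀ i < b, ∀ x < b, τ'.arr 5 ((row + i) * P + y) ≤
        block τ P row col i x + column τ P col y x) ∧
      Ready M D V S I b (4 * B) hs.pos (block τ P row col) v l (R + 500 * b + 10) τ' c' := by
  have hZ := hs.roomy.le
  have hW := hs.roomy.lt_word
  have hbZ := hs.b_le
  refine Run.forLoop (fun k τ' c' => Near S I τ τ' ∧ Tidy Z τ' ∧ τ'.reg 11 = y ∧
    τ'.reg 12 = k ∧ Improves P (τ.arr 4) (τ.arr 5) (τ'.arr 5) ∧
    (∀ i < k, ∀ x < b, τ'.arr 5 ((row + i) * P + y) ≤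
        block τ P row col i x + column τ P col y x) ∧
      Ready M D V S I b (4 * B) hs.pos (block τ P row col) v ((List.range' k (b - k)).map .ask ++ l)
        (R + 2 + 500 * k) τ' c') b (by omega) ?_ ?_ ?_ ?_
  · refine ⟨(Near.refl τ).setReg (by norm_num) _, ht.setReg (by simp), by simp [hy], by simp,
      .refl .., by simp, ?_⟩
    refine Ready.of_near (τ := τ) (c := c) (R := R) ?_ (by simp) (by simp) (fun _ _ => rfl) (by omega)
    simpa [List.range_eq_range'] using h
  · rintro k hk τ' c' ⟨hn, ht', -, hk', -⟩
    exact ⟨hk', (hs.near hn).regb, ht'.fits hs.roomy (by decide) (by decide)⟩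
  · rintro k hk τ' c' ⟨hn, ht', hy', hk', himp, hdone, hr⟩
    rw [range'_eq_cons hk, List.map_cons, List.cons_append, ← hn.block_eq] at hr
    have hr := hr.of_near (τ' := τ') (c' := c' + (rb.cost + 3)) (R' := R + 2 + 500 * k + 4) rfl rfl
      (fun _ _ => rfl) (by simp; omega)
    refine (run_askProgram (hs.near hn) ht' hk' hy' hk
      (fun x hx => by rw [hn.column_eq]; exact hv x hx) hr).mono ?_
    rintro τ'' c'' ⟨m, hm, hn', hreg, h5, ht'', hr⟩
    rw [hn.block_eq] at hr hm
    rw [hn.column_eq] at hm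
    -- The minimum `m` is attained, so the new value is an actual sum of two matrix entries.
    have himp' : Improves P (τ.arr 4) (τ'.arr 5) (τ''.arr 5) := by
      obtain ⟨x, hx, rfl⟩ := hm.1
      rw [h5]
      have h1 := hs.row_le
      have h2 := hs.col_le
      have := Improves.update (C := τ.arr 4) (f := τ'.arr 5) (by omega : row + k < P)
        (by omega : col + x < P) hyP
      push_cast at this
      simpa only [block, column] using this
    refine ⟨by rw [hreg, hk'], by omega, (hn.trans hn').setReg (by norm_num) _,
      ht''.setReg (abs_natCast_le (by omega)), by simp [hreg, hy'], by simp,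
      himp.trans himp', ?_, hr.of_near (by simp) (by simp) (fun _ _ => rfl) (by omega)⟩
    intro i hi x hx
    rcases Nat.lt_succ_iff_lt_or_eq.1 hi with hik | rfl
    · exact (himp'.le _).trans (hdone i hik x hx)
    · rw [State.setReg_arr, h5, Function.update_self]
      exact (min_le_right _ _).trans (hm.2 ⟨x, hx, rfl⟩)
  · rintro τ' c' ⟨hn, ht', hy', -, himp, hdone, hr⟩
    refine ⟨hn, ht', hy', himp, hdone, ?_⟩
    rw [Nat.sub_self] at hr
    exact hr.of_near rfl rfl (fun _ _ => rfl) (by simp; omega)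

theorem run_ops (hs : Setting D V W Z b P B S I row col τ) (ht : Tidy Z τ)
    (h : Ready M D V S I b (4 * B) hs.pos (block τ P row col) v (allCommands τ P col b) R τ c) :
    Run W (opsProgram D M) τ c fun τ' c' =>
      Near S I τ τ' ∧ Tidy Z τ' ∧ Improves P (τ.arr 4) (τ.arr 5) (τ'.arr 5) ∧
      (∀ y < P, ∀ i < b, ∀ x < b, τ'.arr 5 ((row + i) * P + y) ≤
        block τ P row col i x + column τ P col y x) ∧ c' ≤ R + 1000 * (P * b) := by
  have hZ := hs.roomy.le
  have hW := hs.roomy.lt_word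
  have hPZ := hs.sizeP
  have hb := hs.pos
  refine Run.forLoop (fun y τ' c' => Near S I τ τ' ∧ Tidy Z τ' ∧ τ'.reg 11 = y ∧
    Improves P (τ.arr 4) (τ.arr 5) (τ'.arr 5) ∧
    (∀ y' < y, ∀ i < b, ∀ x < b, τ'.arr 5 ((row + i) * P + y') ≤
        block τ P row col i x + column τ P col y' x) ∧ ∃ v,
      Ready M D V S I b (4 * B) hs.pos (block τ P row col) v
        ((List.range' y (P - y)).flatMap (columnCommands τ P col b))
        (R + 2 + 800 * (y * b)) τ' c') P (by omega) ?_ ?_ ?_ ?_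
  · refine ⟨(Near.refl τ).setReg (by norm_num) _, ht.setReg (by simp), by simp,
      .refl .., by simp, v, ?_⟩
    refine Ready.of_near (τ := τ) (c := c) (R := R) ?_ (by simp) (by simp) (fun _ _ => rfl) (by omega)
    simpa [List.range_eq_range', allCommands] using h
  · rintro k hk τ' c' ⟨hn, ht', hk', -⟩
    exact ⟨hk', (hs.near hn).regP, ht'.fits hs.roomy (by decide) (by decide)⟩
  · rintro y hy τ' c' ⟨hn, ht', hy', himp, hdone, v, hr⟩
    rw [range'_eq_cons hy, List.flatMap_cons, columnCommands, List.append_assoc,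
      ← hn.column_eq] at hr
    have hr := hr.of_near (τ' := τ') (c' := c' + (rP.cost + 3)) (R' := R + 2 + 800 * (y * b) + 4)
      rfl rfl (fun _ _ => rfl) (by simp; omega)
    refine .seq ((run_updates (hs.near hn) ht' hy' hr).mono ?_)
    rintro τ₁ c₁ ⟨hn₁, ht₁, hy₁, h5₁, v₁, hv₁, hr₁⟩
    have hn₁' := hn.trans hn₁
    rw [← hn₁'.block_eq] at hr₁
    rw [← hn₁.column_eq] at hv₁
    refine (run_asks (hs.near hn₁') ht₁ hy₁ hy hv₁ hr₁).mono ?_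
    rintro τ₂ c₂ ⟨hn₂, ht₂, hy₂, himp₂, hdone₂, hr₂⟩
    rw [hn₁'.arr 4 (by norm_num), h5₁] at himp₂
    rw [hn₁'.block_eq] at hr₂
    refine ⟨hy₂, by omega, (hn₁'.trans hn₂).setReg (by norm_num) _,
      ht₂.setReg (abs_natCast_le (by omega)), by simp, himp.trans himp₂, ?_, v₁,
      hr₂.of_near (by simp) (by simp) (fun _ _ => rfl) ?_⟩
    · intro y' hy' i hi x hx
      rcases Nat.lt_succ_iff_lt_or_eq.1 hy' with hlt | rfl
      · exact (himp₂.le _).trans (hdone y' hlt i hi x hx)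
      · have := hdone₂ i hi x hx
        rwa [hn₁'.block_eq, hn₁'.column_eq] at this
    · rw [add_mul]; omega
  · rintro τ' c' ⟨hn, ht', -, himp, hdone, v, σ, T, -, -, hc⟩
    refine ⟨hn, ht', himp, hdone, ?_⟩
    have : rP.cost = 1 := rfl
    have : 1 ≤ P * b := Nat.mul_pos (by have := hs.row_le; omega) hb
    omega

/-- The `Setting` is demanded only for states in which registers `9` and `10` already hold the
position of the block, because the program itself computes them. Freshness of all memories from `I`
on is passed along with `I + 1`, so every block finds an empty memory. -/
theorem run_block (hs : ∀ τ', (∀ r < 9, τ'.reg r = τ.reg r) → τ'.arr = τ.arr →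
      τ'.reg 9 = (row : ℤ) → τ'.reg 10 = (col : ℤ) → Setting D V W Z b P B S I row col τ')
    (ht : Tidy Z τ) (hrow : (rBlock / rQ * rb).eval τ = row) (hcol : (rBlock % rQ * rb).eval τ = col)
    (hZ : Roomy Z W) (hSZ : S ≤ Z) (hP : P ≤ Z)
    (hfresh : ∀ a ≥ 6, ∀ j, (I : ℤ) ≤ j % (S : ℤ) → τ.arr a j = 0) {k : ℕ} {T : ℕ}
    (hD : ∀ (A : ℕ → ℕ → ℤ) (hb : 0 < b) (l : List Command), Bounded b (4 * B) A (fun _ => 0) →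
      (∀ k ∈ l, k.Ok b (4 * B)) → l.length ≤ P * (2 * b) → ∃ T₀ T₁ σ₀,
      Exec ((2 * b * b + 2) ^ k) D.preprocess
        (inputState (wgraph b (4 * B) A fun _ => 0) (edges b hb)) T₀ σ₀ ∧
      D.Serves V (wgraph b (4 * B) A fun _ => 0) σ₀ (l.flatMap (Command.ops M b (4 * B) hb)) T₁ ∧
      T₀ + T₁ ≤ T) (hV : (2 * b * b + 2) ^ k ≤ V) :
    Run W (blockProgram D M) τ c fun τ' c' =>
      (∀ r < 9, r ≠ 6 → τ'.reg r = τ.reg r) ∧ (∀ a < 5, τ'.arr a = τ.arr a) ∧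
      τ'.reg 6 = (I + 1 : ℕ) ∧
      (∀ a ≥ 6, ∀ j, ((I + 1 : ℕ) : ℤ) ≤ j % (S : ℤ) → τ'.arr a j = 0) ∧ Tidy Z τ' ∧
      Improves P (τ.arr 4) (τ.arr 5) (τ'.arr 5) ∧
      (∀ y < P, ∀ i < b, ∀ x < b, τ'.arr 5 ((row + i) * P + y) ≤
        τ.arr 4 ((row + i) * P + (col + x)) + τ.arr 4 ((col + x) * P + y)) ∧
      c' ≤ c + 6 * T + 22000 * (P * b) := by
  have hW := hZ.lt_word
  have hτ : ∀ r < 9, ((τ.setReg 9 row).setReg 10 col).reg r = τ.reg r := fun r hr => by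
    rw [State.setReg_reg, Function.update_of_ne (by omega), State.setReg_reg,
      Function.update_of_ne (by omega)]
  have hs := hs ((τ.setReg 9 row).setReg 10 col) hτ rfl (by simp) (by simp)
  have hrowZ : row ≤ Z := by have := hs.row_le; omega
  have hcolZ : col ≤ Z := by have := hs.col_le; omega
  have ht₁ : Tidy Z (τ.setReg 9 row) := ht.setReg (abs_natCast_le hrowZ)
  have ht₂ : Tidy Z ((τ.setReg 9 row).setReg 10 col) := ht₁.setReg (abs_natCast_le hcolZ)
  refine .seq (.assign (ht.fits hZ (by decide) (by decide)) ?_)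
  rw [hrow]
  refine .seq (.assign (ht₁.fits hZ (by decide) (by decide)) ?_)
  have hcol' : (rBlock % rQ * rb).eval (τ.setReg 9 row) = col := by
    rw [← hcol]; simp
  rw [hcol']
  set τ₀ := (τ.setReg 9 row).setReg 10 col with hτ₀
  have harr : τ₀.arr = τ.arr := rfl
  have hb := hs.pos
  refine .seq ((run_load hs ht₂ fun a ha j hj => hfresh a ha j hj.ge).mono ?_)
  rintro τ₁ c₁ ⟨h₁, hn₁, h5₁, ht₁', hc₁⟩
  have hbd : Bounded b (4 * B) (block τ₀ P row col) fun _ => 0 :=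
    ⟨fun i _ x _ => by push_cast; exact hs.entry _, fun x hx => by simp⟩
  have hok : ∀ k ∈ allCommands τ₀ P col b, k.Ok b (4 * B) := by
    intro k hk
    simp only [allCommands, columnCommands, List.mem_flatMap, List.mem_append, List.mem_map,
      List.mem_range] at hk
    obtain ⟨y, -, ⟨x, hx, rfl⟩ | ⟨x, hx, rfl⟩⟩ := hk
    · refine ⟨hx, ?_⟩
      push_cast
      exact hs.entry _
    · exact hx
  obtain ⟨T₀, T₁, σ₀, hpre, hserve, hT⟩ := hD _ hb _ hbd hok (length_allCommands ..).le
  refine .seq (.relocate hpre h₁ hs.lt (lt_of_le_of_lt (Nat.mul_le_mul_right _ hV) hs.word)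
    hs.preprocess fun τ₂ c₂ h₂ a₂ hc₂ => ?_)
  have hn₂ := hn₁.trans a₂.near
  have hs₂ := hs.near hn₂
  have hready : Ready M D V S I b (4 * B) hb (block τ₂ P row col) (fun _ => 0)
      (allCommands τ₂ P col b) (c₂ + 6 * T₁) τ₂ c₂ := by
    have : allCommands τ₂ P col b = allCommands τ₀ P col b := by
      have : columnCommands τ₂ P col b = columnCommands τ₀ P col b := by
        funext y
        rw [columnCommands, hn₂.column_eq, ← columnCommands]
      rw [allCommands, this, ← allCommands]
    rw [this, hn₂.block_eq]
    exact ⟨σ₀, T₁, h₂, hserve, le_rfl⟩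
  refine .seq ((run_ops hs₂ (a₂.tidy ht₁') hready).mono ?_)
  rintro τ₃ c₃ ⟨hn₃, ht₃, himp, hdone, hc₃⟩
  have hn := hn₂.trans hn₃
  have hI : τ₃.reg 6 = I := by rw [hn.reg 6 (by norm_num), hs.regI]
  have hIS := hs.lt
  refine .assign (ht₃.fits hZ (by decide) (by decide)) ⟨?_, ?_, ?_, ?_, ?_, ?_, ?_, ?_⟩
  · intro r hr h6
    rw [State.setReg_reg, Function.update_of_ne h6, hn.reg r (by omega), hτ r hr]
  · intro a ha
    rw [State.setReg_arr, hn.arr a ha, harr]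
  · simp [hI]
  · intro a ha j hj
    rw [State.setReg_arr, hn.cell a ha j (by omega), harr]
    exact hfresh a ha j (by omega)
  · refine ht₃.setReg ?_
    rw [show (rI + .const 1).eval τ₃ = (I + 1 : ℕ) by simp [hI]]
    exact abs_natCast_le (by omega)
  · rw [hn₂.arr 4 (by norm_num), a₂.arr 5 (by norm_num), h5₁, harr] at himp
    exact himp
  · intro y hy i hi x hx
    have := hdone y hy i hi x hx
    rw [hn₂.block_eq, hn₂.column_eq] at this
    exact this
  · have e1 : (rBlock / rQ * rb).cost = 5 := rfl
    have e2 : (rBlock % rQ * rb).cost = 5 := rfl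
    have e3 : (rI + .const 1).cost = 3 := rfl
    have : b * b ≤ P * b := Nat.mul_le_mul_right _ (by have := hs.row_le; omega)
    have : 1 ≤ P * b := Nat.mul_pos (by have := hs.row_le; omega) hb
    omega

end Reduction

namespace Reduction

open WordRAM DynAPSP Grid APSP

/-! ## Squaring the matrix -/

def blocksProgram (D : Algorithm) (M : Model) : Prog := .forLoop 8 (rQ * rQ) (blockProgram D M)

def squareProgram (D : Algorithm) (M : Model) : Prog :=
  .seq (.forLoop 12 (rP * rP) (.put 5 rx (.const 4 * rB)))
  (.seq (blocksProgram D M)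
  (.forLoop 12 (rP * rP) (.put 4 rx (.sel (.le (.get 5 rx) rB) (.get 5 rx) (.const 4 * rB)))))

/-- Bounds for the sizes of the numbers, and the performance of the dynamic algorithm. -/
structure Params (M : Model) (D : Algorithm) (V W Z b P Q B S T : ℕ) : Prop where
  roomy : Roomy Z W
  word : V * S < W
  preprocess : D.preprocess.regBound * S < W
  insertEdge : D.insertEdge.regBound * S < W
  removeEdge : D.removeEdge.regBound * S < W
  setWeight : D.setWeight.regBound * S < W
  query : D.query.regBound * S < W
  pos : 0 < b
  posQ : 0 < Q
  posB : 0 < B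
  mul_eq : Q * b = P
  size : 100 * B * b * b ≤ Z
  size' : 4 * b * b ≤ Z
  sizeP : P * P ≤ Z
  sizeS : S ≤ Z
  solves : ∃ k, (2 * b * b + 2) ^ k ≤ V ∧
    ∀ (A : ℕ → ℕ → ℤ) (hb : 0 < b) (l : List Command), Bounded b (4 * B) A (fun _ => 0) →
      (∀ k ∈ l, k.Ok b (4 * B)) → l.length ≤ P * (2 * b) → ∃ T₀ T₁ σ₀,
      Exec ((2 * b * b + 2) ^ k) D.preprocess
        (inputState (wgraph b (4 * B) A fun _ => 0) (edges b hb)) T₀ σ₀ ∧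
      D.Serves V (wgraph b (4 * B) A fun _ => 0) σ₀ (l.flatMap (Command.ops M b (4 * B) hb)) T₁ ∧
      T₀ + T₁ ≤ T

/-- The values of the registers that are set at the beginning. -/
structure Consts (n b P Q B S : ℕ) (τ : State) : Prop where
  regN : τ.reg 0 = n
  regb : τ.reg 1 = b
  regP : τ.reg 2 = P
  regQ : τ.reg 3 = Q
  regB : τ.reg 4 = B
  regS : τ.reg 5 = S

variable {M : Model} {D : Algorithm} {V W Z n b P Q B S T I c : ℕ} {τ τ' : State}

theorem Consts.of_eq (h : Consts n b P Q B S τ) (hr : ∀ r < 6, τ'.reg r = τ.reg r) :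
    Consts n b P Q B S τ' :=
  ⟨by rw [hr 0 (by norm_num), h.regN], by rw [hr 1 (by norm_num), h.regb],
    by rw [hr 2 (by norm_num), h.regP], by rw [hr 3 (by norm_num), h.regQ],
    by rw [hr 4 (by norm_num), h.regB], by rw [hr 5 (by norm_num), h.regS]⟩

theorem Params.posP (h : Params M D V W Z b P Q B S T) : 0 < P := by
  rw [← h.mul_eq]; exact Nat.mul_pos h.posQ h.pos

theorem Params.le_mul (h : Params M D V W Z b P Q B S T) : P ≤ P * P :=
  Nat.le_mul_of_pos_left _ h.posP

theorem Params.Q_le (h : Params M D V W Z b P Q B S T) : Q ≤ P := by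
  rw [← h.mul_eq]; exact Nat.le_mul_of_pos_right _ h.pos

theorem Params.setting (h : Params M D V W Z b P Q B S T) (hc : Consts n b P Q B S τ) {k : ℕ}
    (hk : k < Q * Q) (hI : τ.reg 6 = I) (hIS : I < S) (hrow : τ.reg 9 = (k / Q * b : ℕ))
    (hcol : τ.reg 10 = (k % Q * b : ℕ)) (he : ∀ j, |τ.arr 4 j| ≤ 4 * B) :
    Setting D V W Z b P B S I (k / Q * b) (k % Q * b) τ where
  __ := h
  __ := hc
  regI := hI
  regRow := hrow
  regCol := hcol
  lt := hIS
  row_le := by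
    have : k / Q + 1 ≤ Q := Nat.div_lt_of_lt_mul hk
    have := Nat.mul_le_mul_right b this
    rwa [add_mul, one_mul, h.mul_eq] at this
  col_le := by
    have : k % Q + 1 ≤ Q := Nat.mod_lt _ h.posQ
    have := Nat.mul_le_mul_right b this
    rwa [add_mul, one_mul, h.mul_eq] at this
  entry := he
  sizeP := h.le_mul.trans h.sizeP

/-- Block `k` sits at block row `k / Q` and block column `k % Q`. Every pair `(i, x)` lies in
exactly one block, so together the blocks take all intermediate vertices into account. -/
theorem run_blocks (h : Params M D V W Z b P Q B S T) (hc : Consts n b P Q B S τ) (ht : Tidy Z τ)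
    (hI : τ.reg 6 = I) (hIS : I + Q * Q ≤ S) (he : ∀ j, |τ.arr 4 j| ≤ 4 * B)
    (hfresh : ∀ a ≥ 6, ∀ j, (I : ℤ) ≤ j % (S : ℤ) → τ.arr a j = 0) :
    Run W (blocksProgram D M) τ c fun τ' c' =>
      (∀ r < 8, r ≠ 6 → τ'.reg r = τ.reg r) ∧ (∀ a < 5, τ'.arr a = τ.arr a) ∧
      τ'.reg 6 = (I + Q * Q : ℕ) ∧
      (∀ a ≥ 6, ∀ j, ((I + Q * Q : ℕ) : ℤ) ≤ j % (S : ℤ) → τ'.arr a j = 0) ∧ Tidy Z τ' ∧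
      Improves P (τ.arr 4) (τ.arr 5) (τ'.arr 5) ∧
      (∀ i < P, ∀ x < P, ∀ y < P, τ'.arr 5 (i * P + y) ≤
        τ.arr 4 (i * P + x) + τ.arr 4 (x * P + y)) ∧
      c' ≤ c + Q * Q * (6 * T + 23000 * (P * b)) + 20 := by
  have hZ := h.roomy.le
  have hW := h.roomy.lt_word
  have hb := h.pos
  have hQ := h.posQ
  have hQZ : Q * Q ≤ Z := (Nat.mul_le_mul h.Q_le h.Q_le).trans h.sizeP
  have hSZ := h.sizeS
  have hPb : 1 ≤ P * b := Nat.mul_pos h.posP hb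
  obtain ⟨e, hV, hD⟩ := h.solves
  refine Run.forLoop (fun k τ' c' => (∀ r < 8, r ≠ 6 → τ'.reg r = τ.reg r) ∧
      (∀ a < 5, τ'.arr a = τ.arr a) ∧ τ'.reg 6 = (I + k : ℕ) ∧ τ'.reg 8 = k ∧
      (∀ a ≥ 6, ∀ j, ((I + k : ℕ) : ℤ) ≤ j % (S : ℤ) → τ'.arr a j = 0) ∧ Tidy Z τ' ∧
      Improves P (τ.arr 4) (τ.arr 5) (τ'.arr 5) ∧
      (∀ k' < k, ∀ y < P, ∀ i < b, ∀ x < b, τ'.arr 5 ((((k' / Q * b : ℕ) : ℤ) + i) * P + y) ≤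
        τ.arr 4 ((((k' / Q * b : ℕ) : ℤ) + i) * P + (((k' % Q * b : ℕ) : ℤ) + x)) +
          τ.arr 4 ((((k' % Q * b : ℕ) : ℤ) + x) * P + y)) ∧
      c' ≤ c + 2 + k * (6 * T + 23000 * (P * b))) (Q * Q) (by omega) ?_ ?_ ?_ ?_
  · refine ⟨fun r hr _ => ?_, fun _ _ => rfl, ?_, ?_, hfresh, ht.setReg (by simp), .refl .., ?_, ?_⟩
    · rw [State.setReg_reg, Function.update_of_ne (by omega)]
    · simpa using hI
    · simp
    · simp
    · omega
  · rintro k hk τ' c' ⟨hr, -, -, hk', -, ht', -⟩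
    refine ⟨hk', ?_, ht'.fits h.roomy (by decide) (by decide)⟩
    simp [hr 3 (by norm_num) (by norm_num), hc.regQ]
  · rintro k hk τ' c' ⟨hr, ha, hI', hk', hfr, ht', himp, hdone, hc'⟩
    have hcon : Consts n b P Q B S τ' := hc.of_eq fun r hr' => hr r (by omega) (by omega)
    refine (run_block (row := k / Q * b) (col := k % Q * b) (I := I + k) (P := P) (B := B) (S := S)
      (fun τ₁ hr₁ ha₁ h9 h10 => h.setting (hcon.of_eq fun r hr' => hr₁ r (by omega)) hk
        (by rw [hr₁ 6 (by norm_num), hI']) (by omega) h9 h10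
        (by rw [ha₁, ha 4 (by norm_num)]; exact he)) ht'
      ?_ ?_ h.roomy hSZ (h.le_mul.trans h.sizeP) hfr hD hV).mono ?_
    · simp [hk', hcon.regQ, hcon.regb]
    · simp [hk', hcon.regQ, hcon.regb]
    rintro τ₁ c₁ ⟨hr₁, ha₁, hI₁, hfr₁, ht₁, himp₁, hdone₁, hc₁⟩
    have hself : ∀ {v : ℤ} {r : ℕ}, r ≠ 8 → (τ₁.setReg 8 v).reg r = τ₁.reg r := fun hne => by
      rw [State.setReg_reg, Function.update_of_ne hne]
    rw [ha 4 (by norm_num)] at himp₁ hdone₁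
    refine ⟨by rw [hr₁ 8 (by norm_num) (by norm_num), hk'], by omega, fun r hr' h6 => ?_,
      fun a ha' => ?_, ?_, by simp, hfr₁, ht₁.setReg (abs_natCast_le (by omega)),
      himp.trans himp₁, ?_, ?_⟩
    · rw [hself (by omega), hr₁ r (by omega) h6, hr r hr' h6]
    · rw [State.setReg_arr, ha₁ a ha', ha a ha']
    · rw [hself (by omega), hI₁]; rfl
    · intro k' hk'' y hy i hi x hx
      rcases Nat.lt_succ_iff_lt_or_eq.1 hk'' with hlt | rfl
      · exact (himp₁.le _).trans (hdone k' hlt y hy i hi x hx)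
      · exact hdone₁ y hy i hi x hx
    · have : (rQ * rQ).cost = 3 := rfl
      rw [add_mul]; omega
  · rintro τ' c' ⟨hr, ha, hI', -, hfr, ht', himp, hdone, hc'⟩
    refine ⟨hr, ha, hI', hfr, ht', himp, ?_, ?_⟩
    · intro i hi x hx y hy
      have hdiv : ∀ i < P, i / b < Q := fun i hi => by
        rw [Nat.div_lt_iff_lt_mul hb, h.mul_eq]; exact hi
      -- The number of the block containing the entry `(i, x)`.
      have hk : i / b * Q + x / b < Q * Q := by
        have := Nat.mul_le_mul_right Q (hdiv i hi)
        have := hdiv x hx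
        rw [Nat.succ_mul] at *; omega
      have := hdone _ hk y hy (i % b) (Nat.mod_lt _ hb) (x % b) (Nat.mod_lt _ hb)
      rw [Grid.vertex_div (hdiv x hx), Grid.vertex_mod (hdiv x hx), ← Nat.cast_add, ← Nat.cast_add,
        Nat.div_add_mod', Nat.div_add_mod'] at this
      exact this
    · have : (rQ * rQ).cost = 3 := rfl
      omega

theorem fillArr_natCast {f : ℤ → ℤ} {val : ℕ → ℤ} {m k : ℕ} (hk : k < m) :
    fillArr f (fun k => (k : ℤ)) val m k = val k :=
  fillArr_idx (idx := fun k => (k : ℤ)) Nat.cast_injective hk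

theorem index_lt {i y : ℕ} (hi : i < P) (hy : y < P) : i * P + y < P * P := by
  have := Nat.mul_le_mul_right P hi
  rw [Nat.succ_mul] at this; omega

/-- The state between two squarings: memories from number `I` are unused, and array `4` contains
the distances with respect to walks of at most `L` arcs. -/
structure Stage (n b P Q B S Z : ℕ) (w : WDigraph n) (L I : ℕ) (τ : State) : Prop where
  consts : Consts n b P Q B S τ
  tidy : Tidy Z τ
  index : τ.reg 6 = I
  fresh : ∀ a ≥ 6, ∀ j, (I : ℤ) ≤ j % (S : ℤ) → τ.arr a j = 0
  entry : ∀ j, |τ.arr 4 j| ≤ 4 * B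
  represents : Represents w P L B fun i j => τ.arr 4 (i * P + j)

/-- Array `5` is filled with infinity, lowered to the min-plus square by the blocks, and copied back
to array `4` with truncation; correctness is `Represents.square`. -/
theorem run_square (h : Params M D V W Z b P Q B S T) {w : WDigraph n} {L X : ℕ}
    (hs : Stage n b P Q B S Z w L I τ) (hIS : I + Q * Q ≤ S) (hn : n ≤ P)
    (hw : ∀ i j x, w i j = some x → |x| ≤ (X : ℤ)) (hB : L * 2 * X ≤ B) :
    Run W (squareProgram D M) τ c fun τ' c' =>
      Stage n b P Q B S Z w (L * 2) (I + Q * Q) τ' ∧ τ'.reg 7 = τ.reg 7 ∧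
      c' ≤ c + Q * Q * (6 * T + 23000 * (P * b)) + 100 * (P * P) := by
  have hZ := h.roomy.le
  have hW := h.roomy.lt_word
  have hPZ := h.sizeP
  have hPP : 1 ≤ P * P := Nat.mul_pos h.posP h.posP
  have hBZ : 4 * B ≤ Z := by
    have h1 := h.size
    have h2 : 1 ≤ b * b := Nat.mul_pos h.pos h.pos
    have h3 := Nat.mul_le_mul_left (100 * B) h2
    rw [← mul_assoc] at h3
    omega
  have hBZ' : |(4 : ℤ) * B| ≤ Z := by
    rw [abs_of_nonneg (by positivity)]; exact_mod_cast hBZ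
  have hB0 := h.posB
  have hc := hs.consts
  have hreg : ∀ {a : ℕ} {val : ℕ → ℤ} (k : ℕ) (τ : State), ∀ r < 12,
      (τ.filled 12 a (fun k => (k : ℤ)) val k).reg r = τ.reg r := fun k τ r hr => by
    rw [State.filled_reg, Function.update_of_ne (by omega)]
  have hcon : ∀ {a : ℕ} {val : ℕ → ℤ} (k : ℕ) {τ : State}, Consts n b P Q B S τ →
      Consts n b P Q B S (τ.filled 12 a (fun k => (k : ℤ)) val k) :=
    fun k τ hc => hc.of_eq fun r hr => hreg k τ r (by omega)
  have hM : ∀ {τ : State}, Consts n b P Q B S τ → (rP * rP).eval τ = (P * P : ℕ) := fun hc => by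
    simp [hc.regP]
  have htf : ∀ k ≤ P * P, Tidy Z (τ.filled 12 5 (fun k => (k : ℤ)) (fun _ => 4 * B) k) :=
    fun k hk => hs.tidy.filled (by omega) fun _ _ => hBZ'
  refine .seq (Run.fill (fun k => (k : ℤ)) (fun _ => 4 * B) (P * P) (by omega) (by omega)
    (fun k hk => ⟨hM (hcon k hc), (htf k hk).fits h.roomy (by decide) (by decide)⟩)
    (fun k hk => ⟨by simp, (htf k hk.le).fits h.roomy (by decide) (by decide)⟩)
    (fun k hk => ⟨by simp [(hcon k hc).regB],
      (htf k hk.le).fits h.roomy (by decide) (by decide)⟩) ?_)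
  set τ₁ := τ.filled 12 5 (fun k => (k : ℤ)) (fun _ => 4 * B) (P * P) with hτ₁
  have harr₁ : ∀ a, a ≠ 5 → τ₁.arr a = τ.arr a := fun a ha => by
    rw [hτ₁, State.filled_arr, Function.update_of_ne ha]
  have h5₁ : ∀ k < P * P, τ₁.arr 5 (k : ℕ) = 4 * B := fun k hk => by
    rw [hτ₁, State.filled_arr, Function.update_self, fillArr_natCast hk]
  have ht₁ := htf _ le_rfl
  refine .seq ((run_blocks (I := I) h (hcon _ hc) ht₁ (by rw [hreg _ _ 6 (by norm_num), hs.index]) hIS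
    (by rw [harr₁ 4 (by norm_num)]; exact hs.entry)
    (fun a ha => by rw [harr₁ a (by omega)]; exact hs.fresh a ha)).mono ?_)
  rintro τ₂ c₂ ⟨hr₂, ha₂, hI₂, hfr₂, ht₂, himp, hdone, hc₂⟩
  rw [harr₁ 4 (by norm_num)] at himp hdone
  have hcon₂ : Consts n b P Q B S τ₂ := (hcon (P * P) hc).of_eq fun r hr => hr₂ r (by omega) (by omega)
  have h4₂ : τ₂.arr 4 = τ.arr 4 := by rw [ha₂ 4 (by norm_num), harr₁ 4 (by norm_num)]
  set val : ℕ → ℤ := fun k => if τ₂.arr 5 k ≤ B then τ₂.arr 5 k else 4 * B with hval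
  have hvalZ : ∀ k, |val k| ≤ (Z : ℤ) := fun k => by
    simp only [hval]
    split_ifs
    exacts [ht₂.arr 5 (by norm_num) _, hBZ']
  have htf₂ : ∀ k ≤ P * P, Tidy Z (τ₂.filled 12 4 (fun k => (k : ℤ)) val k) :=
    fun k hk => ht₂.filled (by omega) fun _ _ => hvalZ _
  have hrep : Represents w P (L * 2) B fun i y =>
      (τ₂.filled 12 4 (fun k => (k : ℤ)) val (P * P)).arr 4 (i * P + y) := by
    have := hs.represents.square (D := fun i y => τ₂.arr 5 (i * P + y)) hn hw hB hB0
      (fun i hi y hy x hx => hdone i hi x hx y hy) (fun i hi y hy => ?_)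
    · have hentry : ∀ i < P, ∀ y < P,
          (τ₂.filled 12 4 (fun k => (k : ℤ)) val (P * P)).arr 4 (i * P + y) =
            if τ₂.arr 5 (i * P + y) ≤ B then τ₂.arr 5 (i * P + y) else 4 * B := by
        intro i hi y hy
        rw [State.filled_arr, Function.update_self]
        have := fillArr_natCast (f := τ₂.arr 4) (val := val) (index_lt hi hy)
        push_cast at this
        rw [this]
        simp [hval]
      refine ⟨fun i hi y hy k hk ℓ p => ?_, fun i hi y hy => ?_⟩
      · rw [hentry i hi y hy]; exact this.le i hi y hy k hk ℓ p
      · rw [hentry i hi y hy]; exact this.eq i hi y hy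
    · rcases himp.eq (i * P + y) with e | ⟨i', hi', x, hx, y', hy', e, e'⟩
      · left
        have := h5₁ _ (index_lt hi hy)
        push_cast at this
        rw [e, this]
      · right
        have e : i * P + y = i' * P + y' := by exact_mod_cast e
        have e1 : i = i' := by
          rw [← Grid.vertex_div (R := i) hy, e, Grid.vertex_div hy']
        have e2 : y = y' := by
          rw [← Grid.vertex_mod (R := i) hy, e, Grid.vertex_mod hy']
        subst e1 e2
        exact ⟨x, hx, e'⟩
  refine Run.fill (fun k => (k : ℤ)) val (P * P) (by omega) (by omega)
    (fun k hk => ⟨hM (hcon k hcon₂), (htf₂ k hk).fits h.roomy (by decide) (by decide)⟩)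
    (fun k hk => ⟨by simp, (htf₂ k hk.le).fits h.roomy (by decide) (by decide)⟩)
    (fun k hk => ⟨?_, (htf₂ k hk.le).fits h.roomy (by decide) (by decide)⟩) ⟨⟨hcon _ hcon₂,
      htf₂ _ le_rfl, by rw [hreg _ _ 6 (by norm_num), hI₂], ?_, ?_, hrep⟩, ?_, ?_⟩
  · rw [RExpr.eval_sel _ _ _ _ (RExpr.eval_le ..)]
    simp [hcon₂.regB, hval]
  · intro a ha j hj
    rw [State.filled_arr, Function.update_of_ne (by omega)]
    exact hfr₂ a ha j hj
  · intro j
    -- Later blocks require a bound on every cell of array `4`. Cells outside the matrix are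
    -- unchanged and keep the earlier bound.
    by_cases hj : ∃ k < P * P, ((k : ℕ) : ℤ) = j
    · obtain ⟨k, hk, rfl⟩ := hj
      have hi : k / P < P := Nat.div_lt_of_lt_mul hk
      have hy := Nat.mod_lt k h.posP
      have := hrep.eq_or_abs_le hw hB hi hy
      simp only [← Nat.cast_mul, ← Nat.cast_add, Nat.div_add_mod'] at this
      rcases this with e | e
      · rw [e, abs_of_nonneg (by positivity)]
      · exact e.trans (by linarith [(by positivity : (0 : ℤ) ≤ B)])
    · push Not at hj
      rw [State.filled_arr, Function.update_self, fillArr_of_ne hj, h4₂]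
      exact hs.entry j
  · rw [hreg _ _ 7 (by norm_num), hr₂ 7 (by norm_num) (by norm_num), hreg _ _ 7 (by norm_num)]
  · have e1 : (rP * rP).cost = 3 := rfl
    have e2 : (RExpr.sel (.le (.get 5 rx) rB) (.get 5 rx) (.const 4 * rB)).cost = 18 := rfl
    have e3 : (RExpr.const 4 * rB).cost = 3 := rfl
    have e4 : rx.cost = 1 := rfl
    rw [e1, e3, e4] at hc₂
    rw [e1, e2, e4]
    omega

end Reduction

namespace Reduction

open WordRAM DynAPSP Grid APSP

/-! ## The whole program -/

/-- Find the least `b` such that `b ^ q` is at least `n`, and compute the other parameters. -/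
def setupProgram (q d : ℕ) : Prog :=
  .seq (.assign 1 (.const 1))
  (.seq (.loop (.lt (.pow rb q) rN) (.assign 1 (rb + .const 1)))
  (.seq (.assign 2 (.pow rb q))
  (.seq (.assign 3 (rP / rb))
  (.seq (.assign 4 (.const 2 * .pow rP (d + 1)))
  (.seq (.assign 5 (rP * rP * rP))
  (.assign 7 (.const 1)))))))

/-- `RExpr.sel` evaluates both alternatives, so cells outside the input matrix are read as well.
This is harmless, since all cells of the arrays are bounded. -/
def initExpr : RExpr :=
  .sel (.eq (rx / rP) (rx % rP)) (.const 0)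
    (.sel (.lt (rx / rP) rN) (.sel (.lt (rx % rP) rN)
      (.sel (.eq (.get 0 (rx / rP * rN + rx % rP)) (.const 1))
        (.get 1 (rx / rP * rN + rx % rP)) (.const 4 * rB)) (.const 4 * rB)) (.const 4 * rB))

def initProgram : Prog := .forLoop 12 (rP * rP) (.put 4 rx initExpr)

def squaresProgram (D : Algorithm) (M : Model) : Prog :=
  .loop (.lt rL rN) (.seq (squareProgram D M) (.assign 7 (rL * .const 2)))

def distExpr : RExpr := .get 4 (rx / rN * rP + rx % rN)

def outputProgram : Prog :=
  .seq (.forLoop 12 (rN * rN) (.put 2 rx (.lt distExpr (.const 4 * rB))))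
    (.forLoop 12 (rN * rN) (.put 3 rx distExpr))

def apspProgram (D : Algorithm) (M : Model) (q d : ℕ) : Prog :=
  .seq (setupProgram q d) (.seq initProgram (.seq (squaresProgram D M) outputProgram))

variable {M : Model} {D : Algorithm} {V W Z n b P Q B S T I c q d : ℕ} {τ τ' : State}

/-- The powers make the cost of the expressions grow with `q` and `d`, so the fixed exponent in
`Roomy` does not suffice and a separate word bound is assumed. Incrementing `b` step by step is
cheap enough, as `b` is at most `P`. -/
theorem run_setup (hZ : 100 ≤ Z) (hW : Z ^ (2 * q + 2 * d + 100) < W) (ht : Tidy Z τ) (hb : 0 < b)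
    (hn : n ≤ b ^ q) (hlt : ∀ k, 0 < k → k < b → k ^ q < n) (hP : P = b ^ q) (hQ : Q = P / b)
    (hB : B = 2 * P ^ (d + 1)) (hS : S = P * P * P) (hbZ : b ≤ Z) (hPZ : P ≤ Z) (hBZ : B ≤ Z)
    (hSZ : S ≤ Z) (h0 : τ.reg 0 = n) (h6 : τ.reg 6 = 0) :
    Run W (setupProgram q d) τ c fun τ' c' =>
      Consts n b P Q B S τ' ∧ τ'.reg 6 = 0 ∧ τ'.reg 7 = 1 ∧ τ'.arr = τ.arr ∧ Tidy Z τ' ∧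
      c' ≤ c + (b + 1) * (4 * q + 2 * d + 60) := by
  have hfits : ∀ {e : RExpr} {τ : State}, e.Small Z τ → e.cost ≤ 2 * q + 2 * d + 100 → e.Fits W τ :=
    fun he hc => he.fits (by omega) hW hc
  have hset : ∀ k ≤ Z, Tidy Z (τ.setReg 1 (k : ℕ)) := fun k hk =>
    ht.setReg (abs_natCast_le hk)
  have hguard : ∀ k ≤ Z, (RExpr.lt (.pow rb q) rN).Fits W (τ.setReg 1 (k : ℕ)) := fun k hk =>
    hfits ((RExpr.small_lt ..).2 ⟨((hset k hk).small hZ (by decide)).pow (by omega) q,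
      (hset k hk).small hZ (by decide)⟩) (by simp; omega)
  refine .seq (.assign (hfits (ht.small hZ (by decide)) (by simp)) ?_)
  refine .seq (.loop (fun k τ' c' => τ' = τ.setReg 1 ((k + 1 : ℕ) : ℤ) ∧
    c' = c + 2 + k * (2 * q + 8)) (b - 1) ⟨by simp, by simp⟩ ?_ ?_)
  · rintro k hk _ c' ⟨rfl, rfl⟩
    refine ⟨hguard _ (by omega), ?_, .assign (hfits ((hset _ (by omega)).small hZ (by decide))
      (by simp)) ⟨?_, ?_⟩⟩
    · have := hlt (k + 1) (by omega) (by omega)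
      have : (((k + 1 : ℕ) : ℤ)) ^ q < n := by exact_mod_cast this
      push_cast at this
      simp [h0, this]
    · simp [State.setReg]
    · simp; ring
  · rintro _ c' ⟨rfl, rfl⟩
    rw [Nat.sub_add_cancel hb]
    have hnot : ¬ (b : ℤ) ^ q < n := by
      rw [not_lt]; exact_mod_cast hn
    have t1 := hset b hbZ
    refine ⟨hguard _ hbZ, by simp [h0, hnot], ?_⟩
    set τ₁ := τ.setReg 1 (b : ℤ) with hτ₁
    have e2 : (RExpr.pow rb q).eval τ₁ = (P : ℕ) := by simp [hτ₁, hP]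
    refine .seq (.assign (hfits ((t1.small hZ (by decide)).pow (by omega) q) (by simp; omega)) ?_)
    rw [e2]
    have t2 := t1.setReg (r := 2) (abs_natCast_le hPZ)
    set τ₂ := τ₁.setReg 2 (P : ℤ) with hτ₂
    have e3 : (rP / rb).eval τ₂ = (Q : ℕ) := by simp [hτ₂, hτ₁, hQ]
    refine .seq (.assign (hfits (t2.small hZ (by decide)) (by simp)) ?_)
    rw [e3]
    have t3 := t2.setReg (r := 3)
      (abs_natCast_le (show Q ≤ Z by rw [hQ]; exact (Nat.div_le_self _ _).trans hPZ))
    set τ₃ := τ₂.setReg 3 (Q : ℤ) with hτ₃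
    have e4 : (RExpr.const 2 * .pow rP (d + 1)).eval τ₃ = (B : ℕ) := by simp [hτ₃, hτ₂, hB]
    refine .seq (.assign (hfits ((RExpr.small_mul ..).2 ⟨t3.small hZ (by decide),
      (t3.small hZ (by decide)).pow (by omega) (d + 1)⟩) (by simp; omega)) ?_)
    rw [e4]
    have t4 := t3.setReg (r := 4) (abs_natCast_le hBZ)
    set τ₄ := τ₃.setReg 4 (B : ℤ) with hτ₄
    have e5 : (rP * rP * rP).eval τ₄ = (S : ℕ) := by simp [hτ₄, hτ₃, hτ₂, hS]
    refine .seq (.assign (hfits (t4.small hZ (by decide)) (by simp)) ?_)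
    rw [e5]
    have t5 := t4.setReg (r := 5) (abs_natCast_le hSZ)
    refine .assign (hfits (t5.small hZ (by decide)) (by simp)) ?_
    refine ⟨⟨?_, ?_, ?_, ?_, ?_, ?_⟩, ?_, ?_, ?_, t5.setReg ?_, ?_⟩
    any_goals simp [hτ₄, hτ₃, hτ₂, hτ₁, h0, h6]
    · omega
    · obtain ⟨b, rfl⟩ : ∃ b', b = b' + 1 := ⟨b - 1, by omega⟩
      simp only [Nat.add_sub_cancel]
      have : (b + 1 + 1) * (4 * q + 2 * d + 60) = b * (2 * q + 8) + b * (2 * q + 2 * d + 52) +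
        2 * (4 * q + 2 * d + 60) := by ring
      omega

theorem eval_initExpr (hc : Consts n b P Q B S τ) {k : ℕ} (hk : τ.reg 12 = k) :
    initExpr.eval τ = if k / P = k % P then 0 else if k / P < n then if k % P < n then
      if τ.arr 0 ((k / P : ℕ) * n + (k % P : ℕ)) = 1 then τ.arr 1 ((k / P : ℕ) * n + (k % P : ℕ))
        else 4 * B else 4 * B else 4 * B := by
  rw [initExpr, RExpr.eval_sel _ _ _ _ (RExpr.eval_eq ..)]
  simp only [RExpr.eval_sel _ _ _ _ (RExpr.eval_lt ..), RExpr.eval_sel _ _ _ _ (RExpr.eval_eq ..),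
    RExpr.eval_add, RExpr.eval_mul, RExpr.eval_div, RExpr.eval_mod, RExpr.eval_const,
    RExpr.eval_reg, RExpr.eval_get, hk, hc.regP, hc.regN, hc.regB]
  norm_cast

theorem run_init (h : Params M D V W Z b P Q B S T) {w : WDigraph n} (hc : Consts n b P Q B S τ)
    (ht : Tidy Z τ) (h6 : τ.reg 6 = 0) (ha : ∀ a, 2 ≤ a → ∀ j, τ.arr a j = 0)
    (hn : n ≤ P) (hw : NoNegativeCycle w)
    (h0 : ∀ i j : Fin n, τ.arr 0 (i * n + j) = if (w i j).isSome then 1 else 0)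
    (h1 : ∀ i j : Fin n, τ.arr 1 (i * n + j) = (w i j).getD 0)
    (hB : ∀ j, |τ.arr 1 j| ≤ B) :
    Run W initProgram τ c fun τ' c' =>
      Stage n b P Q B S Z w 1 0 τ' ∧ τ'.reg 7 = τ.reg 7 ∧ c' ≤ c + 200 * (P * P) := by
  have hZ := h.roomy.le
  have hW := h.roomy.lt_word
  have hPZ := h.sizeP
  have hPP : 1 ≤ P * P := Nat.mul_pos h.posP h.posP
  have hBZ : 4 * B ≤ Z := by
    have h1 := h.size
    have h2 : 1 ≤ b * b := Nat.mul_pos h.pos h.pos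
    have h3 := Nat.mul_le_mul_left (100 * B) h2
    rw [← mul_assoc] at h3
    omega
  set val : ℕ → ℤ := fun k => if k / P = k % P then 0 else if k / P < n then if k % P < n then
    if τ.arr 0 ((k / P : ℕ) * n + (k % P : ℕ)) = 1 then τ.arr 1 ((k / P : ℕ) * n + (k % P : ℕ))
      else 4 * B else 4 * B else 4 * B with hval
  have hv4 : ∀ k, |val k| ≤ 4 * (B : ℤ) := fun k => by
    have h4 : |(4 : ℤ) * B| ≤ 4 * B := by rw [abs_of_nonneg (by positivity)]
    simp only [hval]
    split_ifs
    · simp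
    · exact (hB _).trans (by linarith [(by positivity : (0 : ℤ) ≤ B)])
    all_goals exact h4
  have hv : ∀ k, |val k| ≤ (Z : ℤ) := fun k => (hv4 k).trans (by exact_mod_cast hBZ)
  have hreg : ∀ k, ∀ r < 12, (τ.filled 12 4 (fun k => (k : ℤ)) val k).reg r = τ.reg r :=
    fun k r hr => by rw [State.filled_reg, Function.update_of_ne (by omega)]
  have hcon : ∀ k, Consts n b P Q B S (τ.filled 12 4 (fun k => (k : ℤ)) val k) :=
    fun k => hc.of_eq fun r hr => hreg k r (by omega)
  have htf : ∀ k ≤ P * P, Tidy Z (τ.filled 12 4 (fun k => (k : ℤ)) val k) :=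
    fun k hk => ht.filled (by omega) fun _ _ => hv _
  refine Run.fill (fun k => (k : ℤ)) val (P * P) (by omega) (by omega)
    (fun k hk => ⟨by simp [(hcon k).regP], (htf k hk).fits h.roomy (by decide) (by decide)⟩)
    (fun k hk => ⟨by simp, (htf k hk.le).fits h.roomy (by decide) (by decide)⟩)
    (fun k hk => ⟨?_, (htf k hk.le).fits h.roomy (by decide) (by decide)⟩)
    ⟨⟨hcon _, htf _ le_rfl, by rw [hreg _ 6 (by norm_num), h6]; rfl, ?_, ?_, ?_⟩,
      hreg _ 7 (by norm_num), ?_⟩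
  · have hx : (τ.filled 12 4 (fun k => (k : ℤ)) val k).reg 12 = k := by simp
    have ha0 : ∀ a, a ≠ 4 → (τ.filled 12 4 (fun k => (k : ℤ)) val k).arr a = τ.arr a :=
      fun a ha => by rw [State.filled_arr, Function.update_of_ne ha]
    rw [eval_initExpr (hcon k) hx, ha0 0 (by norm_num), ha0 1 (by norm_num)]
  · intro a ha' j _
    rw [State.filled_arr, Function.update_of_ne (by omega), ha a (by omega)]
  · intro j
    rw [State.filled_arr, Function.update_self]
    exact abs_fillArr_le (fun j => by rw [ha 4 (by norm_num)]; simp) (fun k _ => hv4 k) j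
  · have hentry : ∀ i < P, ∀ y < P,
        (τ.filled 12 4 (fun k => (k : ℤ)) val (P * P)).arr 4 (i * P + y) =
          if i = y then 0 else if i < n then if y < n then
            if τ.arr 0 (i * n + y) = 1 then τ.arr 1 (i * n + y) else 4 * B else 4 * B else 4 * B := by
      intro i hi y hy
      rw [State.filled_arr, Function.update_self]
      have := fillArr_natCast (f := τ.arr 4) (val := val) (index_lt hi hy)
      push_cast at this
      rw [this]
      simp only [hval, Grid.vertex_div hy, Grid.vertex_mod hy]
    refine .init hw (fun i hi => by rw [hentry i hi i hi, if_pos rfl]) ?_ ?_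
    · intro i y hi hy x hne hx
      rw [hentry i (by omega) y (by omega), if_neg hne, if_pos hi, if_pos hy]
      have e0 := h0 ⟨i, hi⟩ ⟨y, hy⟩
      have e1 := h1 ⟨i, hi⟩ ⟨y, hy⟩
      rw [hx] at e0 e1
      rw [if_pos (by simpa using e0)]
      simpa using e1
    · intro i hi y hy hne hnone
      rw [hentry i hi y hy, if_neg hne]
      split_ifs with c1 c2 c3
      · have := h0 ⟨i, c1⟩ ⟨y, c2⟩
        rw [hnone c1 c2] at this
        simp only [c3] at this
        simp at this
      all_goals rfl
  · have e1 : (rP * rP).cost = 3 := rfl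
    have e2 : initExpr.cost ≤ 150 := by decide
    have e4 : rx.cost = 1 := rfl
    rw [e1, e4]
    have := Nat.mul_le_mul_left (P * P) (by omega : 3 + 1 + initExpr.cost + 8 ≤ 162)
    omega

/-- Each squaring doubles the number of arcs and uses up `Q * Q` memories. As long as the loop runs,
`2 ^ k < n`, so the doubled number of arcs stays within the budget `2 * n` that `hB` allows. -/
theorem run_squares (h : Params M D V W Z b P Q B S T) {w : WDigraph n} {X : ℕ}
    (hs : Stage n b P Q B S Z w 1 0 τ) (hL : τ.reg 7 = 1) (hIS : Nat.clog 2 n * (Q * Q) ≤ S)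
    (hn : n ≤ P) (hw : ∀ i j x, w i j = some x → |x| ≤ (X : ℤ)) (hB : 2 * n * X ≤ B) :
    Run W (squaresProgram D M) τ c fun τ' c' =>
      (∃ I, Stage n b P Q B S Z w (2 ^ Nat.clog 2 n) I τ') ∧
      c' ≤ c + Nat.clog 2 n * (Q * Q * (6 * T + 23000 * (P * b)) + 110 * (P * P)) + 4 := by
  have hZ := h.roomy.le
  have hPP : 1 ≤ P * P := Nat.mul_pos h.posP h.posP
  refine Run.loop (fun k τ' c' => Stage n b P Q B S Z w (2 ^ k) (k * (Q * Q)) τ' ∧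
    τ'.reg 7 = (2 ^ k : ℕ) ∧
    c' ≤ c + k * (Q * Q * (6 * T + 23000 * (P * b)) + 110 * (P * P))) (Nat.clog 2 n)
    ⟨by simpa using hs, by simpa using hL, by simp⟩ ?_ ?_
  · rintro k hk τ₁ c₁ ⟨hs₁, hL₁, hc₁⟩
    have hlt : 2 ^ k < n := (Nat.lt_clog_iff_pow_lt (by norm_num)).1 hk
    have hI : k * (Q * Q) + Q * Q ≤ S := by
      have := Nat.mul_le_mul_right (Q * Q) hk
      rw [Nat.succ_mul] at this
      omega
    have hLX : 2 ^ k * 2 * X ≤ B :=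
      (Nat.mul_le_mul_right X (by omega : 2 ^ k * 2 ≤ 2 * n)).trans hB
    refine ⟨hs₁.tidy.fits h.roomy (by decide) (by decide), ?_, .seq ((run_square h hs₁ hI hn hw
      hLX).mono ?_)⟩
    · have : ((2 ^ k : ℕ) : ℤ) < n := by exact_mod_cast hlt
      simp only [RExpr.eval_lt, RExpr.eval_reg, hL₁, hs₁.consts.regN, if_pos this]
      norm_num
    rintro τ₂ c₂ ⟨hs₂, hL₂, hc₂⟩
    have hval : (rL * .const 2).eval τ₂ = (2 ^ (k + 1) : ℕ) := by
      simp [hL₂, hL₁, pow_succ]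
    have hPZ := h.le_mul.trans h.sizeP
    have hne : ∀ r, r ≠ 7 → (τ₂.setReg 7 ((2 ^ (k + 1) : ℕ) : ℤ)).reg r = τ₂.reg r :=
      fun r hr => by rw [State.setReg_reg, Function.update_of_ne hr]
    refine .assign (hs₂.tidy.fits h.roomy (by decide) (by decide)) ?_
    rw [hval]
    refine ⟨⟨hs₂.consts.of_eq fun r hr => hne r (by omega), hs₂.tidy.setReg ?_, ?_, ?_, hs₂.entry,
      ?_⟩, by simp, ?_⟩
    · refine abs_natCast_le ?_
      have h1 := h.sizeP
      have h2 : 2 ^ (k + 1) ≤ 2 * P := by rw [pow_succ]; omega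
      rcases Nat.lt_or_ge P 2 with h3 | h3
      · omega
      · exact h2.trans ((Nat.mul_le_mul_right P h3).trans h1)
    · rw [hne 6 (by norm_num), hs₂.index, Nat.succ_mul]
    · rw [Nat.succ_mul]; exact hs₂.fresh
    · rw [pow_succ]; exact hs₂.represents
    · have e1 : (rL * .const 2).cost = 3 := rfl
      have e2 : (RExpr.lt rL rN).cost = 3 := rfl
      rw [e1, Nat.succ_mul]
      rw [e2] at hc₂
      omega
  · rintro τ₁ c₁ ⟨hs₁, hL₁, hc₁⟩
    have hle : n ≤ 2 ^ Nat.clog 2 n := Nat.le_pow_clog (by norm_num) n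
    have : ¬ ((2 ^ Nat.clog 2 n : ℕ) : ℤ) < n := by exact_mod_cast not_lt.2 hle
    refine ⟨hs₁.tidy.fits h.roomy (by decide) (by decide), ?_, ⟨_, hs₁⟩, ?_⟩
    · simp only [RExpr.eval_lt, RExpr.eval_reg, hL₁, hs₁.consts.regN, if_neg this]
    · have e2 : (RExpr.lt rL rN).cost = 3 := rfl
      omega

theorem run_output (h : Params M D V W Z b P Q B S T) {w : WDigraph n} {L X : ℕ}
    (hs : Stage n b P Q B S Z w L I τ) (hnP : n ≤ P) (hn : NoNegativeCycle w) (hL : n ≤ L)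
    (hw : ∀ i j x, w i j = some x → |x| ≤ (X : ℤ)) (hB : L * X ≤ B) :
    Run W outputProgram τ c fun τ' c' => IsOutput w τ' ∧ c' ≤ c + 100 * (P * P) := by
  have hZ := h.roomy.le
  have hW := h.roomy.lt_word
  have hPZ := h.sizeP
  have hnn : n * n ≤ P * P := Nat.mul_le_mul hnP hnP
  have hPP : 1 ≤ P * P := Nat.mul_pos h.posP h.posP
  set val : ℕ → ℤ := fun k => τ.arr 4 ((k / n : ℕ) * P + (k % n : ℕ)) with hval
  set val' : ℕ → ℤ := fun k => if val k < 4 * B then 1 else 0 with hval'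
  have hreg : ∀ (a : ℕ) (val : ℕ → ℤ) k (τ : State), ∀ r < 12,
      (τ.filled 12 a (fun k => (k : ℤ)) val k).reg r = τ.reg r :=
    fun a val k τ r hr => by rw [State.filled_reg, Function.update_of_ne (by omega)]
  have hcon : ∀ (a : ℕ) (val : ℕ → ℤ) k {τ : State}, Consts n b P Q B S τ →
      Consts n b P Q B S (τ.filled 12 a (fun k => (k : ℤ)) val k) :=
    fun a val k τ hc => hc.of_eq fun r hr => hreg a val k τ r (by omega)
  have hN : ∀ {τ : State}, Consts n b P Q B S τ → (rN * rN).eval τ = (n * n : ℕ) := fun hc => by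
    simp [hc.regN]
  have hdist : ∀ {τ' : State} {k : ℕ}, Consts n b P Q B S τ' → τ'.reg 12 = k →
      τ'.arr 4 = τ.arr 4 → distExpr.eval τ' = val k := fun hc hk h4 => by
    simp [distExpr, hc.regN, hc.regP, hk, h4, hval]
  have ht₁ : ∀ k ≤ n * n, Tidy Z (τ.filled 12 2 (fun k => (k : ℤ)) val' k) :=
    fun k hk => hs.tidy.filled (by omega) fun k _ => by
      simp only [hval']
      split_ifs
      · rw [abs_one]; exact_mod_cast (by omega : 1 ≤ Z)
      · simp
  have h4₁ : ∀ k, (τ.filled 12 2 (fun k => (k : ℤ)) val' k).arr 4 = τ.arr 4 := fun k => by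
    rw [State.filled_arr, Function.update_of_ne (by norm_num)]
  refine .seq (Run.fill (fun k => (k : ℤ)) val' (n * n) (by omega) (by omega)
    (fun k hk => ⟨hN (hcon _ _ k hs.consts), (ht₁ k hk).fits h.roomy (by decide) (by decide)⟩)
    (fun k hk => ⟨by simp, (ht₁ k hk.le).fits h.roomy (by decide) (by decide)⟩)
    (fun k hk => ⟨?_, (ht₁ k hk.le).fits h.roomy (by decide) (by decide)⟩) ?_)
  · rw [RExpr.eval_lt, hdist (k := k) (hcon _ _ k hs.consts) (by simp) (h4₁ k)]
    simp [hs.consts.regB, hval']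
  set τ₁ := τ.filled 12 2 (fun k => (k : ℤ)) val' (n * n) with hτ₁
  have hc₁ : Consts n b P Q B S τ₁ := hcon _ _ _ hs.consts
  have ht₂ : ∀ k ≤ n * n, Tidy Z (τ₁.filled 12 3 (fun k => (k : ℤ)) val k) :=
    fun k hk => (ht₁ _ le_rfl).filled (by omega) fun k _ => hs.tidy.arr 4 (by norm_num) _
  have h4₂ : ∀ k, (τ₁.filled 12 3 (fun k => (k : ℤ)) val k).arr 4 = τ.arr 4 := fun k => by
    rw [State.filled_arr, Function.update_of_ne (by norm_num), h4₁]
  refine Run.fill (fun k => (k : ℤ)) val (n * n) (by omega) (by omega)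
    (fun k hk => ⟨hN (hcon _ _ k hc₁), (ht₂ k hk).fits h.roomy (by decide) (by decide)⟩)
    (fun k hk => ⟨by simp, (ht₂ k hk.le).fits h.roomy (by decide) (by decide)⟩)
    (fun k hk => ⟨hdist (hcon _ _ k hc₁) (by simp) (h4₂ k),
      (ht₂ k hk.le).fits h.roomy (by decide) (by decide)⟩) ⟨fun i j => ?_, ?_⟩
  · have hv : val (i * n + j) = τ.arr 4 (i * P + j) := by
      simp only [hval, Grid.vertex_div j.2, Grid.vertex_mod j.2]
    have e2 : (τ₁.filled 12 3 (fun k => (k : ℤ)) val (n * n)).arr 2 (i * n + j) =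
        if τ.arr 4 (i * P + j) < 4 * B then 1 else 0 := by
      rw [State.filled_arr, Function.update_of_ne (by norm_num), hτ₁, State.filled_arr,
        Function.update_self]
      have := fillArr_natCast (f := τ.arr 2) (val := val') (index_lt i.2 j.2)
      push_cast at this
      rw [this]
      simp only [hval', hv]
    have e3 : (τ₁.filled 12 3 (fun k => (k : ℤ)) val (n * n)).arr 3 (i * n + j) =
        τ.arr 4 (i * P + j) := by
      rw [State.filled_arr, Function.update_self]
      have := fillArr_natCast (f := τ₁.arr 3) (val := val) (index_lt i.2 j.2)
      push_cast at this
      rw [this, hv]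
    obtain ⟨f1, f2⟩ := hs.represents.isLeast hnP hn hL hw hB h.posB i j
    rw [e2, e3]
    split_ifs with hlt
    exacts [.inl ⟨rfl, f1 hlt⟩, .inr ⟨rfl, f2 hlt⟩]
  · have e1 : (rN * rN).cost = 3 := rfl
    have e2 : (RExpr.lt distExpr (.const 4 * rB)).cost = 14 := rfl
    have e3 : distExpr.cost = 10 := rfl
    have e4 : rx.cost = 1 := rfl
    rw [e1, e2, e3, e4]
    omega

/-! ### The input of the static problem and the complete run -/

theorem inputState_reg (w : WDigraph n) (r : ℕ) :
    (APSP.inputState w).reg r = if r = 0 then (n : ℤ) else 0 := by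
  simp only [APSP.inputState, State.loadArr, State.loadRegs, State.zero]
  match r with
  | 0 => simp
  | r + 1 => simp

theorem inputState_arr_of_le (w : WDigraph n) {a : ℕ} (ha : 2 ≤ a) (j : ℤ) :
    (APSP.inputState w).arr a j = 0 := by
  simp only [APSP.inputState, State.loadArr, State.loadRegs, State.zero]
  rw [Function.update_of_ne (by omega), Function.update_of_ne (by omega)]

theorem loadArr_ofFn (σ : State) (a : ℕ) (f : Fin n → Fin n → ℤ) (i j : Fin n) :
    (σ.loadArr a (List.ofFn fun k : Fin (n * n) => f k.divNat k.modNat)).arr a (i * n + j) =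
      f i j := by
  have hk : (i : ℕ) * n + j < n * n := index_lt i.2 j.2
  have e : ((i : ℤ) * n + j).toNat = (i : ℕ) * n + j := by
    rw [← Nat.cast_mul, ← Nat.cast_add, Int.toNat_natCast]
  simp only [State.loadArr, Function.update_self]
  rw [if_pos (by positivity), e, List.getD_eq_getElem _ _ (by simpa using hk), List.getElem_ofFn]
  congr 1
  · ext; simp [Fin.divNat, Grid.vertex_div j.2]
  · ext; simp [Fin.modNat, Grid.vertex_mod j.2]

theorem abs_loadArr_ofFn_le (σ : State) (a : ℕ) {m X : ℕ} {f : Fin m → ℤ} (hf : ∀ k, |f k| ≤ (X : ℤ))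
    (j : ℤ) : |(σ.loadArr a (List.ofFn f)).arr a j| ≤ (X : ℤ) := by
  simp only [State.loadArr, Function.update_self]
  split_ifs
  · rcases lt_or_ge j.toNat m with h | h
    · rw [List.getD_eq_getElem _ _ (by simpa using h), List.getElem_ofFn]
      exact hf _
    · rw [List.getD_eq_default _ _ (by simpa using h)]; simp
  · simp

theorem inputState_arr_zero (w : WDigraph n) : (APSP.inputState w).arr 0 = (State.zero.loadArr 0
    (List.ofFn fun k : Fin (n * n) => if (w k.divNat k.modNat).isSome then 1 else 0)).arr 0 := by
  simp only [APSP.inputState, State.loadArr]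
  rw [Function.update_of_ne (by norm_num), Function.update_self, Function.update_self]

theorem inputState_arr_one (w : WDigraph n) : (APSP.inputState w).arr 1 = (State.zero.loadArr 1
    (List.ofFn fun k : Fin (n * n) => (w k.divNat k.modNat).getD 0)).arr 1 := by
  simp only [APSP.inputState, State.loadArr]
  rw [Function.update_self, Function.update_self]

theorem run_apsp (h : Params M D V W Z b P Q B S T) {w : WDigraph n}
    (hW : Z ^ (2 * q + 2 * d + 100) < W) (hn0 : 0 < n) (hn : n ≤ b ^ q)
    (hlt : ∀ k, 0 < k → k < b → k ^ q < n)
    (hP : P = b ^ q) (hQ : Q = P / b) (hq : 0 < q) (hB : B = 2 * P ^ (d + 1)) (hS : S = P * P * P)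
    (hneg : NoNegativeCycle w) (hw : ∀ i j x, w i j = some x → |x| ≤ (n : ℤ) ^ d) :
    ∃ t σ, Exec W (apspProgram D M q d) (APSP.inputState w) t σ ∧ IsOutput w σ ∧
      t ≤ (b + 1) * (4 * q + 2 * d + 60) +
        Nat.clog 2 n * (Q * Q * (6 * T + 23000 * (P * b)) + 110 * (P * P)) + 400 * (P * P) := by
  have hZ := h.roomy.le
  have hnP : n ≤ P := hP ▸ hn
  have hPZ := h.le_mul.trans h.sizeP
  have hbP : b ≤ P := hP ▸ Nat.le_self_pow hq.ne' b
  have hBZ : B ≤ Z := by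
    have h1 := h.size
    have h2 : 1 ≤ b * b := Nat.mul_pos h.pos h.pos
    have h3 := Nat.mul_le_mul_left (100 * B) h2
    rw [← mul_assoc] at h3
    omega
  have hpow : n * n ^ d ≤ P ^ (d + 1) := by
    rw [← pow_succ']; exact Nat.pow_le_pow_left hnP _
  have hXB : n ^ d ≤ B := by
    have := Nat.le_mul_of_pos_left (n ^ d) hn0
    omega
  have hw' : ∀ i j x, w i j = some x → |x| ≤ ((n ^ d : ℕ) : ℤ) := by push_cast; exact hw
  have h1 : ∀ j, |(APSP.inputState w).arr 1 j| ≤ ((n ^ d : ℕ) : ℤ) := by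
    rw [inputState_arr_one]
    refine abs_loadArr_ofFn_le _ _ fun k => ?_
    cases e : w k.divNat k.modNat with
    | none => simp
    | some x => exact hw' _ _ _ e
  have h0 : ∀ j, |(APSP.inputState w).arr 0 j| ≤ ((1 : ℕ) : ℤ) := by
    rw [inputState_arr_zero]
    refine abs_loadArr_ofFn_le _ _ fun k => ?_
    split_ifs <;> simp
  have ht : Tidy Z (APSP.inputState w) := by
    refine ⟨fun r _ => ?_, fun a _ j => ?_⟩
    · rw [inputState_reg]
      split_ifs
      · exact abs_natCast_le (hnP.trans hPZ)
      · simp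
    · match a with
      | 0 => exact (h0 j).trans (by norm_cast; omega)
      | 1 => exact (h1 j).trans (by exact_mod_cast hXB.trans hBZ)
      | a + 2 => rw [inputState_arr_of_le w (by omega)]; simp
  have hB1 : 2 * n * n ^ d ≤ B := by rw [mul_assoc]; omega
  have hB2 : 2 ^ Nat.clog 2 n * n ^ d ≤ B := by
    refine (Nat.mul_le_mul_right _ ?_).trans hB1
    rcases Nat.eq_zero_or_pos (Nat.clog 2 n) with h0 | h0
    · rw [h0]; omega
    · obtain ⟨k, hk⟩ := Nat.exists_eq_add_one.2 h0
      have := (Nat.lt_clog_iff_pow_lt (b := 2) (by norm_num)).1 (show k < Nat.clog 2 n by omega)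
      rw [hk, pow_succ]
      omega
  -- `P ^ 3` memories are more than enough for all blocks of all squarings; their number influences
  -- only the word length.
  have hclog : Nat.clog 2 n * (Q * Q) ≤ S := by
    have : Nat.clog 2 n ≤ n := Nat.clog_le_of_le_pow Nat.lt_two_pow_self.le
    rw [hS, mul_assoc]
    exact Nat.mul_le_mul (this.trans hnP) (Nat.mul_le_mul h.Q_le h.Q_le)
  obtain ⟨t, σ, he, ho, htime⟩ : Run W (apspProgram D M q d) (APSP.inputState w) 0
      fun τ' c' => IsOutput w τ' ∧ c' ≤ (b + 1) * (4 * q + 2 * d + 60) +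
        Nat.clog 2 n * (Q * Q * (6 * T + 23000 * (P * b)) + 110 * (P * P)) + 400 * (P * P) := by
    refine .seq ((run_setup hZ hW ht h.pos hn hlt hP hQ hB hS (hbP.trans hPZ) hPZ hBZ h.sizeS
      (by rw [inputState_reg, if_pos rfl]) (by rw [inputState_reg, if_neg (by norm_num)])).mono ?_)
    rintro τ₁ c₁ ⟨hc₁, h6₁, h7₁, ha₁, ht₁, hc₁'⟩
    refine .seq ((run_init h hc₁ ht₁ h6₁ (fun a ha j => by rw [ha₁, inputState_arr_of_le w ha]) hnP
      hneg (fun i j => ?_) (fun i j => ?_) (fun j => ?_)).mono ?_)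
    · rw [ha₁, inputState_arr_zero]
      exact loadArr_ofFn _ _ (fun i j => if (w i j).isSome then 1 else 0) i j
    · rw [ha₁, inputState_arr_one]
      exact loadArr_ofFn _ _ (fun i j => (w i j).getD 0) i j
    · rw [ha₁]
      exact (h1 j).trans (by exact_mod_cast hXB)
    rintro τ₂ c₂ ⟨hs₂, h7₂, hc₂⟩
    refine .seq ((run_squares h hs₂ (h7₂.trans h7₁) hclog hnP hw' hB1).mono ?_)
    rintro τ₃ c₃ ⟨⟨I, hs₃⟩, hc₃⟩
    refine (run_output h hs₃ hnP hneg (Nat.le_pow_clog (by norm_num) n) hw' hB2).mono ?_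
    rintro τ₄ c₄ ⟨ho, hc₄⟩
    have hPP : 1 ≤ P * P := Nat.mul_pos h.posP h.posP
    exact ⟨ho, by omega⟩
  exact ⟨t, σ, he, ho, by omega⟩

end Reduction

namespace WordRAM

/-! ## Larger words -/

theorem RExpr.Fits.mono {W W' : ℕ} (h : W ≤ W') {σ : State} : ∀ {e : RExpr}, e.Fits W σ → e.Fits W' σ
  | .const _, he | .reg _, he => lt_of_lt_of_le he (by exact_mod_cast h)
  | .get _ _, he => ⟨he.1.mono h, lt_of_lt_of_le he.2 (by exact_mod_cast h)⟩
  | .bin _ _ _, he => ⟨he.1.mono h, he.2.1.mono h, lt_of_lt_of_le he.2.2 (by exact_mod_cast h)⟩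

theorem Exec.mono {W W' : ℕ} (h : W ≤ W') {p : Prog} {σ σ' : State} {t : ℕ} (he : Exec W p σ t σ') :
    Exec W' p σ t σ' := by
  induction he with
  | skip σ => exact .skip σ
  | assign σ x e he => exact .assign σ x e (he.mono h)
  | put σ a i e hi he => exact .put σ a i e (hi.mono h) (he.mono h)
  | seq _ _ ih₁ ih₂ => exact .seq ih₁ ih₂
  | condTrue hf he _ ih => exact .condTrue (hf.mono h) he ih
  | condFalse hf he _ ih => exact .condFalse (hf.mono h) he ih
  | loopStop hf he => exact .loopStop (hf.mono h) he
  | loopStep hf he _ _ ih₁ ih₂ => exact .loopStep (hf.mono h) he ih₁ ih₂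

end WordRAM

theorem DynAPSP.Algorithm.Serves.mono {D : DynAPSP.Algorithm} {W W' N : ℕ} (h : W ≤ W') :
    ∀ {os : List (DynAPSP.Op N)} {G : DynAPSP.WGraph N} {σ : WordRAM.State} {T : ℕ},
      D.Serves W G σ os T → D.Serves W' G σ os T
  | [], _, _, _, hs => hs
  | _ :: _, _, _, _, ⟨t, T', σ', he, ha, hs, hT⟩ => ⟨t, T', σ', he.mono h, ha, hs.mono h, hT⟩

namespace Reduction

open WordRAM DynAPSP Grid APSP

/-! ## The choice of the parameters -/

/-- Minimality of `b` gives `(b - 1) ^ q < n`, and `b ≤ 2 * (b - 1)` for `b ≥ 2`. Padding to `b ^ q`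
vertices thus costs only a constant factor. -/
theorem exists_base {n q : ℕ} (hn : 0 < n) (hq : 0 < q) :
    ∃ b, 0 < b ∧ n ≤ b ^ q ∧ (∀ k, 0 < k → k < b → k ^ q < n) ∧ b ^ q ≤ 2 ^ q * n := by
  have hex : ∃ b, 0 < b ∧ n ≤ b ^ q := ⟨n, hn, Nat.le_self_pow hq.ne' n⟩
  classical
  obtain ⟨h0, h1⟩ := Nat.find_spec hex
  have hlt : ∀ k, 0 < k → k < Nat.find hex → k ^ q < n := fun k hk hkb =>
    not_le.1 fun h => Nat.find_min hex hkb ⟨hk, h⟩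
  refine ⟨Nat.find hex, h0, h1, hlt, ?_⟩
  generalize Nat.find hex = b at *
  rcases Nat.lt_or_ge 1 b with hb | hb
  · have h2 := hlt (b - 1) (by omega) (by omega)
    calc b ^ q ≤ (2 * (b - 1)) ^ q := Nat.pow_le_pow_left (by omega) q
      _ = 2 ^ q * (b - 1) ^ q := mul_pow ..
      _ ≤ 2 ^ q * n := Nat.mul_le_mul_left _ h2.le
  · obtain rfl : b = 1 := by omega
    rw [one_pow]
    exact Nat.mul_pos (by positivity) hn

/-- Each of the `2 * P * b` commands of a block amounts to at most two operations, so the word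
length for `4 * P * b` operations serves all the sequences that occur. -/
theorem solves_of_algorithm {M : Model} {D : Algorithm} {c p k b B P : ℕ} {K a x : ℝ}
    (hD : ∀ (N : ℕ) (G : WGraph N) (L : List (Fin N × Fin N)),
      1 ≤ N → IsPlanar G.graph → (∀ e ∈ G.graph.edgeSet, G.weight e ≤ N ^ c) → IsEdgeList G L →
      ∃ (T₀ : ℕ) (σ₀ : State), Exec ((N + 2) ^ k) D.preprocess (DynAPSP.inputState G L) T₀ σ₀ ∧
        ∀ os : List (Op N), ValidSeq M c G os →
          ∃ T : ℕ, D.Serves ((N + os.length + 2) ^ k) G σ₀ os T ∧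
            (T₀ + T : ℝ) ≤ K * ((N : ℝ) ^ p + os.length * (N : ℝ) ^ a))
    (hc : 6 * (4 * B) * b ≤ (2 * b * b) ^ c)
    (hx : ∀ m : ℕ, m ≤ 4 * P * b →
      K * (((2 * b * b : ℕ) : ℝ) ^ p + m * ((2 * b * b : ℕ) : ℝ) ^ a) ≤ x) :
    ∃ j, (2 * b * b + 2) ^ j ≤ (2 * b * b + 4 * P * b + 2) ^ k ∧
      ∀ (A : ℕ → ℕ → ℤ) (hb : 0 < b) (l : List Command), Bounded b (4 * B) A (fun _ => 0) →
        (∀ k ∈ l, k.Ok b (4 * B)) → l.length ≤ P * (2 * b) → ∃ T₀ T₁ σ₀,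
        Exec ((2 * b * b + 2) ^ j) D.preprocess
          (DynAPSP.inputState (wgraph b (4 * B) A fun _ => 0) (edges b hb)) T₀ σ₀ ∧
        D.Serves ((2 * b * b + 4 * P * b + 2) ^ k) (wgraph b (4 * B) A fun _ => 0) σ₀
          (l.flatMap (Command.ops M b (4 * B) hb)) T₁ ∧ T₀ + T₁ ≤ ⌊x⌋₊ := by
  refine ⟨k, Nat.pow_le_pow_left (by omega) k, fun A hb l hA hl hlen => ?_⟩
  have hN : 1 ≤ 2 * b * b := by have := Nat.mul_pos hb hb; rw [mul_assoc]; omega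
  obtain ⟨T₀, σ₀, he, hs⟩ := hD (2 * b * b) (wgraph b (4 * B) A fun _ => 0) (edges b hb) hN
    (graph_isPlanar hb) (fun e he => (hA.wgraph_weight_le hb he).trans hc) (isEdgeList_edges hb)
  obtain ⟨T₁, hs₁, ht⟩ := hs _ (validSeq_ops hb hc l _ hA hl)
  have hm : (l.flatMap (Command.ops M b (4 * B) hb)).length ≤ 4 * P * b := by
    refine (length_ops_le hb l).trans ?_
    calc 2 * l.length ≤ 2 * (P * (2 * b)) := Nat.mul_le_mul_left _ hlen
      _ = 4 * P * b := by ring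
  exact ⟨T₀, T₁, σ₀, he, hs₁.mono (Nat.pow_le_pow_left (by omega) k),
    Nat.le_floor (by push_cast; exact ht.trans (hx _ hm))⟩

/-- All edge weights are at most `6 * U * b` with `U = 4 * B`, which is polynomial in `b` and hence
in the size `2 * b * b` of the grid. The summand `6` in the exponent absorbs the factor `48 ≤ 2 ^
6`. -/
theorem six_mul_le {b q d B : ℕ} (hb : 0 < b) (hB : B = 2 * (b ^ q) ^ (d + 1)) :
    6 * (4 * B) * b ≤ (2 * b * b) ^ (q * (d + 1) + 6) := by
  have h1 : 1 ≤ 2 ^ (q * (d + 1)) := Nat.one_le_two_pow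
  have h2 : b ^ (q * (d + 1) + 1) ≤ (b * b) ^ (q * (d + 1) + 6) := by
    rw [← pow_two, ← pow_mul]
    exact Nat.pow_le_pow_right hb (by omega)
  calc 6 * (4 * B) * b = 48 * b ^ (q * (d + 1) + 1) := by rw [hB, ← pow_mul]; ring
    _ ≤ 2 ^ (q * (d + 1) + 6) * (b * b) ^ (q * (d + 1) + 6) := Nat.mul_le_mul (by rw [pow_add]; omega) h2
    _ = (2 * b * b) ^ (q * (d + 1) + 6) := by rw [mul_assoc 2, mul_pow 2]

/-- The sum of the bounds for the registers used by the programs of the algorithm. -/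
def regBounds (D : Algorithm) : ℕ := D.preprocess.regBound + D.insertEdge.regBound +
  D.removeEdge.regBound + D.setWeight.regBound + D.query.regBound

/-- An exponent for the word length of the algorithm for all pairs shortest paths. -/
def wordExponent (D : Algorithm) (q d k : ℕ) : ℕ :=
  (5 + (q + 1) * (d + 4)) * (1000 + (2 * q + 2 * d + 100)) + (2 * q + 5) * k + 3 * (q + 1) +
    regBounds D + 1

/-- Every quantity involved is polynomial in `P`, hence in `n + 2`, with an exponent depending only
on `q`, `d`, `k` and the algorithm. Word length stays logarithmic. -/
theorem params_of_solves {M : Model} {D : Algorithm} {n b q d k T : ℕ} (hn : 0 < n) (hb : 0 < b)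
    (hq : 0 < q) (hbn : b ^ q ≤ 2 ^ q * n) (hs : ∃ j, (2 * b * b + 2) ^ j ≤ (2 * b * b + 4 * b ^ q * b + 2) ^ k ∧
      ∀ (A : ℕ → ℕ → ℤ) (hb : 0 < b) (l : List Command),
        Bounded b (4 * (2 * (b ^ q) ^ (d + 1))) A (fun _ => 0) →
        (∀ k ∈ l, k.Ok b (4 * (2 * (b ^ q) ^ (d + 1)))) → l.length ≤ b ^ q * (2 * b) → ∃ T₀ T₁ σ₀,
        Exec ((2 * b * b + 2) ^ j) D.preprocess (DynAPSP.inputState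
          (wgraph b (4 * (2 * (b ^ q) ^ (d + 1))) A fun _ => 0) (edges b hb)) T₀ σ₀ ∧
        D.Serves ((2 * b * b + 4 * b ^ q * b + 2) ^ k)
          (wgraph b (4 * (2 * (b ^ q) ^ (d + 1))) A fun _ => 0) σ₀
          (l.flatMap (Command.ops M b (4 * (2 * (b ^ q) ^ (d + 1))) hb)) T₁ ∧ T₀ + T₁ ≤ T) :
    Params M D ((2 * b * b + 4 * b ^ q * b + 2) ^ k) ((n + 2) ^ wordExponent D q d k)
        (200 * (b ^ q) ^ (d + 4)) b (b ^ q) (b ^ q / b) (2 * (b ^ q) ^ (d + 1))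
        (b ^ q * b ^ q * b ^ q) T ∧
      (200 * (b ^ q) ^ (d + 4)) ^ (2 * q + 2 * d + 100) < (n + 2) ^ wordExponent D q d k := by
  have hbP : b ≤ b ^ q := Nat.le_self_pow hq.ne' b
  have hQ : b ^ q / b * b = b ^ q := Nat.div_mul_cancel (dvd_pow_self b hq.ne')
  have hPs : b ^ q ≤ (n + 2) ^ (q + 1) := by
    rw [pow_succ]
    exact hbn.trans (Nat.mul_le_mul (Nat.pow_le_pow_left (by omega) q) (by omega))
  have hQ0 : 0 < b ^ q / b := Nat.div_pos hbP hb
  generalize b ^ q = P at *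
  have hP : 0 < P := hb.trans_le hbP
  have hs2 : 1 < n + 2 := by omega
  have h200 : 200 ≤ (n + 2) ^ 5 := le_trans (by norm_num) (Nat.pow_le_pow_left (by omega : 3 ≤ n + 2) 5)
  have hpow : ∀ {x e f : ℕ}, x ≤ (n + 2) ^ e → e < f → x < (n + 2) ^ f := fun hx hef =>
    hx.trans_lt (Nat.pow_lt_pow_right hs2 hef)
  have hZ : 200 * P ^ (d + 4) ≤ (n + 2) ^ (5 + (q + 1) * (d + 4)) := by
    rw [pow_add (n + 2), pow_mul]
    exact Nat.mul_le_mul h200 (Nat.pow_le_pow_left hPs _)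
  have hZm : ∀ m, (200 * P ^ (d + 4)) ^ m ≤ (n + 2) ^ ((5 + (q + 1) * (d + 4)) * m) := fun m => by
    rw [pow_mul]; exact Nat.pow_le_pow_left hZ m
  have hS : P * P * P ≤ (n + 2) ^ (3 * (q + 1)) := by
    rw [mul_comm 3, pow_mul, show P * P * P = P ^ 3 by ring]
    exact Nat.pow_le_pow_left hPs 3
  have hV : (2 * b * b + 4 * P * b + 2) ^ k ≤ (n + 2) ^ ((2 * q + 5) * k) := by
    rw [pow_mul]
    refine Nat.pow_le_pow_left ?_ k
    calc 2 * b * b + 4 * P * b + 2 ≤ 8 * (P * P) := by nlinarith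
      _ ≤ (n + 2) ^ 3 * ((n + 2) ^ (q + 1) * (n + 2) ^ (q + 1)) := Nat.mul_le_mul
        (le_trans (by norm_num) (Nat.pow_le_pow_left (by omega : 2 ≤ n + 2) 3)) (Nat.mul_le_mul hPs hPs)
      _ = _ := by ring
  have hreg : ∀ r ≤ regBounds D, r * (P * P * P) < (n + 2) ^ wordExponent D q d k := fun r hr => by
    have h1 : r ≤ (n + 2) ^ regBounds D := hr.trans (Nat.lt_pow_self hs2).le
    refine hpow ((Nat.mul_le_mul h1 hS).trans_eq (pow_add ..).symm) ?_
    unfold wordExponent; omega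
  have hP1 : ∀ i ≤ d + 4, P ^ i ≤ P ^ (d + 4) := fun i hi => Nat.pow_le_pow_right hP hi
  have hbb : b * b ≤ P * P := Nat.mul_le_mul hbP hbP
  have h1 : 1 ≤ P ^ (d + 4) := Nat.pow_pos hP
  have h2 : P * P ≤ P ^ (d + 4) := by rw [← pow_two]; exact hP1 2 (by omega)
  refine ⟨⟨⟨by omega, hpow (hZm _) ?_⟩, hpow ((Nat.mul_le_mul hV hS).trans_eq (pow_add ..).symm) ?_,
    hreg _ ?_, hreg _ ?_, hreg _ ?_, hreg _ ?_, hreg _ ?_, hb, hQ0, by positivity, hQ, ?_, ?_,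
    by omega, ?_, hs⟩, hpow (hZm _) ?_⟩
  · rw [wordExponent, mul_add _ 1000]; omega
  · unfold wordExponent; omega
  any_goals unfold regBounds; omega
  · calc 100 * (2 * P ^ (d + 1)) * b * b = 200 * (P ^ (d + 1) * (b * b)) := by ring
      _ ≤ 200 * (P ^ (d + 1) * (P * P)) := by gcongr
      _ = 200 * P ^ (d + 3) := by ring
      _ ≤ _ := Nat.mul_le_mul_left _ (hP1 _ (by omega))
  · rw [mul_assoc]; omega
  · rw [show P * P * P = P ^ 3 by ring]
    have := hP1 3 (by omega)
    omega
  · rw [wordExponent, mul_add _ 1000]; omega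

/-! ## The running time -/

/-- `Nat.clog 2 n ≤ 1 + 2 * log n` because `log 2 > 1 / 2`, and `log n ≤ n ^ δ / δ`. -/
theorem clog_add_one_le {n : ℕ} (hn : 0 < n) {δ : ℝ} (hδ : 0 < δ) :
    (Nat.clog 2 n + 1 : ℝ) ≤ (2 + 2 / δ) * (n : ℝ) ^ δ := by
  have hn1 : (1 : ℝ) ≤ n := by exact_mod_cast hn
  have h1 : 1 ≤ (n : ℝ) ^ δ := Real.one_le_rpow hn1 hδ.le
  have h2 : (Nat.clog 2 n : ℝ) ≤ 1 + 2 * Real.log n := by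
    have h0 := Real.log_nonneg hn1
    rcases Nat.eq_zero_or_pos (Nat.clog 2 n) with h | h
    · rw [h]; push_cast; linarith
    · obtain ⟨k, hk⟩ := Nat.exists_eq_add_one.2 h
      have := (Nat.lt_clog_iff_pow_lt (b := 2) (by norm_num)).1 (show k < Nat.clog 2 n by omega)
      have h3 : ((2 : ℝ) ^ k) ≤ n := by exact_mod_cast this.le
      have h4 := Real.log_le_log (by positivity) h3
      rw [Real.log_pow] at h4
      have h5 := Real.log_two_gt_d9
      have h6 : (0 : ℝ) ≤ k := by positivity
      rw [hk]; push_cast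
      nlinarith
  have h3 := Real.log_le_rpow_div (by linarith : (0 : ℝ) ≤ n) hδ
  calc (Nat.clog 2 n + 1 : ℝ) ≤ 2 * 1 + 2 * ((n : ℝ) ^ δ / δ) := by linarith
    _ ≤ 2 * (n : ℝ) ^ δ + 2 * ((n : ℝ) ^ δ / δ) := by gcongr
    _ = _ := by ring

/-- A factor for the running time of the algorithm for all pairs shortest paths. -/
noncomputable def timeConstant (K ε : ℝ) (p q d : ℕ) : ℝ :=
  (2 * (4 * q + 2 * d + 60) + (6 * (K * (2 ^ p + 8)) + 23000) + 510) * 2 ^ (3 * q) * (2 + 2 / (ε / q))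

/-- The operations on one grid cost about `b ^ (q + 1) * b ^ (1 - 2 * ε)`. The preprocessing, about
`b ^ (2 * p)`, is dominated since `2 * p + 2 ≤ q`. -/
theorem serve_time_le {b p q T : ℕ} {K ε : ℝ} (hε' : ε ≤ 1 / 2) (hε : 0 < ε) (hK : 0 ≤ K) (hb : 0 < b)
    (hq : 2 * p + 2 ≤ q) (hT : (T : ℝ) ≤ K * (((2 * b * b : ℕ) : ℝ) ^ p +
      (4 * b ^ q * b : ℕ) * ((2 * b * b : ℕ) : ℝ) ^ (1 / 2 - ε))) :
    (T : ℝ) ≤ K * (2 ^ p + 8) * (b : ℝ) ^ (q + 2 - 2 * ε) := by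
  have hb1 : (1 : ℝ) ≤ b := by exact_mod_cast hb
  have hb0 : (0 : ℝ) < b := by linarith
  have hq' : (2 * p + 2 : ℝ) ≤ q := by exact_mod_cast hq
  have e1 : ((2 * b * b : ℕ) : ℝ) ^ p ≤ 2 ^ p * (b : ℝ) ^ (q + 2 - 2 * ε) := by
    push_cast
    rw [mul_assoc, mul_pow, ← pow_two, ← pow_mul, ← Real.rpow_natCast (b : ℝ)]
    gcongr
    push_cast; linarith
  have e2 : ((2 * b * b : ℕ) : ℝ) ^ (1 / 2 - ε) ≤ 2 * (b : ℝ) ^ (1 - 2 * ε) := by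
    push_cast
    rw [mul_assoc, Real.mul_rpow (by norm_num) (by positivity), ← pow_two, ← Real.rpow_natCast (b : ℝ),
      ← Real.rpow_mul hb0.le, show ((2 : ℕ) : ℝ) * (1 / 2 - ε) = 1 - 2 * ε by push_cast; ring]
    gcongr
    calc (2 : ℝ) ^ (1 / 2 - ε) ≤ 2 ^ (1 : ℝ) := Real.rpow_le_rpow_of_exponent_le (by norm_num) (by linarith)
      _ = 2 := Real.rpow_one 2
  have e3 : (b : ℝ) ^ (q + 2 - 2 * ε) = (b : ℝ) ^ q * b * (b : ℝ) ^ (1 - 2 * ε) := by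
    rw [← pow_succ, ← Real.rpow_natCast, ← Real.rpow_add hb0]
    congr 1; push_cast; ring
  rw [mul_assoc K]
  refine hT.trans (mul_le_mul_of_nonneg_left ?_ hK)
  rw [add_mul]
  refine add_le_add e1 ?_
  calc ((4 * b ^ q * b : ℕ) : ℝ) * ((2 * b * b : ℕ) : ℝ) ^ (1 / 2 - ε)
      ≤ (4 * b ^ q * b : ℕ) * (2 * (b : ℝ) ^ (1 - 2 * ε)) := by gcongr
    _ = _ := by rw [e3]; push_cast; ring

/-- With `δ = ε / q`, all terms are at most a constant times `G * (Nat.clog 2 n + 1)`, where `G = b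
^ (3 * q - 2 * ε)` is of order at most `n ^ (3 - 2 * δ)`. One `δ` of the gain pays for the
logarithm. The other overheads lose at least one whole factor `b` against `b ^ (3 * q)`, which is
enough as `2 * ε ≤ 1`. -/
theorem time_le {n b p q d t T : ℕ} {K ε : ℝ} (hε : 0 < ε) (hε' : ε ≤ 1 / 2) (hK : 0 ≤ K) (hn : 0 < n)
    (hb : 0 < b) (hq : 2 * p + 2 ≤ q) (hbn : b ^ q ≤ 2 ^ q * n)
    (hT : (T : ℝ) ≤ K * (((2 * b * b : ℕ) : ℝ) ^ p +
      (4 * b ^ q * b : ℕ) * ((2 * b * b : ℕ) : ℝ) ^ (1 / 2 - ε)))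
    (ht : t ≤ (b + 1) * (4 * q + 2 * d + 60) + Nat.clog 2 n * ((b ^ q / b) * (b ^ q / b) *
      (6 * T + 23000 * (b ^ q * b)) + 110 * (b ^ q * b ^ q)) + 400 * (b ^ q * b ^ q)) :
    (t : ℝ) ≤ timeConstant K ε p q d * (n : ℝ) ^ (3 - ε / q) := by
  have hb1 : (1 : ℝ) ≤ b := by exact_mod_cast hb
  have hb0 : (0 : ℝ) < b := by linarith
  have hn0 : (0 : ℝ) < n := by exact_mod_cast hn
  obtain ⟨r, rfl⟩ : ∃ r, q = r + 1 := ⟨q - 1, by omega⟩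
  have hT' := serve_time_le hε' hε hK hb hq hT
  rw [show b ^ (r + 1) / b = b ^ r by rw [pow_succ, Nat.mul_div_cancel _ hb]] at ht
  have ht' : (t : ℝ) ≤ (b + 1) * (4 * (r + 1 : ℕ) + 2 * d + 60) + Nat.clog 2 n * (b ^ r * b ^ r *
      (6 * T + 23000 * (b ^ (r + 1) * b)) + 110 * (b ^ (r + 1) * b ^ (r + 1))) +
      400 * (b ^ (r + 1) * b ^ (r + 1)) := by exact_mod_cast ht
  set δ := ε / (r + 1 : ℕ) with hδ
  have hδ0 : 0 < δ := by positivity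
  have hδq : δ * (r + 1 : ℕ) = ε := by rw [hδ]; field_simp
  have hδ1 : δ ≤ 1 / 2 := by
    have : (1 : ℝ) ≤ (r + 1 : ℕ) := by exact_mod_cast Nat.le_add_left 1 r
    nlinarith
  set G := (b : ℝ) ^ (3 * (r + 1 : ℕ) - 2 * ε) with hG
  have hpow : ∀ m : ℕ, m + 1 ≤ 3 * (r + 1) → (b : ℝ) ^ m ≤ G := fun m hm => by
    rw [hG, ← Real.rpow_natCast]
    have : ((m : ℝ) + 1) ≤ 3 * (r + 1 : ℕ) := by exact_mod_cast hm
    exact Real.rpow_le_rpow_of_exponent_le hb1 (by linarith)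
  have g1 : (b : ℝ) ≤ G := by simpa using hpow 1 (by omega)
  have g2 : (b : ℝ) ^ (r + 1) * b ^ (r + 1) ≤ G := by
    rw [← pow_add]; exact hpow _ (by omega)
  have g3 : (b : ℝ) ^ r * b ^ r * (b ^ (r + 1) * b) ≤ G := by
    rw [← pow_succ, ← pow_add, ← pow_add]; exact hpow _ (by omega)
  have g4 : (b : ℝ) ^ r * b ^ r * T ≤ K * (2 ^ p + 8) * G := by
    calc (b : ℝ) ^ r * b ^ r * T
        ≤ b ^ r * b ^ r * (K * (2 ^ p + 8) * (b : ℝ) ^ ((r + 1 : ℕ) + 2 - 2 * ε)) := by gcongr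
      _ = K * (2 ^ p + 8) * (b ^ (r + r) * (b : ℝ) ^ ((r + 1 : ℕ) + 2 - 2 * ε)) := by ring
      _ = K * (2 ^ p + 8) * G := by
          rw [← Real.rpow_natCast (b : ℝ) (r + r), ← Real.rpow_add hb0, hG]
          congr 2; push_cast; ring
  have hG0 : 0 < G := by positivity
  set C := 2 * (4 * ((r + 1 : ℕ) : ℝ) + 2 * d + 60) + (6 * (K * (2 ^ p + 8)) + 23000) + 510 with hC
  have hC0 : 0 ≤ C := by positivity
  have h1 : (t : ℝ) ≤ C * G * (Nat.clog 2 n + 1) := by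
    have h2 : (b : ℝ) + 1 ≤ 2 * G := by linarith
    calc (t : ℝ) ≤ (b + 1) * (4 * (r + 1 : ℕ) + 2 * d + 60) + Nat.clog 2 n *
          (6 * (b ^ r * b ^ r * T) + 23000 * (b ^ r * b ^ r * (b ^ (r + 1) * b)) +
            110 * (b ^ (r + 1) * b ^ (r + 1))) + 400 * (b ^ (r + 1) * b ^ (r + 1)) := by
          refine ht'.trans_eq ?_; ring
      _ ≤ 2 * G * (4 * (r + 1 : ℕ) + 2 * d + 60) + Nat.clog 2 n *
          (6 * (K * (2 ^ p + 8) * G) + 23000 * G + 110 * G) + 400 * G := by gcongr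
      _ ≤ C * G * (Nat.clog 2 n + 1) := by
          rw [← sub_nonneg, show C * G * (Nat.clog 2 n + 1) - (2 * G * (4 * (r + 1 : ℕ) + 2 * d + 60) +
            Nat.clog 2 n * (6 * (K * (2 ^ p + 8) * G) + 23000 * G + 110 * G) + 400 * G) =
            Nat.clog 2 n * (G * (2 * (4 * ((r + 1 : ℕ) : ℝ) + 2 * d + 60) + 400)) +
            G * (6 * (K * (2 ^ p + 8)) + 23110) by rw [hC]; ring]
          positivity
  have h3 : G ≤ 2 ^ (3 * (r + 1)) * (n : ℝ) ^ (3 - 2 * δ) := by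
    calc G = ((b : ℝ) ^ (r + 1)) ^ (3 - 2 * δ) := by
          rw [← Real.rpow_natCast, ← Real.rpow_mul hb0.le, hG]
          congr 1; linear_combination 2 * hδq
      _ ≤ (2 ^ (r + 1) * (n : ℝ)) ^ (3 - 2 * δ) := by
          refine Real.rpow_le_rpow (by positivity) (by exact_mod_cast hbn) (by linarith)
      _ = (2 ^ (r + 1)) ^ (3 - 2 * δ) * (n : ℝ) ^ (3 - 2 * δ) :=
          Real.mul_rpow (by positivity) hn0.le
      _ ≤ (2 ^ (r + 1)) ^ (3 : ℝ) * (n : ℝ) ^ (3 - 2 * δ) := by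
          gcongr
          · exact one_le_pow₀ (by norm_num)
          · linarith
      _ = _ := by
          rw [show (3 : ℝ) = (3 : ℕ) by norm_num, Real.rpow_natCast, ← pow_mul, mul_comm 3]
  calc (t : ℝ) ≤ C * (2 ^ (3 * (r + 1)) * (n : ℝ) ^ (3 - 2 * δ)) * ((2 + 2 / δ) * (n : ℝ) ^ δ) :=
        h1.trans (by gcongr; exact clog_add_one_le hn hδ0)
    _ = C * 2 ^ (3 * (r + 1)) * (2 + 2 / δ) * ((n : ℝ) ^ (3 - 2 * δ) * (n : ℝ) ^ δ) := by ring
    _ = _ := by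
        rw [← Real.rpow_add hn0, timeConstant, ← hδ, ← hC]
        congr 2; ring

end Reduction

theorem theorem4 (hAPSP : APSP.Conjecture) (M : DynAPSP.Model) (ε : ℝ) (hε : 0 < ε) :
    ¬ ∃ p : ℕ, ∀ c : ℕ, DynAPSP.SolvableInTime M c p (1 / 2 - ε) := by
  rintro ⟨p, hp⟩
  -- Decreasing `ε` to at most `1 / 2` only weakens the assumed running time, as the grids have at
  -- least one vertex.
  have hε₁ : 0 < min ε (1 / 2) := lt_min hε (by norm_num)
  -- The exponent `q` depends on `p` alone. It must be fixed before `APSP.Conjecture` supplies the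
  -- weight exponent `d`, and `d` in turn determines the exponent `c` for the grids. This is why `p`
  -- has to be uniform in `c`.
  set q := 2 * p + 2 with hq
  have hq0 : (0 : ℝ) < q := by positivity
  obtain ⟨d, hd⟩ := hAPSP (min ε (1 / 2) / q) (by positivity)
  obtain ⟨D, K, k, hD⟩ := hp (q * (d + 1) + 6)
  refine hd ⟨Reduction.apspProgram D M q d,
    Reduction.timeConstant (max K 0) (min ε (1 / 2)) p q d, Reduction.wordExponent D q d k, fun n w hn hneg hw => ?_⟩
  obtain ⟨b, hb, hnb, hlt, hbn⟩ := Reduction.exists_base (q := q) hn (by omega)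
  -- A bound for the time spent on one block, with `max K 0` because `K` is not assumed nonnegative.
  set x : ℝ := max K 0 * (((2 * b * b : ℕ) : ℝ) ^ p +
      (4 * b ^ q * b : ℕ) * ((2 * b * b : ℕ) : ℝ) ^ (1 / 2 - min ε (1 / 2))) with hx
  have hx0 : 0 ≤ x := by positivity
  have hN : (1 : ℝ) ≤ (2 * b * b : ℕ) := by
    have := Nat.mul_pos hb hb
    exact_mod_cast (by rw [mul_assoc]; omega : 1 ≤ 2 * b * b)
  obtain ⟨hP, hW⟩ := Reduction.params_of_solves (M := M) (D := D) (d := d) hn hb (by omega) hbn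
    (Reduction.solves_of_algorithm (x := x) hD (Reduction.six_mul_le hb rfl) fun m hm => by
      rw [hx]
      gcongr
      · exact le_max_left ..
      · exact min_le_left ..)
  obtain ⟨t, σ, he, ho, ht⟩ := Reduction.run_apsp hP hW hn hnb hlt rfl rfl (by omega) rfl rfl hneg hw
  exact ⟨t, σ, he, ho, Reduction.time_le hε₁ (min_le_right ..) (le_max_right ..) hn hb hq.ge hbn
    (Nat.floor_le hx0) ht⟩
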